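/- **Setting.** Let $d\in\{2,3\}$, let $\Omega\subset\mathbb R^d$ be a bounded open set with boundary $\Gamma$, and let $1<r<\infty$ if $d=2$, $\tfrac65\le r\le 6$ if $d=3$; put $r'=r/(r-1)$. The data are: a measurable matrix field $K(x)\in\mathbb R^{d\times d}$ on $\Omega$, symmetric and uniformly positive definite, with $v^\top K(x)^{-1}v\ge\alpha_1|v|^2$; a viscosity $\nu:\mathbb R\to\mathbb R$ with $\nu_1\le\nu\le\nu_2$ and $|\nu(t_1)-\nu(t_2)|\le\gamma_\nu|t_1-t_2|$; a buoyancy $F:\mathbb R^2\to\mathbb R^d$ with $|F(y_1)-F(y_2)|\le\gamma_F|y_1-y_2|$ and $|F(y)|\le C_F|y|$; a constant matrix $D\in\mathbb R^{2\times2}$ with $s^\top Ds\ge\alpha_2|s|^2$. All of $\alpha_1,\alpha_2,\nu_1,\nu_2,\gamma_\nu,\gamma_F,C_F$ are positive. Put $\sigma=\|K^{-1}\|_{L^\infty(\Omega)}$ and $\bar\sigma=\|D\|$ (spectral norms). A mesh $\mathcal T_h$ of $\Omega$ is a finite set of pairwise disjoint open convex polytopes $K\subset\Omega$ with at most $2d$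 facets (triangles and convex quadrilaterals if $d=2$; tetrahedra, convex hexahedra, and other polyhedra with at most six faces if $d=3$) with $\overline\Omega=\bigcup\overline K$, such that each facet of a cell lies in $\Gamma$ (a boundary facet) or is a facet of another cell (otherwise it is an interior facet). It is $\bar\rho$-shape regular if $h_K/\rho_K\le\bar\rho$ for all $K$, where $h_K$ is the diameter of $K$ and $\rho_K$ the largest diameter of a ball in $K$. $V^{cr}_h$ and $\mathcal M^{cr}_h$ are the spaces of functions with values in $\mathbb R^d$ and $\mathbb R^2$, affine on each cell and continuous at the midpoints (barycentres) $m_e$ of the interior facets $e$; $V^{cr_0}_h$ and $\mathcal M^{cr_0}_h$ are the subspaces of functions vanishing at the midpoints of the boundary facets. With the broken gradient $\nabla_h$ and broken divergence $\operatorname{div}_h$, set $$\|v\|_{1,h}^2=\sigma\|v\|_{L^2(\Omega)}^2+\nu_2\|\nabla_hv\|_{L^2(\Omega)}^2\ (v\in V_h^{cr}),\qquad \|s\|_{1,h}^2=\bar\sigma\|\nabla_hs\|_{L^2(\Omega)}^2\ (s\in\mathcal M_h^{cr}),$$ $$a^h(s;u,v)=\int_\Omega K^{-1}u\cdot v+\nu(s_1)\nabla_hu:\nabla_hv,\qquad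 a^h_y(y,s)=\int_\Omega D\nabla_hy:\nabla_hs,$$ $$c^h(w,u,v)=\int_\Omega(w\cdot\nabla_h)u\cdot v+\sum_{K}\int_{\partial K\setminus\Gamma}\tfrac12\bigl(w\cdot n_K-|w\cdot n_K|\bigr)(u^e-u)\cdot v\,ds,$$ where $n_K$ is the outward unit normal, $w,u,v$ are taken from inside $K$, and $u^e$ is the trace of $u$ from the cell adjacent to $K$; $c^h_y(w,y,s)$ is given by the same formula with $y,s$ in place of $u,v$. Let $X_h$ be the set of $v\in V_h^{cr_0}$ with $\int_\Omega q\operatorname{div}_hv=0$ for all piecewise constant $q$ of zero mean. For a boundary datum $y^D\in L^2(\Gamma)^2$ and a control $U\in L^r(\Omega)^d$, a discrete state is a pair $(u_h,y_h)\in X_h\times\mathcal M_h^{cr}$ with $y_h(m_e)=\frac1{|e|}\int_ey^D\,ds$ for all boundary facets $e$ and $$a^h(y_h;u_h,v)+c^h(u_h,u_h,v)=\int_\Omega F(y_h)\cdot v+\int_\Omega U\cdot v\quad\forall v\in X_h,\qquad a^h_y(y_h,s)+c^h_y(u_h,y_h,s)=0\quad\forall s\in\mathcal M_h^{cr_0}.$$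 Positive numbers $\alpha_a^{nc},\alpha_2^{nc}$ are called coercivity constants for the mesh if $a^h(s;v,v)\ge\alpha_a^{nc}\|v\|_{1,h}^2$ for all $s\in\mathcal M_h^{cr}$, $v\in V_h^{cr_0}$ and $a^h_y(s,s)\ge\alpha_2^{nc}\|s\|_{1,h}^2$ for all $s\in\mathcal M_h^{cr_0}$. **Theorem.** Fix $d,\Omega,r$, the data $K,\nu,F,D$ (with their constants) and $\bar\rho>0$. There are coercivity constants valid for all meshes of $\Omega$. Moreover there is a constant $C_e^{nc}>0$, depending only on the quantities just fixed (not on the mesh, on $y^D$ or on controls), with the following properties. (i) For every $\bar\rho$-shape regular mesh, $\|v\|_{L^q(\Omega)}\le C_e^{nc}\|v\|_{1,h}$ for all $v\in V_h^{cr_0}$ and all $v\in\mathcal M_h^{cr_0}$ and $1\le q\le\max(6,r')$; $|c^h(w,u,v)|\le C_e^{nc}\|w\|_{1,h}\|u\|_{1,h}\|v\|_{1,h}$ for $w,u,v\in V_h^{cr_0}$; and $|c^h_y(w,y,s)|\le C_e^{nc}\|w\|_{1,h}\|y\|_{1,h}\|s\|_{1,h}$ for $w\in V_h^{cr_0}$,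 $y\in\mathcal M_h^{cr}$, $s\in\mathcal M_h^{cr_0}$. (ii) Let $\alpha_a^{nc},\alpha_2^{nc},\tilde M>0$ and $M_u^{nc},M_y^{nc}\ge0$ satisfy $$\alpha_a^{nc}>\frac{C_e^{nc}M_y^{nc}}{\alpha_2^{nc}}\bigl(\gamma_\nu\tilde M+C_F\bigr)+C_e^{nc}M_u^{nc}.$$ Then there is $C>0$, independent of the mesh, of $y^D$ and of the controls, such that for every $\bar\rho$-shape regular mesh for which $\alpha_a^{nc},\alpha_2^{nc}$ are coercivity constants and every $y^D\in L^2(\Gamma)^2$: * (Uniqueness) if, for a control $U\in L^r(\Omega)^d$, $(u_h,y_h)$ is a discrete state with $\|\nabla_hu_h\|_{L^3(\Omega)}\le\tilde M$, $\|u_h\|_{1,h}\le M_u^{nc}$, $\|y_h\|_{1,h}\le M_y^{nc}$, then every discrete state $(u_h',y_h')$ for the same $U$ with $\|u_h'\|_{1,h}\le M_u^{nc}$ equals $(u_h,y_h)$; * (Stability) if $(u_h(U_i),y_h(U_i))$ are discrete states for controls $U_i\in L^r(\Omega)^d$, $i=1,2$ (with the same $y^D$), with $\|u_h(U_i)\|_{1,h}\le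 M_u^{nc}$ for $i=1,2$, and $\|\nabla_hu_h(U_1)\|_{L^3(\Omega)}\le\tilde M$, $\|y_h(U_1)\|_{1,h}\le M_y^{nc}$, then $$\|u_h(U_1)-u_h(U_2)\|_{1,h}+\|y_h(U_1)-y_h(U_2)\|_{1,h}\le C\,\|U_1-U_2\|_{L^r(\Omega)}.$$ -/

import Mathlib

open MeasureTheory
open scoped ENNReal

noncomputable section

namespace NCFlow

/-- Euclidean space `ℝᵐ`. -/
abbrev Vec (m : ℕ) := EuclideanSpace ℝ (Fin m)

/-- The action of a square matrix on Euclidean space; its norm is the spectral norm. -/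
abbrev matOp {m : ℕ} (A : Matrix (Fin m) (Fin m) ℝ) : Vec m →L[ℝ] Vec m :=
  Matrix.toEuclideanCLM (n := Fin m) (𝕜 := ℝ) A

/-! ### The data of the flow problem -/

/-- Permeability `K`, viscosity `ν`, buoyancy `F` and diffusion matrix `D` on `Ω`, together with
the structural constants and the standing assumptions on them. -/
structure FlowData (d : ℕ) (Ω : Set (Vec d)) where
  K : Vec d → Matrix (Fin d) (Fin d) ℝ
  ν : ℝ → ℝ
  F : Vec 2 → Vec d
  D : Matrix (Fin 2) (Fin 2) ℝ
  α₁ : ℝ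
  α₂ : ℝ
  ν₁ : ℝ
  ν₂ : ℝ
  γν : ℝ
  γF : ℝ
  CF : ℝ
  α₁_pos : 0 < α₁
  α₂_pos : 0 < α₂
  ν₁_pos : 0 < ν₁
  ν₂_pos : 0 < ν₂
  γν_pos : 0 < γν
  γF_pos : 0 < γF
  CF_pos : 0 < CF
  /-- `K` is measurable on `Ω`. -/
  K_meas : ∀ i j, AEMeasurable (fun x => K x i j) (volume.restrict Ω)
  K_symm : ∀ x ∈ Ω, (K x).IsSymm
  /-- `K` is uniformly positive definite. -/
  K_posDef : ∃ κ : ℝ, 0 < κ ∧ ∀ x ∈ Ω, ∀ v : Vec d, κ * ‖v‖ ^ 2 ≤ inner ℝ v (matOp (K x) v)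
  K_inv : ∀ x ∈ Ω, ∀ v : Vec d, α₁ * ‖v‖ ^ 2 ≤ inner ℝ v (matOp (K x)⁻¹ v)
  ν_lipschitz : ∀ t₁ t₂ : ℝ, |ν t₁ - ν t₂| ≤ γν * |t₁ - t₂|
  ν_bounds : ∀ t : ℝ, ν₁ ≤ ν t ∧ ν t ≤ ν₂
  F_lipschitz : ∀ y₁ y₂ : Vec 2, ‖F y₁ - F y₂‖ ≤ γF * ‖y₁ - y₂‖
  F_growth : ∀ y : Vec 2, ‖F y‖ ≤ CF * ‖y‖
  D_posDef : ∀ s : Vec 2, α₂ * ‖s‖ ^ 2 ≤ inner ℝ s (matOp D s)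

/-- `σ = ‖K⁻¹‖_{∞,Ω}`. -/
def FlowData.sigma {d : ℕ} {Ω : Set (Vec d)} (P : FlowData d Ω) : ℝ :=
  (eLpNorm (fun x => matOp (P.K x)⁻¹) ∞ (volume.restrict Ω)).toReal

/-- `σ̄ = ‖D‖_{∞,Ω}` (the matrix `D` is constant). -/
def FlowData.sigmaBar {d : ℕ} {Ω : Set (Vec d)} (P : FlowData d Ω) : ℝ := ‖matOp P.D‖

/-! ### Meshes -/

/-- A mesh cell: a bounded open convex polytope in `ℝᵈ` with at most `2d` facets, described by the
outward unit normals and offsets of its facets. For `d = 2` these are exactly the triangles and the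
convex quadrilaterals; for `d = 3` they include the tetrahedra and the convex hexahedra. -/
structure Cell (d : ℕ) where
  numFacets : ℕ
  numFacets_le : numFacets ≤ 2 * d
  normal : Fin numFacets → Vec d
  offset : Fin numFacets → ℝ
  norm_normal : ∀ i, ‖normal i‖ = 1
  normal_offset_injective : Function.Injective fun i => (normal i, offset i)
  nonempty : {x : Vec d | ∀ i, inner ℝ (normal i) x < offset i}.Nonempty
  bounded : Bornology.IsBounded {x : Vec d | ∀ i, inner ℝ (normal i) x < offset i}
  /-- No inequality is redundant: every facet has positive `(d-1)`-dimensional measure. -/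
  facet_pos : ∀ i, 0 < μHE[d - 1]
    {x : Vec d | inner ℝ (normal i) x = offset i ∧ ∀ j, inner ℝ (normal j) x ≤ offset j}

/-- The open set of points of a cell. -/
def Cell.pts {d : ℕ} (c : Cell d) : Set (Vec d) := {x | ∀ i, inner ℝ (c.normal i) x < c.offset i}

/-- The `i`-th (closed) facet of a cell: an edge for `d = 2`, a face for `d = 3`. -/
def Cell.facet {d : ℕ} (c : Cell d) (i : Fin c.numFacets) : Set (Vec d) :=
  {x | inner ℝ (c.normal i) x = c.offset i ∧ ∀ j, inner ℝ (c.normal j) x ≤ c.offset j}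

/-- The midpoint (barycentre) of a facet. -/
def Cell.mid {d : ℕ} (c : Cell d) (i : Fin c.numFacets) : Vec d :=
  ⨍ x in c.facet i, x ∂μHE[d - 1]

/-- A face-to-face partition of `Ω` into finitely many cells. -/
structure Mesh (d : ℕ) (Ω : Set (Vec d)) where
  numCells : ℕ
  cell : Fin numCells → Cell d
  cell_subset : ∀ k, (cell k).pts ⊆ Ω
  disjoint : ∀ k k', k ≠ k' → Disjoint (cell k).pts (cell k').pts
  closure_eq : closure Ω = ⋃ k, closure (cell k).pts
  /-- Each facet of a cell lies on the boundary `Γ` or is a facet of another cell. -/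
  facet_cases : ∀ k i, (cell k).facet i ⊆ frontier Ω ∨
    ∃ k' i', k' ≠ k ∧ (cell k').facet i' = (cell k).facet i

namespace Mesh

variable {d : ℕ} {Ω : Set (Vec d)} (T : Mesh d Ω)

/-- The open cell `K_k`. -/
abbrev pts (k : Fin T.numCells) : Set (Vec d) := (T.cell k).pts

/-- The `i`-th facet of `K_k` is a boundary facet. -/
def IsBdry (k : Fin T.numCells) (i : Fin (T.cell k).numFacets) : Prop :=
  (T.cell k).facet i ⊆ frontier Ω

/-- `K_{k'}` is the cell adjacent to `K_k` across the interior facet `i` of `K_k`. -/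
def IsNeighbor (k : Fin T.numCells) (i : Fin (T.cell k).numFacets) (k' : Fin T.numCells) : Prop :=
  ¬ T.IsBdry k i ∧ k' ≠ k ∧ ∃ i', (T.cell k').facet i' = (T.cell k).facet i

/-- `ρ_K`: the supremum of the diameters of the balls contained in `s`. -/
def inDiam (s : Set (Vec d)) : ℝ :=
  sSup {δ : ℝ | ∃ x ε, Metric.ball x ε ⊆ s ∧ δ = Metric.diam (Metric.ball x ε)}

/-- Shape regularity `h_K / ρ_K ≤ ρ` for all cells. -/
def ShapeRegular (ρ : ℝ) : Prop :=
  ∀ k, Metric.diam (T.pts k) / inDiam (T.pts k) ≤ ρ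

/-- Piecewise affine (`ℙ₁`) functions on the mesh with values in `ℝᵐ`: one affine map per cell. -/
abbrev PW (m : ℕ) := Fin T.numCells → (Vec d →ᵃ[ℝ] Vec m)

variable {T}

/-- The lowest order Crouzeix–Raviart space: continuity at the midpoints of interior facets. -/
def IsCR {m : ℕ} (v : T.PW m) : Prop :=
  ∀ k i k', T.IsNeighbor k i k' → v k ((T.cell k).mid i) = v k' ((T.cell k).mid i)

/-- Crouzeix–Raviart functions that vanish at the midpoints of the boundary facets. -/
def IsCR0 {m : ℕ} (v : T.PW m) : Prop :=
  IsCR v ∧ ∀ k i, T.IsBdry k i → v k ((T.cell k).mid i) = 0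

/-- `∂_j` of an affine map. -/
def pderiv {m : ℕ} (f : Vec d →ᵃ[ℝ] Vec m) (j : Fin d) : Vec m :=
  f.linear (EuclideanSpace.single j (1 : ℝ))

/-- The Frobenius product `∇f : ∇g` of affine maps. -/
def gradInner {m : ℕ} (f g : Vec d →ᵃ[ℝ] Vec m) : ℝ := ∑ j, inner ℝ (pderiv f j) (pderiv g j)

/-- The Frobenius norm `|∇f|` of an affine map. -/
def gradNorm {m : ℕ} (f : Vec d →ᵃ[ℝ] Vec m) : ℝ := √(gradInner f f)

/-- The norm of `L^q(Ω)`. -/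
def lqNorm {m : ℕ} (q : ℝ) (v : T.PW m) : ℝ := (∑ k, ∫ x in T.pts k, ‖v k x‖ ^ q) ^ (1 / q)

/-- `‖∇_h v‖_{L^q(Ω)}` for the broken gradient. -/
def gradLqNorm {m : ℕ} (q : ℝ) (v : T.PW m) : ℝ :=
  (∑ k, ∫ _x in T.pts k, gradNorm (v k) ^ q) ^ (1 / q)

/-- The mesh and parameter dependent norm of velocities. -/
def normU (P : FlowData d Ω) (v : T.PW d) : ℝ :=
  √(∑ k, (P.sigma * (∫ x in T.pts k, ‖v k x‖ ^ 2) + P.ν₂ * ∫ _x in T.pts k, gradNorm (v k) ^ 2))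

/-- The mesh and parameter dependent (semi)norm of temperature–concentration pairs. -/
def normY (P : FlowData d Ω) (s : T.PW 2) : ℝ :=
  √(∑ k, P.sigmaBar * ∫ _x in T.pts k, gradNorm (s k) ^ 2)

/-! ### The discrete forms -/

/-- `aʰ(s; u, v)`; the viscosity is evaluated at the first component (temperature) of `s`. -/
def aForm (P : FlowData d Ω) (s : T.PW 2) (u v : T.PW d) : ℝ :=
  ∑ k, ∫ x in T.pts k,
    (inner ℝ (matOp (P.K x)⁻¹ (u k x)) (v k x) + P.ν (s k x 0) * gradInner (u k) (v k))

/-- `aʰ_y(y, s) = ∫ D ∇_h y : ∇_h s`. -/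
def aYForm (P : FlowData d Ω) (y s : T.PW 2) : ℝ :=
  ∑ k, ∫ _x in T.pts k, ∑ j, inner ℝ (matOp P.D (pderiv (y k) j)) (pderiv (s k) j)

open Classical in
/-- The upwind convective form: `cʰ(w, u, v)` for `m = d`, and `cʰ_y(w, u, v)` for `m = 2`. The
facet terms run over the parts of `∂K` off `Γ`, and the value from outside `K` is that of the
adjacent cell. -/
def convForm {m : ℕ} (w : T.PW d) (u v : T.PW m) : ℝ :=
  (∑ k, ∫ x in T.pts k, inner ℝ ((u k).linear (w k x)) (v k x)) +
  ∑ k, ∑ i, ∑ k', if T.IsNeighbor k i k' then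
    ∫ x in (T.cell k).facet i,
      (1 / 2) * (inner ℝ (w k x) ((T.cell k).normal i) - |inner ℝ (w k x) ((T.cell k).normal i)|) *
        inner ℝ (u k' x - u k x) (v k x) ∂μHE[d - 1]
  else 0

/-- `bʰ(v, q) = -∫ q div_h v` for piecewise constant `q`. -/
def bForm (v : T.PW d) (q : Fin T.numCells → ℝ) : ℝ :=
  -∑ k, ∫ _x in T.pts k, q k * LinearMap.trace ℝ (Vec d) (v k).linear

/-- `dʰ(s, v) = ∫ F(s) · v`. -/
def dForm (P : FlowData d Ω) (s : T.PW 2) (v : T.PW d) : ℝ :=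
  ∑ k, ∫ x in T.pts k, inner ℝ (P.F (s k x)) (v k x)

/-- The duality pairing `(U, v)_{r,r'} = ∫ U · v`. -/
def load (U : Vec d → Vec d) (v : T.PW d) : ℝ := ∑ k, ∫ x in T.pts k, inner ℝ (U x) (v k x)

/-- The discrete kernel of `bʰ`: orthogonality to the piecewise constants of zero mean. -/
def IsX (v : T.PW d) : Prop :=
  IsCR0 v ∧ ∀ q : Fin T.numCells → ℝ, (∑ k, ∫ _x in T.pts k, q k) = 0 → bForm v q = 0

/-- `(u, y)` solves the reduced discrete state problem with control `U` and boundary datum `yD`. The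
boundary condition prescribes, at the midpoint of each boundary facet, the mean of `yD` over it. -/
structure IsSolution (P : FlowData d Ω) (yD : Vec d → Vec 2) (U : Vec d → Vec d)
    (u : T.PW d) (y : T.PW 2) : Prop where
  u_mem : IsX u
  y_mem : IsCR y
  bdry : ∀ k i, T.IsBdry k i →
    y k ((T.cell k).mid i) = ⨍ x in (T.cell k).facet i, yD x ∂μHE[d - 1]
  momentum : ∀ v : T.PW d, IsX v →
    aForm P y u v + convForm u u v - dForm P y v - load U v = 0
  transport : ∀ s : T.PW 2, IsCR0 s → aYForm P y s + convForm u y s = 0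

/-- `αa` and `αy` are coercivity constants of `aʰ` and `aʰ_y` on the mesh. -/
def Coercive (T : Mesh d Ω) (P : FlowData d Ω) (αa αy : ℝ) : Prop :=
  (∀ (s : T.PW 2) (v : T.PW d), IsCR s → IsCR0 v → αa * normU P v ^ 2 ≤ aForm P s v v) ∧
  (∀ s : T.PW 2, IsCR0 s → αy * normY P s ^ 2 ≤ aYForm P s s)

/-- `Ce` is a constant in the discrete Sobolev embeddings into `L^q`, `1 ≤ q ≤ qmax`, and in the
continuity estimates of the convective forms. -/
def EmbeddingConst (T : Mesh d Ω) (P : FlowData d Ω) (qmax Ce : ℝ) : Prop :=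
  (∀ q : ℝ, 1 ≤ q → q ≤ qmax →
    (∀ v : T.PW d, IsCR0 v → lqNorm q v ≤ Ce * normU P v) ∧
    (∀ s : T.PW 2, IsCR0 s → lqNorm q s ≤ Ce * normY P s)) ∧
  (∀ w u v : T.PW d, IsCR0 w → IsCR0 u → IsCR0 v →
    |convForm w u v| ≤ Ce * normU P w * normU P u * normU P v) ∧
  (∀ (w : T.PW d) (y s : T.PW 2), IsCR0 w → IsCR y → IsCR0 s →
    |convForm w y s| ≤ Ce * normU P w * normY P y * normY P s)

end Mesh

end NCFlow

end

/-! Everything rests on a Sobolev inequality for Crouzeix–Raviart functions that is uniform over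
shape regular meshes. It is proved for piecewise constants. Let `M` be the cellwise constant
majorant `cellBound v`, a value of `|v|` plus diameter times `|∇v|`. Along a segment parallel to a
coordinate axis, a piecewise constant function changes only at the facets that are crossed. Hence
its `L¹` modulus of continuity is at most the step length times the sum of jump times (facet
diameter)^(d-1), which is `lintegral_pwConst_add_sub_le`. Mollification and the
Gagliardo–Nirenberg–Sobolev inequality turn this into an `L^{d/(d-1)}` bound,
`exists_wNorm_le_sum_jump`.

Apply that bound to `M^s` with `s = q(d-1)/d`. Continuity at facet midpoints bounds the jump of
`M^s` by `M^{s-1}` times diameter times gradient, summed over the two adjacent cells. Cauchy–Schwarz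
over facets, together with volume ≥ κ·diameter^d, gives `‖M‖_q^s ≤ C ‖M^{s-1}‖_2 ‖∇_h v‖_2`. When
`2(s-1) ≤ q`, the power `‖M‖_q^{s-1}` cancels and `‖M‖_q ≤ C ‖∇_h v‖_2` remains
(`exists_wNorm_cellBound_le`). This covers `q = 6` for `d = 3` and every `q > 2` for `d = 2`.

The convective form is not linear in its first argument, but `t ↦ (t - |t|)/2` is Lipschitz. The
same facet estimate therefore bounds the difference of two forms by the `L⁴`, `L²`, `L⁴` norms of `w
- w'`, `∇_h u`, `v` (`abs_convForm_sub_le`). The case `w' = 0` is the continuity estimate.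

For stability, subtract the equations of the two states and test with the differences
(`Bounds.transport_estimate`, `Bounds.momentum_estimate`). The norms are built from upper bounds of
the forms, so any coercivity constants on a nontrivial space are at most one. The hypothesis thus
forces `Ce * Mu ≤ 1` and `Ce * My * (γν * Mt + CF) ≤ 1` where these are needed. If `Ce` is large
compared with the embedding constant and with mesh independent coercivity constants `a`, `y`, all
nonlinear terms are absorbed (`Bounds.stability`). Uniqueness is stability with equal controls. -/

open MeasureTheory
open scoped ENNReal

/-! ### Hausdorff measure on hyperplanes and in codimension two -/

noncomputable section

namespace NCFlow

open Module

/-- An affine hyperplane is Lebesgue null. -/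
theorem volume_hyperplane {d : ℕ} {n : Vec d} (hn : n ≠ 0) (o : ℝ) :
    volume {x : Vec d | inner ℝ n x = o} = 0 := by
  rcases Set.eq_empty_or_nonempty {x : Vec d | inner ℝ n x = o} with h | ⟨z, hz⟩
  · rw [h, measure_empty]
  · have h1 : {x : Vec d | inner ℝ n x = o} =
        (fun x => -z + x) ⁻¹' ((ℝ ∙ n)ᗮ : Submodule ℝ (Vec d)) := by
      ext x
      simp only [Set.mem_ofPred_eq, Set.mem_preimage, SetLike.mem_coe,
        Submodule.mem_orthogonal_singleton_iff_inner_right, inner_add_right, inner_neg_right] at hz ⊢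
      rw [hz]
      constructor <;> intro h <;> linarith
    rw [h1, measure_preimage_add]
    apply Measure.addHaar_submodule
    intro h
    have : n ∈ (ℝ ∙ n)ᗮ := by rw [h]; trivial
    rw [Submodule.mem_orthogonal_singleton_iff_inner_right, inner_self_eq_zero] at this
    exact hn this

/-- On an affine subspace the Euclidean Hausdorff measure is the Lebesgue measure of its direction. -/
theorem euclideanHausdorffMeasure_eq_volume_of_sub_mem {d : ℕ} (W : Submodule ℝ (Vec d)) (z : Vec d)
    {S : Set (Vec d)} (hS : ∀ x ∈ S, x - z ∈ W) :
    μHE[finrank ℝ W] S = volume {w : W | z + (w : Vec d) ∈ S} := by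
  have hi : Isometry (fun w : W => z + (w : Vec d)) :=
    (IsometryEquiv.addLeft z).isometry.comp isometry_subtype_coe
  have h1 : S = (fun w : W => z + (w : Vec d)) '' {w : W | z + (w : Vec d) ∈ S} := by
    ext x
    constructor
    · intro hx
      exact ⟨⟨x - z, hS x hx⟩, by simpa using hx, by simp⟩
    · rintro ⟨w, hw, rfl⟩
      exact hw
  conv_lhs => rw [h1]
  rw [hi.euclideanHausdorffMeasure_image, InnerProductSpace.euclideanHausdorffMeasure_eq_volume]

/-- Ball volume constant in dimension `n`. -/
def ballVol (n : ℕ) : ℝ≥0∞ := volume (Metric.closedBall (0 : Vec n) 1)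

theorem ballVol_lt_top (n : ℕ) : ballVol n < ∞ := measure_closedBall_lt_top

/-- An orthonormal basis carries the unit ball of `V` to that of Euclidean space. The general `V` is
needed because the formula is applied to the direction space of a hyperplane. -/
theorem volume_closedBall_eq {V : Type*} [NormedAddCommGroup V] [InnerProductSpace ℝ V]
    [FiniteDimensional ℝ V] [MeasurableSpace V] [BorelSpace V] (x : V) {r : ℝ} (hr : 0 ≤ r) :
    volume (Metric.closedBall x r) = ENNReal.ofReal (r ^ finrank ℝ V) * ballVol (finrank ℝ V) := by
  rw [Measure.addHaar_closedBall' _ _ hr, ballVol]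
  congr 1
  have := (stdOrthonormalBasis ℝ V).repr.measurePreserving.measure_preimage
    (s := Metric.closedBall (0 : EuclideanSpace ℝ (Fin (finrank ℝ V))) 1)
    (Metric.isClosed_closedBall.measurableSet.nullMeasurableSet)
  rw [← this]
  congr 1
  ext x
  simp

theorem finrank_orthogonal_singleton {d : ℕ} {n : Vec d} (hn : n ≠ 0) :
    finrank ℝ ((ℝ ∙ n)ᗮ : Submodule ℝ (Vec d)) = d - 1 := by
  have h := (ℝ ∙ n).finrank_add_finrank_orthogonal
  rw [finrank_span_singleton hn, finrank_euclideanSpace_fin] at h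
  omega

theorem finrank_orthogonal_pair {d : ℕ} {n m : Vec d} (h : LinearIndependent ℝ ![n, m]) :
    finrank ℝ ((Submodule.span ℝ {n, m})ᗮ : Submodule ℝ (Vec d)) = d - 2 := by
  have h' := (Submodule.span ℝ {n, m}).finrank_add_finrank_orthogonal
  have h2 : finrank ℝ (Submodule.span ℝ {n, m}) = 2 := by
    have := finrank_span_eq_card h
    have h3 : Set.range ![n, m] = {n, m} := by simp [Set.pair_comm]
    rwa [h3, Fintype.card_fin] at this
  rw [h2, finrank_euclideanSpace_fin] at h'
  omega

/-- Area bound for a piece of a hyperplane. -/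
theorem euclideanHausdorffMeasure_hyperplane_le {d : ℕ} {n : Vec d} (hn : n ≠ 0) {o : ℝ}
    {S : Set (Vec d)} (hS : ∀ x ∈ S, inner ℝ n x = o) {z : Vec d} (hz : z ∈ S) {r : ℝ}
    (hr : 0 ≤ r) (hSr : ∀ x ∈ S, dist x z ≤ r) :
    μHE[d - 1] S ≤ ENNReal.ofReal (r ^ (d - 1)) * ballVol (d - 1) := by
  have h := euclideanHausdorffMeasure_eq_volume_of_sub_mem (ℝ ∙ n)ᗮ z (S := S) (by
    intro x hx
    rw [Submodule.mem_orthogonal_singleton_iff_inner_right, inner_sub_right, hS x hx, hS z hz,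
      sub_self])
  rw [finrank_orthogonal_singleton hn] at h
  rw [h]
  have h2 := volume_closedBall_eq (0 : ((ℝ ∙ n)ᗮ : Submodule ℝ (Vec d))) hr
  rw [finrank_orthogonal_singleton hn] at h2
  rw [← h2]
  apply measure_mono
  intro w hw
  have := hSr _ hw
  simpa [dist_eq_norm] using this

/-- Bounded pieces of codimension two have no area. -/
theorem euclideanHausdorffMeasure_codim_two {d : ℕ} (hd : 2 ≤ d) {n m : Vec d}
    (h : LinearIndependent ℝ ![n, m]) {o o' : ℝ} {S : Set (Vec d)} (hb : Bornology.IsBounded S)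
    (hS : ∀ x ∈ S, inner ℝ n x = o ∧ inner ℝ m x = o') : μHE[d - 1] S = 0 := by
  rcases S.eq_empty_or_nonempty with rfl | ⟨z, hz⟩
  · simp
  have h1 := euclideanHausdorffMeasure_eq_volume_of_sub_mem (Submodule.span ℝ {n, m})ᗮ z (S := S) (by
    intro x hx
    rw [Submodule.mem_orthogonal]
    intro u hu
    rw [Submodule.mem_span_pair] at hu
    obtain ⟨a, b, rfl⟩ := hu
    simp only [inner_add_left, inner_smul_left, inner_sub_right, (hS x hx).1, (hS x hx).2,
      (hS z hz).1, (hS z hz).2]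
    simp)
  rw [finrank_orthogonal_pair h] at h1
  -- Finite measure in dimension `d - 2` forces measure zero in dimension `d - 1`. The strict
  -- inequality between these truncated differences is where `2 ≤ d` enters.
  refine (Measure.euclideanHausdorffMeasure_zero_or_top (show d - 2 < d - 1 by omega) S).resolve_right ?_
  rw [h1]
  obtain ⟨r, hr⟩ := hb.subset_closedBall z
  apply ne_top_of_le_ne_top (measure_closedBall_lt_top (μ := volume)
    (x := (0 : ((Submodule.span ℝ {n, m})ᗮ : Submodule ℝ (Vec d)))) (r := r)).ne
  apply measure_mono
  intro w hw
  simpa using hr hw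

end NCFlow

end

/-! ### Geometry of a single cell -/

noncomputable section

namespace NCFlow

open Module

theorem nontrivial_of_isOpen {d : ℕ} (hd : 0 < d) {s : Set (Vec d)} (hs : IsOpen s) {x : Vec d}
    (hx : x ∈ s) : s.Nontrivial := by
  have : Nonempty (Fin d) := ⟨⟨0, hd⟩⟩
  have := Module.punctured_nhds_neBot ℝ (Vec d) x
  exact (infinite_of_mem_nhds x (hs.mem_nhds hx)).nontrivial

namespace Cell

variable {d : ℕ} (c : Cell d)

/-- The closed polytope of a cell. -/
def closedPts : Set (Vec d) := {x | ∀ i, inner ℝ (c.normal i) x ≤ c.offset i}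

theorem pts_subset_closedPts : c.pts ⊆ c.closedPts := fun _ hx i => (hx i).le

theorem isOpen_pts : IsOpen c.pts := by
  have : c.pts = ⋂ i, {x | inner ℝ (c.normal i) x < c.offset i} := by
    ext x; simp [pts]
  rw [this]
  exact isOpen_iInter_of_finite fun i => isOpen_lt (by fun_prop) continuous_const

theorem isClosed_closedPts : IsClosed c.closedPts := by
  have : c.closedPts = ⋂ i, {x | inner ℝ (c.normal i) x ≤ c.offset i} := by
    ext x; simp [closedPts]
  rw [this]
  exact isClosed_iInter fun i => isClosed_le (by fun_prop) continuous_const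

theorem convex_closedPts : Convex ℝ c.closedPts := by
  intro x hx y hy a b ha hb hab i
  rw [inner_add_right, inner_smul_right, inner_smul_right]
  have h1 := mul_le_mul_of_nonneg_left (hx i) ha
  have h2 := mul_le_mul_of_nonneg_left (hy i) hb
  have h3 : c.offset i = a * c.offset i + b * c.offset i := by rw [← add_mul, hab, one_mul]
  linarith

theorem pts_nonempty : c.pts.Nonempty := c.nonempty

theorem isBounded_pts : Bornology.IsBounded c.pts := c.bounded

/-- A small displacement towards a fixed interior point makes all the weak inequalities strict. -/
theorem closedPts_subset_closure : c.closedPts ⊆ closure c.pts := by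
  intro x hx
  obtain ⟨p, hp⟩ := c.pts_nonempty
  have h1 : Filter.Tendsto (fun t : ℝ => (1 - t) • x + t • p) (nhdsWithin 0 (Set.Ioi 0)) (nhds x) := by
    have : ContinuousAt (fun t : ℝ => (1 - t) • x + t • p) 0 := by fun_prop
    have h := this.tendsto
    simp only [sub_zero, one_smul, zero_smul, add_zero] at h
    exact h.mono_left nhdsWithin_le_nhds
  refine mem_closure_of_tendsto h1 ?_
  have h2 : ∀ᶠ t : ℝ in nhdsWithin 0 (Set.Ioi 0), t ∈ Set.Ioo (0 : ℝ) 1 :=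
    Ioo_mem_nhdsGT one_pos
  filter_upwards [h2] with t ht i
  rw [inner_add_right, inner_smul_right, inner_smul_right]
  have := hx i
  have := hp i
  nlinarith [ht.1, ht.2]

theorem closure_pts : closure c.pts = c.closedPts :=
  Set.Subset.antisymm (closure_minimal c.pts_subset_closedPts c.isClosed_closedPts)
    c.closedPts_subset_closure

/-- The diameter of a cell. -/
def diam : ℝ := Metric.diam c.pts

theorem diam_nonneg : 0 ≤ c.diam := Metric.diam_nonneg

theorem isBounded_closedPts : Bornology.IsBounded c.closedPts := by
  rw [← closure_pts]; exact c.isBounded_pts.closure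

theorem isCompact_closedPts : IsCompact c.closedPts :=
  Metric.isCompact_of_isClosed_isBounded c.isClosed_closedPts c.isBounded_closedPts

theorem dist_le_diam {x y : Vec d} (hx : x ∈ c.closedPts) (hy : y ∈ c.closedPts) :
    dist x y ≤ c.diam := by
  rw [diam, ← Metric.diam_closure, closure_pts]
  exact Metric.dist_le_diam_of_mem c.isBounded_closedPts hx hy

theorem facet_subset_closedPts (i) : c.facet i ⊆ c.closedPts := fun _ hx => hx.2

theorem isClosed_facet (i) : IsClosed (c.facet i) := by
  have : c.facet i = {x | inner ℝ (c.normal i) x = c.offset i} ∩ c.closedPts := rfl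
  rw [this]
  exact (isClosed_eq (by fun_prop) continuous_const).inter c.isClosed_closedPts

theorem isCompact_facet (i) : IsCompact (c.facet i) :=
  c.isCompact_closedPts.of_isClosed_subset (c.isClosed_facet i) (c.facet_subset_closedPts i)

theorem convex_facet (i) : Convex ℝ (c.facet i) := by
  intro x hx y hy a b ha hb hab
  refine ⟨?_, c.convex_closedPts hx.2 hy.2 ha hb hab⟩
  rw [inner_add_right, inner_smul_right, inner_smul_right, hx.1, hy.1, ← add_mul, hab, one_mul]

theorem normal_ne_zero (i) : c.normal i ≠ 0 := by
  intro h
  have := c.norm_normal i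
  rw [h, norm_zero] at this
  exact zero_ne_one this

theorem facet_nonempty (i) : (c.facet i).Nonempty := by
  rw [Set.nonempty_iff_ne_empty]
  intro h
  have := c.facet_pos i
  change 0 < μHE[d - 1] (c.facet i) at this
  rw [h, measure_empty] at this
  exact this.ne rfl

theorem facet_measure_le (i) {r : ℝ} (hr : ∀ x ∈ c.facet i, ∀ y ∈ c.facet i, dist x y ≤ r) :
    μHE[d - 1] (c.facet i) ≤ ENNReal.ofReal (r ^ (d - 1)) * ballVol (d - 1) := by
  obtain ⟨z, hz⟩ := c.facet_nonempty i
  have h0 : 0 ≤ r := by simpa using hr z hz z hz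
  exact euclideanHausdorffMeasure_hyperplane_le (c.normal_ne_zero i) (fun x hx => hx.1) hz h0
    fun x hx => hr x hx z hz

theorem facet_measure_lt_top (i) : μHE[d - 1] (c.facet i) < ∞ :=
  (c.facet_measure_le i (r := c.diam) fun _ hx _ hy => c.dist_le_diam
    (c.facet_subset_closedPts i hx) (c.facet_subset_closedPts i hy)).trans_lt
    (ENNReal.mul_lt_top ENNReal.ofReal_lt_top (ballVol_lt_top _))

theorem integrableOn_facet (i) {E : Type*} [NormedAddCommGroup E] {f : Vec d → E}
    (hf : Continuous f) : IntegrableOn f (c.facet i) μHE[d - 1] := by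
  have : IsFiniteMeasure ((μHE[d - 1] : Measure (Vec d)).restrict (c.facet i)) :=
    ⟨by simpa using c.facet_measure_lt_top i⟩
  obtain ⟨C, hC⟩ := (c.isCompact_facet i).exists_bound_of_continuousOn hf.continuousOn
  refine Integrable.mono' (integrable_const C) ?_ ?_
  · exact hf.continuousOn.aestronglyMeasurable_of_isCompact (c.isCompact_facet i)
      (c.isClosed_facet i).measurableSet
  · exact (ae_restrict_iff' (c.isClosed_facet i).measurableSet).2 (Filter.Eventually.of_forall hC)

/-- The mean over a closed convex set of positive finite measure stays in that set. -/
theorem mid_mem_facet (i) : c.mid i ∈ c.facet i := by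
  refine Convex.set_average_mem (c.convex_facet i) (c.isClosed_facet i) (c.facet_pos i).ne'
    (c.facet_measure_lt_top i).ne ?_ (c.integrableOn_facet i continuous_id)
  exact (ae_restrict_iff' (c.isClosed_facet i).measurableSet).2 (Filter.Eventually.of_forall
    fun _ hx => hx)

/-- Different facets whose hyperplanes meet have linearly independent normals. -/
theorem linearIndependent_normals {i j} (hij : i ≠ j) {z : Vec d}
    (hi : inner ℝ (c.normal i) z = c.offset i) (hj : inner ℝ (c.normal j) z = c.offset j) :
    LinearIndependent ℝ ![c.normal i, c.normal j] := by
  rw [LinearIndependent.pair_iff' (c.normal_ne_zero i)]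
  intro a ha
  have h1 : |a| = 1 := by
    have := c.norm_normal j
    rwa [← ha, norm_smul, c.norm_normal i, mul_one, Real.norm_eq_abs] at this
  have h2 : c.offset j = a * c.offset i := by rw [← hj, ← ha, inner_smul_left, hi]; simp
  -- Parallel unit normals agree up to sign. Equal normals repeat a constraint; opposite ones leave
  -- no room for an interior point.
  rcases eq_or_eq_neg_of_abs_eq h1 with rfl | rfl
  · apply hij
    apply c.normal_offset_injective
    simp only [one_smul, one_mul] at ha h2
    simp [ha, h2]
  · obtain ⟨p, hp⟩ := c.pts_nonempty
    have h3 := hp i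
    have h4 := hp j
    rw [← ha, h2, inner_smul_left] at h4
    simp at h4
    linarith

/-- Otherwise constraint `j` is active on the whole facet `i`, which then lies in an affine subspace
of codimension two and has no area, against `facet_pos`. -/
theorem exists_mem_facet_lt {i j} (hij : j ≠ i) :
    ∃ z ∈ c.facet i, inner ℝ (c.normal j) z < c.offset j := by
  by_contra! h
  have hd : 2 ≤ d := by
    obtain ⟨z, hz⟩ := c.facet_nonempty i
    have := (c.linearIndependent_normals hij.symm hz.1 (le_antisymm (hz.2 j) (h z hz))).fintype_card_le_finrank
    simpa using this
  obtain ⟨z, hz⟩ := c.facet_nonempty i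
  have h1 := euclideanHausdorffMeasure_codim_two hd
    (c.linearIndependent_normals hij.symm hz.1 (le_antisymm (hz.2 j) (h z hz)))
    (c.isCompact_facet i).isBounded
    (fun x hx => ⟨hx.1, le_antisymm (hx.2 j) (h x hx)⟩)
  exact (c.facet_pos i).ne' h1

/-- Each facet has a relative interior point. -/
theorem exists_relInterior (i) : ∃ z, inner ℝ (c.normal i) z = c.offset i ∧
    ∀ j, j ≠ i → inner ℝ (c.normal j) z < c.offset j := by
  -- Constraints are made strict one at a time: averaging with a point where the new one is strict
  -- preserves the strictness already achieved.
  have key : ∀ s : Finset (Fin c.numFacets), ∃ z ∈ c.facet i,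
      ∀ j ∈ s, j ≠ i → inner ℝ (c.normal j) z < c.offset j := by
    intro s
    induction s using Finset.induction_on with
    | empty =>
      obtain ⟨z, hz⟩ := c.facet_nonempty i
      exact ⟨z, hz, by simp⟩
    | insert a s _ ih =>
      obtain ⟨z, hz, hs⟩ := ih
      by_cases ha : a = i
      · refine ⟨z, hz, fun j hj hji => ?_⟩
        rcases Finset.mem_insert.1 hj with rfl | hj
        · exact absurd ha hji
        · exact hs j hj hji
      · obtain ⟨w, hw, hwa⟩ := c.exists_mem_facet_lt ha
        refine ⟨(1 / 2 : ℝ) • z + (1 / 2 : ℝ) • w,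
          c.convex_facet i hz hw (by norm_num) (by norm_num) (by norm_num), fun j hj hji => ?_⟩
        rw [inner_add_right, inner_smul_right, inner_smul_right]
        rcases Finset.mem_insert.1 hj with rfl | hj
        · have := hz.2 j
          linarith
        · have := hs j hj hji
          have := hw.2 j
          linarith
  obtain ⟨z, hz, h⟩ := key Finset.univ
  exact ⟨z, hz.1, fun j hj => h j (Finset.mem_univ j) hj⟩

theorem diam_pos (hd : 0 < d) : 0 < c.diam := by
  obtain ⟨p, hp⟩ := c.pts_nonempty
  exact Metric.diam_pos (nontrivial_of_isOpen hd c.isOpen_pts hp) c.isBounded_pts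

theorem volume_pts_lt_top : volume c.pts < ∞ := c.isBounded_pts.measure_lt_top

/-- The volume of a cell. -/
def vol : ℝ := volume.real c.pts

theorem vol_pos : 0 < c.vol :=
  ENNReal.toReal_pos (c.isOpen_pts.measure_pos _ c.pts_nonempty).ne' c.volume_pts_lt_top.ne

/-- Shape regular cells have volume comparable to the `d`-th power of the diameter. -/
theorem pow_diam_le_vol (hd : 0 < d) {ρ : ℝ} (hρ : 0 < ρ)
    (h : Metric.diam c.pts / Mesh.inDiam c.pts ≤ ρ) :
    (ballVol d).toReal / (4 * ρ) ^ d * c.diam ^ d ≤ c.vol := by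
  have hdp := c.diam_pos hd
  set S := {δ : ℝ | ∃ x ε, Metric.ball x ε ⊆ c.pts ∧ δ = Metric.diam (Metric.ball x ε)} with hS
  have hbdd : BddAbove S := by
    refine ⟨c.diam, ?_⟩
    rintro δ ⟨x, ε, hx, rfl⟩
    exact Metric.diam_mono hx c.isBounded_pts
  have hpos : 0 < Mesh.inDiam c.pts := by
    obtain ⟨p, hp⟩ := c.pts_nonempty
    obtain ⟨ε, hε, hb⟩ := Metric.isOpen_iff.1 c.isOpen_pts p hp
    have h1 : 0 < Metric.diam (Metric.ball p ε) :=
      Metric.diam_pos (nontrivial_of_isOpen hd Metric.isOpen_ball (Metric.mem_ball_self hε))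
        Metric.isBounded_ball
    exact h1.trans_le (le_csSup hbdd ⟨p, ε, hb, rfl⟩)
  rw [div_le_iff₀ hpos] at h
  -- The supremum defining `inDiam` need not be attained. Giving up a factor two yields an actual
  -- ball, and halving its diameter explains the radius `c.diam / (4 * ρ)`.
  have h2 : c.diam / (2 * ρ) < sSup S := by
    rw [div_lt_iff₀ (by positivity)]
    change c.diam ≤ ρ * sSup S at h
    nlinarith
  obtain ⟨δ, ⟨x, ε, hx, rfl⟩, h3⟩ := exists_lt_of_lt_csSup (by
    by_contra hne
    rw [Set.not_nonempty_iff_eq_empty] at hne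
    change 0 < sSup S at hpos
    rw [hne, Real.sSup_empty] at hpos
    exact hpos.ne rfl) h2
  have hε : 0 ≤ ε := by
    by_contra! hε
    rw [Metric.ball_eq_empty.2 hε.le, Metric.diam_empty] at h3
    have : 0 < c.diam / (2 * ρ) := by positivity
    linarith
  have h4 : c.diam / (4 * ρ) < ε := by
    have := Metric.diam_ball (x := x) hε
    have h5 : c.diam / (4 * ρ) = c.diam / (2 * ρ) / 2 := by field_simp; norm_num
    linarith
  have h6 : Metric.closedBall x (c.diam / (4 * ρ)) ⊆ c.pts :=
    (Metric.closedBall_subset_ball h4).trans hx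
  have h7 := measureReal_mono (μ := volume) h6 c.volume_pts_lt_top.ne
  have h8 := volume_closedBall_eq x (r := c.diam / (4 * ρ)) (by positivity)
  rw [finrank_euclideanSpace_fin] at h8
  rw [measureReal_def, h8, ENNReal.toReal_mul, ENNReal.toReal_ofReal (by positivity), div_pow] at h7
  calc _ = c.diam ^ d / (4 * ρ) ^ d * (ballVol d).toReal := by ring
    _ ≤ _ := h7

theorem ballVol_toReal_pos (n : ℕ) : 0 < (ballVol n).toReal :=
  ENNReal.toReal_pos (Metric.measure_closedBall_pos _ _ one_pos).ne' (ballVol_lt_top n).ne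

end Cell

end NCFlow

end

/-! ### Facets shared by two cells -/

noncomputable section

namespace NCFlow

open Module Filter Topology

namespace Cell

variable {d : ℕ}

theorem eventually_add_smul_lt (c : Cell d) {i} {w v : Vec d}
    (hw : ∀ j, j ≠ i → inner ℝ (c.normal j) w < c.offset j) :
    ∀ᶠ ε : ℝ in 𝓝[>] 0, ∀ j, j ≠ i → inner ℝ (c.normal j) (w + ε • v) < c.offset j := by
  rw [eventually_all]
  intro j
  by_cases hj : j = i
  · exact Eventually.of_forall fun _ h => absurd hj h
  · have h1 : ContinuousAt (fun ε : ℝ => inner ℝ (c.normal j) (w + ε • v)) 0 := by fun_prop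
    have h2 := h1.eventually_lt_const (u := c.offset j) (by simpa using hw j hj)
    filter_upwards [h2.filter_mono nhdsWithin_le_nhds] with ε hε _ using hε

/-- Moving inwards from a relative interior point of a facet enters the cell. -/
theorem eventually_mem_pts (c : Cell d) {i} {w v : Vec d}
    (hi : inner ℝ (c.normal i) w = c.offset i)
    (hw : ∀ j, j ≠ i → inner ℝ (c.normal j) w < c.offset j) (hv : inner ℝ (c.normal i) v < 0) :
    ∀ᶠ ε : ℝ in 𝓝[>] 0, w + ε • v ∈ c.pts := by
  filter_upwards [c.eventually_add_smul_lt (v := v) hw, self_mem_nhdsWithin] with ε h hε j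
  by_cases hj : j = i
  · subst hj
    rw [inner_add_right, inner_smul_right, hi]
    have := mul_neg_of_pos_of_neg (Set.mem_Ioi.1 hε) hv
    linarith
  · exact h j hj

theorem eventually_mem_facet (c : Cell d) {i} {w v : Vec d}
    (hi : inner ℝ (c.normal i) w = c.offset i)
    (hw : ∀ j, j ≠ i → inner ℝ (c.normal j) w < c.offset j) (hv : inner ℝ (c.normal i) v = 0) :
    ∀ᶠ ε : ℝ in 𝓝[>] 0, w + ε • v ∈ c.facet i := by
  filter_upwards [c.eventually_add_smul_lt (v := v) hw] with ε h
  have h1 : inner ℝ (c.normal i) (w + ε • v) = c.offset i := by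
    rw [inner_add_right, inner_smul_right, hi, hv, mul_zero, add_zero]
  refine ⟨h1, fun j => ?_⟩
  by_cases hj : j = i
  · subst hj; exact h1.le
  · exact (h j hj).le

/-- Take the midpoint of relative interior points obtained from the two cells: each end makes the
inactive constraints of its own cell strict, and the other end satisfies them weakly. -/
theorem exists_common_relInterior {c c' : Cell d} {i i'} (h : c.facet i = c'.facet i') :
    ∃ w, (inner ℝ (c.normal i) w = c.offset i ∧
      ∀ j, j ≠ i → inner ℝ (c.normal j) w < c.offset j) ∧
      (inner ℝ (c'.normal i') w = c'.offset i' ∧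
      ∀ j, j ≠ i' → inner ℝ (c'.normal j) w < c'.offset j) := by
  obtain ⟨z, hz, hz'⟩ := c.exists_relInterior i
  obtain ⟨y, hy, hy'⟩ := c'.exists_relInterior i'
  have hzf : z ∈ c.facet i := ⟨hz, fun j => by
    by_cases hj : j = i
    · subst hj; exact hz.le
    · exact (hz' j hj).le⟩
  have hyf : y ∈ c'.facet i' := ⟨hy, fun j => by
    by_cases hj : j = i'
    · subst hj; exact hy.le
    · exact (hy' j hj).le⟩
  have hyf' := hyf
  have hzf' := hzf
  rw [← h] at hyf'
  rw [h] at hzf'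
  have hw := c.convex_facet i hzf hyf' (a := 1 / 2) (b := 1 / 2) (by norm_num) (by norm_num)
    (by norm_num)
  have hw' := c'.convex_facet i' hzf' hyf (a := 1 / 2) (b := 1 / 2) (by norm_num) (by norm_num)
    (by norm_num)
  refine ⟨(1 / 2 : ℝ) • z + (1 / 2 : ℝ) • y, ⟨hw.1, fun j hj => ?_⟩, ⟨hw'.1, fun j hj => ?_⟩⟩
  · rw [inner_add_right, inner_smul_right, inner_smul_right]
    have := hz' j hj
    have := hyf'.2 j
    linarith
  · rw [inner_add_right, inner_smul_right, inner_smul_right]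
    have := hy' j hj
    have := hzf'.2 j
    linarith

/-- A facet determines its hyperplane. -/
theorem normal_eq_smul_of_facet_eq {c c' : Cell d} {i i'} (h : c.facet i = c'.facet i') :
    (c'.normal i' = c.normal i ∧ c'.offset i' = c.offset i) ∨
    (c'.normal i' = -c.normal i ∧ c'.offset i' = -c.offset i) := by
  obtain ⟨w, ⟨h1, h2⟩, ⟨h3, h4⟩⟩ := exists_common_relInterior h
  -- Small displacements orthogonal to the first normal stay in the common facet, hence are
  -- orthogonal to the second normal as well. So the latter lies in the double orthogonal
  -- complement.
  have h5 : c'.normal i' ∈ (ℝ ∙ c.normal i) := by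
    rw [← Submodule.orthogonal_orthogonal (ℝ ∙ c.normal i), Submodule.mem_orthogonal']
    intro v hv
    rw [Submodule.mem_orthogonal_singleton_iff_inner_right] at hv
    obtain ⟨ε, hε, hε0⟩ := ((c.eventually_mem_facet h1 h2 hv).and self_mem_nhdsWithin).exists
    rw [h] at hε
    have h6 := hε.1
    rw [inner_add_right, h3, inner_smul_right] at h6
    have h7 : ε * inner ℝ (c'.normal i') v = 0 := by linarith
    exact (mul_eq_zero.1 h7).resolve_left (ne_of_gt hε0)
  obtain ⟨a, ha⟩ := Submodule.mem_span_singleton.1 h5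
  have h1' : |a| = 1 := by
    have := c'.norm_normal i'
    rwa [← ha, norm_smul, c.norm_normal i, mul_one, Real.norm_eq_abs] at this
  have h2' : c'.offset i' = a * c.offset i := by rw [← h3, ← ha, inner_smul_left, h1]; simp
  rcases eq_or_eq_neg_of_abs_eq h1' with rfl | rfl
  · left; simp [← ha, h2']
  · right; simp [← ha, h2']

/-- With equal outward normals, a short step inwards from a common relative interior point enters
both cells. -/
theorem not_disjoint_of_facet_eq {c c' : Cell d} {i i'} (h : c.facet i = c'.facet i')
    (hn : c'.normal i' = c.normal i) : ¬ Disjoint c.pts c'.pts := by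
  obtain ⟨w, ⟨h1, h2⟩, ⟨h3, h4⟩⟩ := exists_common_relInterior h
  have hv : inner ℝ (c.normal i) (-c.normal i) < 0 := by
    rw [inner_neg_right, real_inner_self_eq_norm_sq, c.norm_normal]; norm_num
  obtain ⟨ε, h5, h6⟩ := ((c.eventually_mem_pts h1 h2 hv).and
    (c'.eventually_mem_pts h3 h4 (by rwa [hn]))).exists
  exact Set.not_disjoint_iff.2 ⟨_, h5, h6⟩

/-- Disjoint cells with a common facet have opposite normals on it. -/
theorem normal_eq_neg_of_facet_eq {c c' : Cell d} {i i'} (h : c.facet i = c'.facet i')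
    (hd : Disjoint c.pts c'.pts) :
    c'.normal i' = -c.normal i ∧ c'.offset i' = -c.offset i :=
  (normal_eq_smul_of_facet_eq h).resolve_left fun hn => not_disjoint_of_facet_eq h hn.1 hd

theorem facet_injective (c : Cell d) : Function.Injective c.facet := by
  intro i j h
  rcases normal_eq_smul_of_facet_eq h with h1 | h1
  · exact (c.normal_offset_injective (by simp [h1])).symm
  · obtain ⟨p, hp⟩ := c.pts_nonempty
    have h2 := hp i
    have h3 := hp j
    rw [h1.1, h1.2, inner_neg_left] at h3
    linarith

end Cell

namespace Mesh

variable {d : ℕ} {Ω : Set (Vec d)} (T : Mesh d Ω)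

/-- The facets of the cells of a mesh, each interior facet being counted once from each side. -/
abbrev FacetIdx := Σ k : Fin T.numCells, Fin (T.cell k).numFacets

variable {T}

/-- The facet as a set. -/
abbrev FacetIdx.set (p : T.FacetIdx) : Set (Vec d) := (T.cell p.1).facet p.2

/-- The facet lies in the interior. -/
def FacetIdx.Interior (p : T.FacetIdx) : Prop := ¬ T.IsBdry p.1 p.2

theorem FacetIdx.Interior.exists_opp {p : T.FacetIdx} (hp : p.Interior) :
    ∃ q : T.FacetIdx, q.1 ≠ p.1 ∧ q.set = p.set := by
  obtain ⟨k', i', h1, h2⟩ := (T.facet_cases p.1 p.2).resolve_left hp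
  exact ⟨⟨k', i'⟩, h1, h2⟩

/-- Two further cells with the same facet would both carry the normal opposite to that of `p`, hence
the same normal, and would overlap. This makes the passage to the other side of a facet a
well-defined involution. -/
theorem facetIdx_unique {p q q' : T.FacetIdx} (h1 : q.1 ≠ p.1) (h2 : q.set = p.set)
    (h1' : q'.1 ≠ p.1) (h2' : q'.set = p.set) : q = q' := by
  have e1 := Cell.normal_eq_neg_of_facet_eq h2.symm (T.disjoint _ _ h1.symm)
  have e2 := Cell.normal_eq_neg_of_facet_eq h2'.symm (T.disjoint _ _ h1'.symm)
  have h3 : q.1 = q'.1 := by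
    by_contra hne
    exact Cell.not_disjoint_of_facet_eq (h2.trans h2'.symm) (e2.1.trans e1.1.symm)
      (T.disjoint _ _ hne)
  obtain ⟨k, i⟩ := q
  obtain ⟨k', i'⟩ := q'
  obtain rfl : k = k' := h3
  have h4 : i = i' := (T.cell k).facet_injective (h2.trans h2'.symm)
  rw [h4]

open Classical in
/-- The same facet seen from the other side; boundary facets are fixed. -/
def FacetIdx.opp (p : T.FacetIdx) : T.FacetIdx :=
  if hp : p.Interior then hp.exists_opp.choose else p

theorem FacetIdx.opp_of_not_interior {p : T.FacetIdx} (hp : ¬ p.Interior) : p.opp = p :=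
  dif_neg hp

theorem FacetIdx.Interior.opp_ne {p : T.FacetIdx} (hp : p.Interior) : p.opp.1 ≠ p.1 := by
  rw [FacetIdx.opp, dif_pos hp]; exact hp.exists_opp.choose_spec.1

theorem FacetIdx.opp_set (p : T.FacetIdx) : p.opp.set = p.set := by
  by_cases hp : p.Interior
  · rw [FacetIdx.opp, dif_pos hp]; exact hp.exists_opp.choose_spec.2
  · rw [FacetIdx.opp_of_not_interior hp]

theorem FacetIdx.opp_interior_iff {p : T.FacetIdx} : p.opp.Interior ↔ p.Interior := by
  have : (T.cell p.opp.1).facet p.opp.2 = (T.cell p.1).facet p.2 := p.opp_set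
  unfold FacetIdx.Interior IsBdry
  rw [this]

theorem FacetIdx.opp_involutive : Function.Involutive (FacetIdx.opp (T := T)) := by
  intro p
  by_cases hp : p.Interior
  · have h1 := FacetIdx.opp_interior_iff.2 hp
    exact facetIdx_unique h1.opp_ne (FacetIdx.opp_set _) hp.opp_ne.symm (FacetIdx.opp_set _).symm
  · rw [FacetIdx.opp_of_not_interior hp, FacetIdx.opp_of_not_interior hp]

/-- The outward unit normal. -/
abbrev FacetIdx.normal (p : T.FacetIdx) : Vec d := (T.cell p.1).normal p.2

theorem FacetIdx.Interior.opp_normal {p : T.FacetIdx} (hp : p.Interior) :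
    p.opp.normal = -p.normal :=
  (Cell.normal_eq_neg_of_facet_eq p.opp_set.symm (T.disjoint _ _ hp.opp_ne.symm)).1

/-- Reduces the sum over neighbours in `convForm` to the single term given by `opp`. -/
theorem isNeighbor_iff {p : T.FacetIdx} {k' : Fin T.numCells} :
    T.IsNeighbor p.1 p.2 k' ↔ p.Interior ∧ k' = p.opp.1 := by
  constructor
  · rintro ⟨h1, h2, i', h3⟩
    exact ⟨h1, congrArg Sigma.fst
      (facetIdx_unique (p := p) (q := ⟨k', i'⟩) h2 h3 (FacetIdx.Interior.opp_ne h1) p.opp_set)⟩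
  · rintro ⟨h1, rfl⟩
    exact ⟨h1, h1.opp_ne, p.opp.2, p.opp_set⟩

theorem sum_opp {M : Type*} [AddCommMonoid M] (φ : T.FacetIdx → M) :
    ∑ p : T.FacetIdx, φ p.opp = ∑ p, φ p :=
  Equiv.sum_comp (FacetIdx.opp_involutive (T := T)).toPerm φ

/-- Passes from facet sums back to cell sums; the factor is the maximal number of facets of a cell.
-/
theorem sum_fst_le {φ : Fin T.numCells → ℝ} (hφ : ∀ k, 0 ≤ φ k) :
    ∑ p : T.FacetIdx, φ p.1 ≤ 2 * d * ∑ k, φ k := by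
  rw [Fintype.sum_sigma, Finset.mul_sum]
  refine Finset.sum_le_sum fun k _ => ?_
  simp only [Finset.sum_const, Finset.card_univ, Fintype.card_fin, nsmul_eq_mul]
  refine mul_le_mul_of_nonneg_right ?_ (hφ k)
  exact_mod_cast (T.cell k).numFacets_le

/-- The diameter of a facet. -/
def FacetIdx.diam (p : T.FacetIdx) : ℝ := Metric.diam p.set

theorem FacetIdx.diam_nonneg (p : T.FacetIdx) : 0 ≤ p.diam := Metric.diam_nonneg

theorem FacetIdx.dist_le_diam (p : T.FacetIdx) {x y : Vec d} (hx : x ∈ p.set) (hy : y ∈ p.set) :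
    dist x y ≤ p.diam :=
  Metric.dist_le_diam_of_mem ((T.cell p.1).isCompact_facet p.2).isBounded hx hy

theorem FacetIdx.diam_le (p : T.FacetIdx) : p.diam ≤ (T.cell p.1).diam :=
  Metric.diam_le_of_forall_dist_le (T.cell p.1).diam_nonneg fun _ hx _ hy =>
    (T.cell p.1).dist_le_diam (Cell.facet_subset_closedPts _ _ hx)
      (Cell.facet_subset_closedPts _ _ hy)

theorem FacetIdx.diam_le_opp (p : T.FacetIdx) : p.diam ≤ (T.cell p.opp.1).diam := by
  have := p.opp.diam_le
  rwa [FacetIdx.diam, p.opp_set] at this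

end Mesh

end NCFlow

end

/-! ### Crossings of a segment with the boundary of a convex cell -/

noncomputable section

namespace NCFlow

open Module Filter Topology

namespace LineCrossing

variable {N : ℕ} {a b : Fin N → ℝ}

/-- The parameter `τ` lies in the open interval cut out by the constraints `b i * τ < a i`. -/
def Inside (a b : Fin N → ℝ) (τ : ℝ) : Prop := ∀ i, b i * τ < a i

/-- The constraint `i` is active at `τ` and no constraint is violated. -/
def Hit (a b : Fin N → ℝ) (i : Fin N) (τ : ℝ) : Prop := b i * τ = a i ∧ ∀ j, b j * τ ≤ a j

/-- Constraints that fail at `t` but hold at `s` have positive slope. The exit takes place at the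
smallest of their thresholds `a i / b i`. -/
theorem exists_exit {s t : ℝ} (hst : s ≤ t) (hs : Inside a b s) (ht : ¬ Inside a b t) :
    ∃ i, 0 < b i ∧ ∃ τ, s < τ ∧ τ ≤ t ∧ Hit a b i τ := by
  simp only [Inside, not_forall, not_lt] at ht
  obtain ⟨i₀, hi₀⟩ := ht
  obtain ⟨i, hi, hmin⟩ := Finset.exists_min_image (Finset.univ.filter fun i => a i ≤ b i * t)
    (fun i => a i / b i) ⟨i₀, by simpa using hi₀⟩
  simp only [Finset.mem_filter, Finset.mem_univ, true_and] at hi hmin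
  have hpos : ∀ j, a j ≤ b j * t → 0 < b j := by
    intro j hj
    have := hs j
    by_contra! h
    nlinarith
  have hbi := hpos i hi
  have h1 : b i * (a i / b i) = a i := by field_simp
  have h2 : s < a i / b i := by rw [lt_div_iff₀ hbi]; linarith [hs i]
  have h3 : a i / b i ≤ t := by rw [div_le_iff₀ hbi]; linarith
  refine ⟨i, hbi, a i / b i, h2, h3, h1, fun j => ?_⟩
  by_cases hj : a j ≤ b j * t
  · have h4 := hmin j hj
    have h5 := hpos j hj
    rw [le_div_iff₀ h5] at h4
    linarith
  · push Not at hj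
    rcases le_or_gt 0 (b j) with h | h
    · exact (mul_le_mul_of_nonneg_left h3 h).trans hj.le
    · exact (mul_le_mul_of_nonpos_left h2.le h.le).trans (hs j).le

theorem exists_entry {s t : ℝ} (hst : s ≤ t) (hs : ¬ Inside a b s) (ht : Inside a b t) :
    ∃ i, b i < 0 ∧ ∃ τ, s ≤ τ ∧ τ < t ∧ Hit a b i τ := by
  obtain ⟨i, hi, τ, h1, h2, h3, h4⟩ := exists_exit (a := a) (b := -b) (s := -t) (t := -s)
    (by linarith) (fun i => by simpa using ht i) (fun h => hs fun i => by simpa using h i)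
  refine ⟨i, by simpa using hi, -τ, by linarith, by linarith, by simpa using h3,
    fun j => by simpa using h4 j⟩

/-- If only constraint `i` is active at the entry, the others stay strict for a short while and `i`
becomes strict at once. -/
theorem exists_inside_after {i : Fin N} {τ t : ℝ} (hτ : τ < t) (h : Hit a b i τ) (hb : b i < 0)
    (hg : ∀ j, j ≠ i → b j * τ ≠ a j) : ∃ σ, τ < σ ∧ σ < t ∧ Inside a b σ := by
  have h1 : ∀ᶠ σ in 𝓝[>] τ, Inside a b σ := by
    unfold Inside
    rw [eventually_all]
    intro j
    by_cases hj : j = i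
    · subst hj
      filter_upwards [self_mem_nhdsWithin] with σ hσ
      rw [← h.1]
      exact mul_lt_mul_of_neg_left hσ hb
    · have h2 : ContinuousAt (fun σ => b j * σ) τ := by fun_prop
      exact (h2.eventually_lt_const (lt_of_le_of_ne (h.2 j) (hg j hj))).filter_mono
        nhdsWithin_le_nhds
  obtain ⟨σ, h2, h3⟩ := (h1.and (Ioo_mem_nhdsGT hτ)).exists
  exact ⟨σ, h3.1, h3.2, h2⟩

theorem exists_inside_before {i : Fin N} {τ s : ℝ} (hτ : s < τ) (h : Hit a b i τ) (hb : 0 < b i)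
    (hg : ∀ j, j ≠ i → b j * τ ≠ a j) : ∃ σ, s < σ ∧ σ < τ ∧ Inside a b σ := by
  obtain ⟨σ, h1, h2, h3⟩ := exists_inside_after (a := a) (b := -b) (i := i) (τ := -τ) (t := -s)
    (by linarith) ⟨by simpa using h.1, fun j => by simpa using h.2 j⟩ (by simpa using hb)
    (fun j hj => by simpa using hg j hj)
  exact ⟨-σ, by linarith, by linarith, fun j => by simpa using h3 j⟩

/-- Neither exit can come after the other, so both happen at the same parameter, where genericity
allows one active constraint only. -/
theorem Hit.exit_unique {i j : Fin N} {τ τ' : ℝ} (h : Hit a b i τ) (h' : Hit a b j τ')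
    (hi : 0 < b i) (hj : 0 < b j)
    (hg : ∀ i j, i ≠ j → ∀ τ, ¬ (b i * τ = a i ∧ b j * τ = a j)) : i = j := by
  have e : τ = τ' := by
    have h1 := h.2 j
    have h2 := h'.2 i
    rw [← h'.1] at h1
    rw [← h.1] at h2
    exact le_antisymm (le_of_mul_le_mul_left h1 hj) (le_of_mul_le_mul_left h2 hi)
  by_contra hne
  exact hg i j hne τ ⟨h.1, e ▸ h'.1⟩

theorem Hit.entry_unique {i j : Fin N} {τ τ' : ℝ} (h : Hit a b i τ) (h' : Hit a b j τ')
    (hi : b i < 0) (hj : b j < 0)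
    (hg : ∀ i j, i ≠ j → ∀ τ, ¬ (b i * τ = a i ∧ b j * τ = a j)) : i = j := by
  refine Hit.exit_unique (a := a) (b := -b) (τ := -τ) (τ' := -τ')
    ⟨by simpa using h.1, fun j => by simpa using h.2 j⟩
    ⟨by simpa using h'.1, fun j => by simpa using h'.2 j⟩ (by simpa using hi) (by simpa using hj) ?_
  intro i j hij σ hσ
  exact hg i j hij (-σ) (by simpa using hσ)

theorem sum_ite_eq_ite_exists {ι : Type*} [Fintype ι] {p : ι → Prop} [DecidablePred p]
    [Decidable (∃ i, p i)] (h : ∀ i j, p i → p j → i = j) :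
    ∑ i, (if p i then (1 : ℝ) else 0) = if ∃ i, p i then 1 else 0 := by
  split_ifs with hp
  · obtain ⟨i, hi⟩ := hp
    rw [Finset.sum_eq_single i, if_pos hi]
    · exact fun j _ hj => if_neg fun hpj => hj (h j i hpj hi)
    · simp
  · push Not at hp
    simp [hp]

open Classical in
/-- Signed count of the hits of the boundary of an interval inside `(0, t)`. -/
theorem ite_inside_sub_ite_inside {t : ℝ} (ht : 0 < t)
    (hg : ∀ i j, i ≠ j → ∀ τ, ¬ (b i * τ = a i ∧ b j * τ = a j))
    (h0 : ∀ i, a i ≠ 0) (h1 : ∀ i, b i * t ≠ a i) :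
    (if Inside a b t then (1 : ℝ) else 0) - (if Inside a b 0 then 1 else 0) =
      -∑ i, Real.sign (b i) * (if ∃ τ ∈ Set.Ioo 0 t, Hit a b i τ then 1 else 0) := by
  set X : Fin N → Prop := fun i => 0 < b i ∧ ∃ τ ∈ Set.Ioo 0 t, Hit a b i τ with hX
  set E : Fin N → Prop := fun i => b i < 0 ∧ ∃ τ ∈ Set.Ioo 0 t, Hit a b i τ with hE
  have hsum : ∑ i, Real.sign (b i) * (if ∃ τ ∈ Set.Ioo 0 t, Hit a b i τ then (1 : ℝ) else 0) =
      (if ∃ i, X i then 1 else 0) - (if ∃ i, E i then 1 else 0) := by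
    rw [← sum_ite_eq_ite_exists (p := X), ← sum_ite_eq_ite_exists (p := E),
      ← Finset.sum_sub_distrib]
    · refine Finset.sum_congr rfl fun i _ => ?_
      rcases lt_trichotomy (b i) 0 with h | h | h
      · rw [Real.sign_of_neg h, if_neg (show ¬ X i from fun hx => h.not_gt hx.1)]
        by_cases hh : ∃ τ ∈ Set.Ioo 0 t, Hit a b i τ
        · rw [if_pos hh, if_pos (show E i from ⟨h, hh⟩)]; norm_num
        · rw [if_neg hh, if_neg (show ¬ E i from fun hx => hh hx.2)]; norm_num
      · rw [show Real.sign (b i) = 0 by rw [h, Real.sign_zero], if_neg (show ¬ X i from fun hx => hx.1.ne' h),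
          if_neg (show ¬ E i from fun hx => hx.1.ne h)]
        norm_num
      · rw [Real.sign_of_pos h, if_neg (show ¬ E i from fun hx => h.not_gt hx.1)]
        by_cases hh : ∃ τ ∈ Set.Ioo 0 t, Hit a b i τ
        · rw [if_pos hh, if_pos (show X i from ⟨h, hh⟩)]; norm_num
        · rw [if_neg hh, if_neg (show ¬ X i from fun hx => hh hx.2)]; norm_num
    · rintro i j ⟨hi, τ, _, h⟩ ⟨hj, τ', _, h'⟩
      exact h.entry_unique h' hi hj hg
    · rintro i j ⟨hi, τ, _, h⟩ ⟨hj, τ', _, h'⟩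
      exact h.exit_unique h' hi hj hg
  rw [hsum]
  have exit_of : ∀ s, 0 ≤ s → s ≤ t → Inside a b s → ¬ Inside a b t → ∃ i, X i := by
    intro s hs0 hst hs hnt
    obtain ⟨i, hi, τ, h2, h3, h4⟩ := exists_exit hst hs hnt
    refine ⟨i, hi, τ, ⟨by linarith, lt_of_le_of_ne h3 ?_⟩, h4⟩
    rintro rfl
    exact h1 i h4.1
  have entry_of : ∀ s, 0 ≤ s → s ≤ t → ¬ Inside a b 0 → Inside a b s → ∃ i, E i := by
    intro s hs0 hst hs hnt
    obtain ⟨i, hi, τ, h2, h3, h4⟩ := exists_entry hs0 hs hnt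
    refine ⟨i, hi, τ, ⟨lt_of_le_of_ne h2 ?_, by linarith⟩, h4⟩
    rintro rfl
    apply h0 i
    rw [← h4.1, mul_zero]
  have no_exit : Inside a b t → ¬ ∃ i, X i := by
    rintro hin ⟨i, hi, τ, hτ, h⟩
    have h2 := hin i
    rw [← h.1] at h2
    exact (mul_lt_mul_of_pos_left hτ.2 hi).not_gt h2
  have no_entry : Inside a b 0 → ¬ ∃ i, E i := by
    rintro hin ⟨i, hi, τ, hτ, h⟩
    have h2 := hin i
    rw [← h.1] at h2
    exact (mul_lt_mul_of_neg_left hτ.1 hi).not_gt h2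
  by_cases hin0 : Inside a b 0 <;> by_cases hint : Inside a b t
  · rw [if_pos hin0, if_pos hint, if_neg (no_exit hint), if_neg (no_entry hin0)]; norm_num
  · rw [if_pos hin0, if_neg hint, if_pos (exit_of 0 le_rfl ht.le hin0 hint),
      if_neg (no_entry hin0)]; norm_num
  · rw [if_neg hin0, if_pos hint, if_neg (no_exit hint),
      if_pos (entry_of t ht.le le_rfl hin0 hint)]; norm_num
  · have hiff : (∃ i, X i) ↔ ∃ i, E i := by
      constructor
      · rintro ⟨i, hi, τ, hτ, h⟩
        obtain ⟨σ, h2, h3, h4⟩ := exists_inside_before hτ.1 h hi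
          (fun j hj hjτ => hg j i hj τ ⟨hjτ, h.1⟩)
        exact entry_of σ h2.le (h3.trans hτ.2).le hin0 h4
      · rintro ⟨i, hi, τ, hτ, h⟩
        obtain ⟨σ, h2, h3, h4⟩ := exists_inside_after hτ.2 h hi
          (fun j hj hjτ => hg j i hj τ ⟨hjτ, h.1⟩)
        exact exit_of σ (hτ.1.trans h2).le h3.le h4 hint
    rw [if_neg hin0, if_neg hint]
    simp only [hiff]
    norm_num

end LineCrossing

namespace Cell

variable {d : ℕ}

/-- The points `x` such that the open segment from `x` to `x + t • e` meets the facet `i`. -/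
def crossing (c : Cell d) (i : Fin c.numFacets) (e : Vec d) (t : ℝ) : Set (Vec d) :=
  {x | ∃ τ ∈ Set.Ioo 0 t, x + τ • e ∈ c.facet i}

/-- Segments generically cross the boundary of a cell transversally and away from its edges. -/
theorem ae_generic (c : Cell d) (e : Vec d) (t : ℝ) : ∀ᵐ x : Vec d,
    (∀ i j, i ≠ j → ∀ τ, ¬ (inner ℝ (c.normal i) e * τ = c.offset i - inner ℝ (c.normal i) x ∧
      inner ℝ (c.normal j) e * τ = c.offset j - inner ℝ (c.normal j) x)) ∧
    (∀ i, c.offset i - inner ℝ (c.normal i) x ≠ 0) ∧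
    (∀ i, inner ℝ (c.normal i) e * t ≠ c.offset i - inner ℝ (c.normal i) x) := by
  have hz : ∀ i, ∀ᵐ x : Vec d, c.offset i - inner ℝ (c.normal i) x ≠ 0 := by
    intro i
    rw [ae_iff]
    convert! volume_hyperplane (c.normal_ne_zero i) (c.offset i) using 2
    ext x
    simp only [not_not, Set.mem_ofPred_eq, sub_eq_zero]
    exact eq_comm
  refine (eventually_all.2 fun i => eventually_all.2 fun j => ?_).and
    ((eventually_all.2 hz).and (eventually_all.2 fun i => ?_))
  · by_cases hij : i = j
    · exact Eventually.of_forall fun _ h => absurd hij h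
    -- `m` eliminates `τ` from the two equations. If `m ≠ 0`, a double hit confines `x` to a
    -- hyperplane with normal `m`. If `m = 0`, independence of the normals makes `e` parallel to
    -- facet `i`, so `x` lies on the hyperplane of that facet.
    set m := inner ℝ (c.normal i) e • c.normal j - inner ℝ (c.normal j) e • c.normal i with hm
    by_cases hm0 : m = 0
    · filter_upwards [hz i] with x hx _ τ hτ
      have h1 : inner ℝ (c.normal i) (x + τ • e) = c.offset i := by
        rw [inner_add_right, inner_smul_right]; linarith [hτ.1]
      have h2 : inner ℝ (c.normal j) (x + τ • e) = c.offset j := by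
        rw [inner_add_right, inner_smul_right]; linarith [hτ.2]
      have h3 := LinearIndependent.pair_iff.1 (c.linearIndependent_normals hij h1 h2)
        (-inner ℝ (c.normal j) e) (inner ℝ (c.normal i) e) (by
          rw [neg_smul, neg_add_eq_sub, ← hm, hm0])
      rw [h3.2, zero_mul] at hτ
      exact hx hτ.1.symm
    · have h1 := volume_hyperplane hm0
        (inner ℝ (c.normal i) e * c.offset j - inner ℝ (c.normal j) e * c.offset i)
      have h2 : ∀ᵐ x : Vec d, ¬ inner ℝ m x =
          inner ℝ (c.normal i) e * c.offset j - inner ℝ (c.normal j) e * c.offset i := by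
        rw [ae_iff]
        simpa using h1
      filter_upwards [h2] with x hx _ τ hτ
      apply hx
      rw [hm, inner_sub_left, inner_smul_left, inner_smul_left]
      simp only [conj_trivial]
      linear_combination (inner ℝ (c.normal i) e) * hτ.2 - (inner ℝ (c.normal j) e) * hτ.1
  · rw [ae_iff]
    convert! volume_hyperplane (c.normal_ne_zero i)
      (c.offset i - inner ℝ (c.normal i) e * t) using 2
    ext x
    simp only [not_not, Set.mem_ofPred_eq]
    constructor <;> intro h <;> linarith

open Classical in
/-- The increment of the indicator function of a cell along a generic segment. -/
theorem ae_indicator_add_sub (c : Cell d) (e : Vec d) {t : ℝ} (ht : 0 < t) : ∀ᵐ x : Vec d,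
    c.pts.indicator (fun _ => (1 : ℝ)) (x + t • e) - c.pts.indicator (fun _ => (1 : ℝ)) x =
      -∑ i, Real.sign (inner ℝ (c.normal i) e) *
        (c.crossing i e t).indicator (fun _ => (1 : ℝ)) x := by
  filter_upwards [c.ae_generic e t] with x hx
  have h := LineCrossing.ite_inside_sub_ite_inside ht hx.1 hx.2.1 hx.2.2
  have hin : ∀ τ, LineCrossing.Inside (fun i => c.offset i - inner ℝ (c.normal i) x)
      (fun i => inner ℝ (c.normal i) e) τ ↔ x + τ • e ∈ c.pts := by
    intro τ
    refine forall_congr' fun i => ?_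
    rw [inner_add_right, inner_smul_right]
    constructor <;> intro h <;> linarith
  have hhit : ∀ i τ, LineCrossing.Hit (fun i => c.offset i - inner ℝ (c.normal i) x)
      (fun i => inner ℝ (c.normal i) e) i τ ↔ x + τ • e ∈ c.facet i := by
    intro i τ
    refine and_congr ?_ (forall_congr' fun i => ?_)
    · rw [inner_add_right, inner_smul_right]
      constructor <;> intro h <;> linarith
    · rw [inner_add_right, inner_smul_right]
      constructor <;> intro h <;> linarith
  simp only [hin, hhit, zero_smul, add_zero] at h
  simpa [Set.indicator_apply, crossing] using h

end Cell

end NCFlow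

end

/-! ### Translations of piecewise constant functions -/

noncomputable section

namespace NCFlow

open Module Filter Topology

theorem volume_box {d : ℕ} (l u : Fin d → ℝ) :
    volume {x : Vec d | ∀ i, x i ∈ Set.Icc (l i) (u i)} = ∏ i, ENNReal.ofReal (u i - l i) := by
  rw [← Real.volume_Icc_pi, ← (PiLp.volume_preserving_ofLp (Fin d)).measure_preimage
    measurableSet_Icc.nullMeasurableSet]
  congr 1
  ext x
  simp [Set.mem_Icc, Pi.le_def, forall_and]

/-- The set is swept out by the facet moving a distance `t` along a coordinate direction. A
transvection of determinant one replaces the coordinate `x j` by `⟨n, x⟩ / ⟨n, e⟩`; this flattens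
the facet, and the image lies in a box with one side `t` and all others `2 * r`. If `e` is tangent
to the facet, the set lies in a hyperplane. -/
theorem Cell.volume_crossing_le {d : ℕ} (c : Cell d) (i : Fin c.numFacets) (j : Fin d) {t r : ℝ}
    (ht : 0 < t) (hr : ∀ x ∈ c.facet i, ∀ y ∈ c.facet i, dist x y ≤ r) :
    volume (c.crossing i (EuclideanSpace.single j 1) t) ≤ ENNReal.ofReal (t * (2 * r) ^ (d - 1)) := by
  set e : Vec d := EuclideanSpace.single j 1 with he
  set n := c.normal i with hn
  obtain ⟨z, hz⟩ := c.facet_nonempty i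
  have hr0 : 0 ≤ r := by simpa using hr z hz z hz
  by_cases hb : inner ℝ n e = 0
  · refine le_trans (le_of_eq (measure_mono_null ?_ (volume_hyperplane (c.normal_ne_zero i)
      (c.offset i)))) zero_le
    rintro x ⟨τ, _, h⟩
    have := h.1
    rw [inner_add_right, inner_smul_right, ← hn, hb, mul_zero, add_zero] at this
    exact this
  set φ : Dual ℝ (Vec d) := ((inner ℝ n e)⁻¹ • (innerSL ℝ n) - EuclideanSpace.proj j :
    Vec d →L[ℝ] ℝ).toLinearMap with hφ
  have hφx : ∀ x, φ x = (inner ℝ n e)⁻¹ * inner ℝ n x - x j := by intro x; simp [hφ]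
  have hφe : φ e = 0 := by rw [hφx, inv_mul_cancel₀ hb]; simp [he]
  set L := LinearMap.transvection φ e with hL
  have hdet : LinearMap.det L = 1 := by rw [hL, LinearMap.transvection.det, hφe, add_zero]
  have hLx : ∀ x, L x = x + φ x • e := fun x => LinearMap.transvection.apply φ e x
  set o := (inner ℝ n e)⁻¹ * c.offset i with ho
  set l : Fin d → ℝ := fun k => if k = j then o - t else z k - r with hl
  set u : Fin d → ℝ := fun k => if k = j then o else z k + r with hu
  have hsub : c.crossing i e t ⊆ L ⁻¹' {x : Vec d | ∀ i, x i ∈ Set.Icc (l i) (u i)} := by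
    rintro x ⟨τ, hτ, h⟩ k
    have h1 : inner ℝ n x = c.offset i - τ * inner ℝ n e := by
      have := h.1
      rw [inner_add_right, inner_smul_right, ← hn] at this
      linarith
    by_cases hk : k = j
    · subst hk
      have h2 : (L x) k = o - τ := by
        rw [hLx]
        simp only [PiLp.add_apply, PiLp.smul_apply, he, PiLp.single_apply, if_true, smul_eq_mul, mul_one]
        rw [hφx, h1, ho]
        field_simp
        ring
      rw [h2]
      simp only [hl, hu, if_true]
      exact ⟨by linarith [hτ.2], by linarith [hτ.1]⟩
    · have h2 : (L x) k = (x + τ • e) k := by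
        rw [hLx]
        simp [he, hk]
      rw [h2]
      simp only [hl, hu, hk, if_false]
      have h3 := hr _ h z hz
      rw [dist_eq_norm] at h3
      have h4 := (PiLp.norm_apply_le (x + τ • e - z) k).trans h3
      rw [PiLp.sub_apply, Real.norm_eq_abs, abs_le] at h4
      exact ⟨by linarith [h4.1], by linarith [h4.2]⟩
  refine (measure_mono hsub).trans ?_
  rw [Measure.addHaar_preimage_linearMap _ (by rw [hdet]; exact one_ne_zero), hdet, volume_box]
  have hprod : ∏ k, ENNReal.ofReal (u k - l k) =
      ENNReal.ofReal t * ENNReal.ofReal (2 * r) ^ (d - 1) := by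
    rw [← Finset.mul_prod_erase Finset.univ _ (Finset.mem_univ j)]
    congr 1
    · simp [hl, hu]
    · rw [Finset.prod_congr rfl (g := fun _ => ENNReal.ofReal (2 * r))]
      · rw [Finset.prod_const, Finset.card_erase_of_mem (Finset.mem_univ j)]
        simp
      · intro k hk
        rw [Finset.mem_erase] at hk
        simp only [hl, hu, hk.1, if_false]
        congr 1
        ring
  rw [hprod, ENNReal.ofReal_mul ht.le, ENNReal.ofReal_pow (by positivity)]
  simp

namespace Mesh

variable {d : ℕ} {Ω : Set (Vec d)} {T : Mesh d Ω}

/-- The piecewise constant function with values `c`, extended by zero. -/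
def pwConst (T : Mesh d Ω) (c : Fin T.numCells → ℝ) (x : Vec d) : ℝ :=
  ∑ k, (T.pts k).indicator (fun _ => c k) x

open Classical in
/-- The size of the jump of a piecewise constant function over a facet. -/
def jump (c : Fin T.numCells → ℝ) (p : T.FacetIdx) : ℝ :=
  if p.Interior then |c p.1 - c p.opp.1| else |c p.1|

theorem jump_nonneg (c : Fin T.numCells → ℝ) (p : T.FacetIdx) : 0 ≤ jump c p := by
  unfold jump; split_ifs <;> exact abs_nonneg _

/-- Summation by parts: averaging the sum with its image under `opp` turns values into differences,
because `g` changes sign across interior facets. The gain of a factor `1/2` on interior facets is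
thrown away. -/
theorem sum_mul_le_sum_jump (c : Fin T.numCells → ℝ) (g : T.FacetIdx → ℝ)
    (hg : ∀ p : T.FacetIdx, p.Interior → g p.opp = -g p) :
    |∑ p : T.FacetIdx, c p.1 * g p| ≤ ∑ p, jump c p * |g p| := by
  classical
  set h : T.FacetIdx → ℝ := fun p => if p.Interior then c p.1 * g p else 0 with hh
  set b : T.FacetIdx → ℝ := fun p => if p.Interior then 0 else c p.1 * g p with hb
  have h1 : ∑ p : T.FacetIdx, c p.1 * g p = ∑ p, ((1 / 2) * (h p + h p.opp) + b p) := by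
    have e1 : ∑ p : T.FacetIdx, c p.1 * g p = ∑ p, (h p + b p) :=
      Finset.sum_congr rfl fun p _ => by simp only [hh, hb]; split_ifs <;> ring
    rw [e1, Finset.sum_add_distrib, Finset.sum_add_distrib, ← Finset.mul_sum,
      Finset.sum_add_distrib, sum_opp h]
    ring
  rw [h1]
  refine (Finset.abs_sum_le_sum_abs _ _).trans (Finset.sum_le_sum fun p _ => ?_)
  by_cases hp : p.Interior
  · have hp' := FacetIdx.opp_interior_iff.2 hp
    simp only [hh, hb, hp, hp', if_true, jump, hg p hp]
    rw [← abs_mul, show 1 / 2 * (c p.fst * g p + c p.opp.fst * -g p) + 0 =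
      (1 / 2) * ((c p.1 - c p.opp.1) * g p) by ring, abs_mul]
    have := abs_nonneg ((c p.1 - c p.opp.1) * g p)
    rw [show |(1 / 2 : ℝ)| = 1 / 2 by norm_num]
    linarith
  · have hp' : ¬ p.opp.Interior := fun h => hp (FacetIdx.opp_interior_iff.1 h)
    simp only [hh, hb, hp, hp', if_false, jump]
    rw [← abs_mul]
    simp

open Classical in
/-- The `L¹` modulus of continuity of a piecewise constant function in coordinate directions. -/
theorem lintegral_pwConst_add_sub_le (c : Fin T.numCells → ℝ) (j : Fin d) {t : ℝ} (ht : 0 < t) :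
    ∫⁻ x, ‖pwConst T c (x + t • EuclideanSpace.single j 1) - pwConst T c x‖ₑ ≤
      ENNReal.ofReal (t * ∑ p : T.FacetIdx, jump c p * (2 * p.diam) ^ (d - 1)) := by
  set e : Vec d := EuclideanSpace.single j 1 with he
  set H : T.FacetIdx → Set (Vec d) := fun p => (T.cell p.1).crossing p.2 e t with hH
  -- Crossing sets are replaced by measurable hulls of the same measure, so that the integral of the
  -- sum can be taken term by term.
  have hae : ∀ᵐ x : Vec d, ‖pwConst T c (x + t • e) - pwConst T c x‖ₑ ≤
      ∑ p : T.FacetIdx, (toMeasurable volume (H p)).indicator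
        (fun _ => ENNReal.ofReal (jump c p)) x := by
    have h1 : ∀ᵐ x : Vec d, ∀ k, _ := eventually_all.2 fun k =>
      (T.cell k).ae_indicator_add_sub e ht
    filter_upwards [h1] with x hx
    set g : T.FacetIdx → ℝ := fun p => Real.sign (inner ℝ p.normal e) *
      (H p).indicator (fun _ => (1 : ℝ)) x with hg
    have h2 : pwConst T c (x + t • e) - pwConst T c x = -∑ p : T.FacetIdx, c p.1 * g p := by
      unfold pwConst
      rw [← Finset.sum_sub_distrib, Fintype.sum_sigma, ← Finset.sum_neg_distrib]
      refine Finset.sum_congr rfl fun k _ => ?_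
      trans c k * ((T.cell k).pts.indicator (fun _ => (1 : ℝ)) (x + t • e) -
        (T.cell k).pts.indicator (fun _ => 1) x)
      · rw [mul_sub]
        congr 1 <;> simp [Set.indicator_apply, pts]
      · rw [hx k, mul_neg, Finset.mul_sum]
    have h3 := sum_mul_le_sum_jump c g (by
      intro p hp
      simp only [hg, hp.opp_normal, inner_neg_left, Real.sign_neg]
      have : H p.opp = H p := by
        simp only [hH, Cell.crossing]
        have : (T.cell p.opp.1).facet p.opp.2 = (T.cell p.1).facet p.2 := p.opp_set
        rw [this]
      rw [this, neg_mul])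
    rw [h2, enorm_neg, Real.enorm_eq_ofReal_abs]
    refine (ENNReal.ofReal_le_ofReal h3).trans ?_
    rw [ENNReal.ofReal_sum_of_nonneg fun p _ => mul_nonneg (jump_nonneg c p) (abs_nonneg _)]
    refine Finset.sum_le_sum fun p _ => ?_
    by_cases hxp : x ∈ H p
    · rw [Set.indicator_of_mem (subset_toMeasurable volume _ hxp)]
      refine ENNReal.ofReal_le_ofReal (mul_le_of_le_one_right (jump_nonneg c p) ?_)
      simp only [hg, Set.indicator_of_mem hxp, mul_one]
      rcases Real.sign_apply_eq (inner ℝ p.normal e) with h | h | h <;> rw [h] <;> norm_num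
    · simp [hg, Set.indicator_of_notMem hxp]
  refine (lintegral_mono_ae hae).trans ?_
  rw [lintegral_finsetSum _ fun p _ => measurable_const.indicator (measurableSet_toMeasurable _ _),
    Finset.mul_sum, ENNReal.ofReal_sum_of_nonneg fun p _ => mul_nonneg ht.le
      (mul_nonneg (jump_nonneg c p) (pow_nonneg (mul_nonneg zero_le_two p.diam_nonneg) _))]
  refine Finset.sum_le_sum fun p _ => ?_
  rw [lintegral_indicator_const (measurableSet_toMeasurable _ _), measure_toMeasurable]
  have h4 := (T.cell p.1).volume_crossing_le p.2 j ht (r := p.diam)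
    fun x hx y hy => p.dist_le_diam hx hy
  calc _ ≤ ENNReal.ofReal (jump c p) * ENNReal.ofReal (t * (2 * p.diam) ^ (d - 1)) := by
        gcongr
    _ = _ := by
        rw [← ENNReal.ofReal_mul (jump_nonneg c p)]
        congr 1
        ring

end Mesh

end NCFlow

end

/-! ### From translation bounds to a Gagliardo–Nirenberg–Sobolev inequality -/

noncomputable section

namespace NCFlow

open Module Filter Topology ContinuousLinearMap
open scoped Convolution NNReal

variable {d : ℕ}

/-- Convolution with a bump function does not increase the `L¹` modulus of continuity. -/
theorem lintegral_bump_convolution_add_sub_le (φ : ContDiffBump (0 : Vec d)) {f : Vec d → ℝ}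
    (hf : Measurable f) (hfi : Integrable f volume) (v : Vec d) :
    ∫⁻ x, ‖(φ.normed volume ⋆[lsmul ℝ ℝ, volume] f) (x + v) -
        (φ.normed volume ⋆[lsmul ℝ ℝ, volume] f) x‖ₑ ≤ ∫⁻ x, ‖f (x + v) - f x‖ₑ := by
  have hex : ConvolutionExists (φ.normed volume) f (lsmul ℝ ℝ) volume :=
    φ.hasCompactSupport_normed.convolutionExists_left _ φ.continuous_normed
      hfi.locallyIntegrable
  have h1 : ∀ x, ‖(φ.normed volume ⋆[lsmul ℝ ℝ, volume] f) (x + v) -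
      (φ.normed volume ⋆[lsmul ℝ ℝ, volume] f) x‖ₑ ≤
      ∫⁻ y, ‖φ.normed volume y‖ₑ * ‖f (x - y + v) - f (x - y)‖ₑ := by
    intro x
    rw [convolution_def, convolution_def, ← integral_sub (hex (x + v)) (hex x)]
    refine (enorm_integral_le_lintegral_enorm _).trans (le_of_eq ?_)
    refine lintegral_congr fun y => ?_
    simp only [lsmul_apply, smul_eq_mul]
    rw [← mul_sub, enorm_mul, add_sub_right_comm]
  refine (lintegral_mono h1).trans ?_
  have hm : Measurable (φ.normed volume) := φ.continuous_normed.measurable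
  have hm2 : Measurable fun x => ‖f (x + v) - f x‖ₑ :=
    ((hf.comp (measurable_add_const v)).sub hf).enorm
  have hm3 : Measurable (Function.uncurry fun x y : Vec d =>
      ‖φ.normed volume y‖ₑ * ‖f (x - y + v) - f (x - y)‖ₑ) :=
    (hm.comp measurable_snd).enorm.mul (hm2.comp (measurable_fst.sub measurable_snd))
  rw [lintegral_lintegral_swap hm3.aemeasurable]
  have h2 : ∀ y, ∫⁻ x, ‖φ.normed volume y‖ₑ * ‖f (x - y + v) - f (x - y)‖ₑ =
      ‖φ.normed volume y‖ₑ * ∫⁻ x, ‖f (x + v) - f x‖ₑ := by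
    intro y
    have hm4 : Measurable fun x => ‖f (x - y + v) - f (x - y)‖ₑ :=
      hm2.comp (measurable_sub_const y)
    rw [lintegral_const_mul _ hm4]
    congr 1
    exact lintegral_sub_right_eq_self (fun x => ‖f (x + v) - f x‖ₑ) y
  simp_rw [h2]
  rw [lintegral_mul_const _ hm.enorm]
  have h3 : ∫⁻ y, ‖φ.normed volume y‖ₑ = 1 := by
    have h4 : ∀ y, ‖φ.normed volume y‖ₑ = ENNReal.ofReal (φ.normed volume y) := fun y => by
      rw [Real.enorm_eq_ofReal (φ.nonneg_normed y)]
    simp_rw [h4]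
    rw [← ofReal_integral_eq_lintegral_ofReal φ.integrable_normed
      (Eventually.of_forall φ.nonneg_normed), φ.integral_normed, ENNReal.ofReal_one]
  rw [h3, one_mul]

/-- Difference quotients have `L¹` norm at most `A` and converge pointwise to the directional
derivative; Fatou's lemma concludes. -/
theorem lintegral_enorm_fderiv_apply_le {u : Vec d → ℝ} (hu : ContDiff ℝ 1 u) (v : Vec d)
    {A : ℝ} (h : ∀ t : ℝ, 0 < t → ∫⁻ x, ‖u (x + t • v) - u x‖ₑ ≤ ENNReal.ofReal (t * A)) :
    ∫⁻ x, ‖fderiv ℝ u x v‖ₑ ≤ ENNReal.ofReal A := by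
  set τ : ℕ → ℝ := fun n => 1 / ((n : ℝ) + 1) with hτ
  have hτpos : ∀ n, 0 < τ n := fun n => by positivity
  have hτlim : Tendsto τ atTop (𝓝[>] 0) :=
    tendsto_nhdsWithin_iff.2 ⟨tendsto_one_div_add_atTop_nhds_zero_nat,
      Eventually.of_forall hτpos⟩
  have hlim : ∀ x, Tendsto (fun n => ‖(τ n)⁻¹ • (u (x + τ n • v) - u x)‖ₑ) atTop
      (𝓝 ‖fderiv ℝ u x v‖ₑ) := by
    intro x
    have h1 := ((hu.differentiable one_ne_zero) x).hasFDerivAt.hasLineDerivAt v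
    exact (h1.tendsto_slope_zero_right.comp hτlim).enorm
  have hc : Continuous u := hu.continuous
  calc ∫⁻ x, ‖fderiv ℝ u x v‖ₑ
      = ∫⁻ x, liminf (fun n => ‖(τ n)⁻¹ • (u (x + τ n • v) - u x)‖ₑ) atTop :=
        lintegral_congr fun x => (hlim x).liminf_eq.symm
    _ ≤ liminf (fun n => ∫⁻ x, ‖(τ n)⁻¹ • (u (x + τ n • v) - u x)‖ₑ) atTop :=
        lintegral_liminf_le fun n => by fun_prop
    _ ≤ ENNReal.ofReal A := by
        refine liminf_le_of_le (by isBoundedDefault) fun b hb => ?_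
        obtain ⟨n, hn⟩ := hb.exists
        refine hn.trans ?_
        simp_rw [enorm_smul]
        rw [lintegral_const_mul _ (by fun_prop)]
        refine (mul_le_mul_right (h _ (hτpos n)) _).trans (le_of_eq ?_)
        rw [Real.enorm_eq_ofReal (inv_nonneg.2 (hτpos n).le),
          ← ENNReal.ofReal_mul (inv_nonneg.2 (hτpos n).le), inv_mul_cancel_left₀ (hτpos n).ne']

theorem enorm_dual_le_sum (L : Vec d →L[ℝ] ℝ) :
    ‖L‖ₑ ≤ ∑ j, ‖L (EuclideanSpace.single j 1)‖ₑ := by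
  have h1 : ‖L‖ ≤ ∑ j, ‖L (EuclideanSpace.single j 1)‖ := by
    refine L.opNorm_le_bound (Finset.sum_nonneg fun _ _ => norm_nonneg _) fun x => ?_
    have h2 : x = ∑ j, x j • EuclideanSpace.single j (1 : ℝ) := by
      have := (EuclideanSpace.basisFun (Fin d) ℝ).sum_repr x
      simpa using this.symm
    conv_lhs => rw [h2, map_sum]
    refine (norm_sum_le _ _).trans ?_
    rw [Finset.sum_mul]
    refine Finset.sum_le_sum fun j _ => ?_
    rw [map_smul, norm_smul, mul_comm]
    exact mul_le_mul_of_nonneg_left (PiLp.norm_apply_le x j) (norm_nonneg _)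
  calc ‖L‖ₑ = ENNReal.ofReal ‖L‖ := (ofReal_norm L).symm
    _ ≤ ENNReal.ofReal (∑ j, ‖L (EuclideanSpace.single j 1)‖) := ENNReal.ofReal_le_ofReal h1
    _ = _ := by
      rw [ENNReal.ofReal_sum_of_nonneg fun _ _ => norm_nonneg _]
      simp_rw [ofReal_norm]

/-- Gagliardo–Nirenberg–Sobolev inequality for integrable functions of compact support whose `L¹`
modulus of continuity in coordinate directions is linear. -/
theorem eLpNorm_le_of_translation_bound {p : ℝ≥0} (hp : NNReal.HolderConjugate d p)
    {f : Vec d → ℝ} (hf : Measurable f) (hfi : Integrable f volume) (hfc : HasCompactSupport f)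
    {A : ℝ} (h : ∀ (j : Fin d) (t : ℝ), 0 < t →
      ∫⁻ x, ‖f (x + t • EuclideanSpace.single j 1) - f x‖ₑ ≤ ENNReal.ofReal (t * A)) :
    eLpNorm f p volume ≤
      eLpNormLESNormFDerivOneConst (volume : Measure (Vec d)) p * (d * ENNReal.ofReal A) := by
  -- The fixed ratio `rOut / rIn = 2` is what yields almost everywhere convergence of the
  -- mollifications of a merely integrable function.
  set φ : ℕ → ContDiffBump (0 : Vec d) := fun n =>
    { rIn := 1 / ((n : ℝ) + 1)
      rOut := 2 * (1 / ((n : ℝ) + 1))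
      rIn_pos := by positivity
      rIn_lt_rOut := by
        have : (0 : ℝ) < 1 / ((n : ℝ) + 1) := by positivity
        linarith } with hφ
  set u : ℕ → Vec d → ℝ := fun n => (φ n).normed volume ⋆[lsmul ℝ ℝ, volume] f with hu
  have hsmooth : ∀ n, ContDiff ℝ 1 (u n) := fun n =>
    (φ n).hasCompactSupport_normed.contDiff_convolution_left _ (φ n).contDiff_normed
      hfi.locallyIntegrable
  have hlim : ∀ᵐ x : Vec d, Tendsto (fun n => u n x) atTop (𝓝 (f x)) := by
    refine ContDiffBump.ae_convolution_tendsto_right_of_locallyIntegrable (K := 2) ?_ ?_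
      hfi.locallyIntegrable
    · have := (tendsto_one_div_add_atTop_nhds_zero_nat (𝕜 := ℝ)).const_mul 2
      simpa [hφ] using this
    · exact Eventually.of_forall fun n => le_rfl
  have hbound : ∀ n, eLpNorm (u n) p volume ≤
      eLpNormLESNormFDerivOneConst (volume : Measure (Vec d)) p * (d * ENNReal.ofReal A) := by
    intro n
    refine (eLpNorm_le_eLpNorm_fderiv_one volume (hsmooth n)
      ((φ n).hasCompactSupport_normed.convolution _ hfc) (p := p) (by simpa using hp)).trans ?_
    gcongr
    rw [eLpNorm_one_eq_lintegral_enorm]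
    refine (lintegral_mono fun x => enorm_dual_le_sum (fderiv ℝ (u n) x)).trans ?_
    have hcf := (hsmooth n).continuous_fderiv one_ne_zero
    rw [lintegral_finsetSum _ fun j _ => by fun_prop]
    refine (Finset.sum_le_sum fun j _ => lintegral_enorm_fderiv_apply_le (hsmooth n) _
      (A := A) fun t ht => (lintegral_bump_convolution_add_sub_le (φ n) hf hfi _).trans
        (h j t ht)).trans ?_
    simp
  -- The bound for the mollifications does not depend on `n` and passes to the almost everywhere
  -- limit by Fatou.
  refine (Lp.eLpNorm_lim_le_liminf_eLpNorm (fun n => (hsmooth n).continuous.aestronglyMeasurable)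
    f hlim).trans ?_
  refine liminf_le_of_le (by isBoundedDefault) fun b hb => ?_
  obtain ⟨n, hn⟩ := hb.exists
  exact hn.trans (hbound n)

end NCFlow

end

/-! ### Sobolev inequality for piecewise constants, and sums over facets -/

noncomputable section

namespace NCFlow

open Module Filter Topology
open scoped NNReal

namespace Mesh

variable {d : ℕ} {Ω : Set (Vec d)} {T : Mesh d Ω}

/-- The volume weighted `ℓ^q` norm of a family of reals indexed by the cells. -/
def wNorm (T : Mesh d Ω) (q : ℝ) (c : Fin T.numCells → ℝ) : ℝ :=
  (∑ k, (T.cell k).vol * c k ^ q) ^ (1 / q)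

theorem pwConst_of_mem (c : Fin T.numCells → ℝ) {k : Fin T.numCells} {x : Vec d}
    (hx : x ∈ T.pts k) : pwConst T c x = c k := by
  unfold pwConst
  rw [Finset.sum_eq_single k, Set.indicator_of_mem hx]
  · intro l _ hl
    exact Set.indicator_of_notMem
      (fun hxl => Set.disjoint_left.1 (T.disjoint l k hl) hxl hx) _
  · simp

theorem measurable_pwConst (c : Fin T.numCells → ℝ) : Measurable (pwConst T c) :=
  Finset.measurable_fun_sum _ fun k _ =>
    measurable_const.indicator (T.cell k).isOpen_pts.measurableSet

theorem integrable_pwConst (c : Fin T.numCells → ℝ) : Integrable (pwConst T c) volume :=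
  integrable_finsetSum _ fun k _ =>
    (integrable_indicator_iff (T.cell k).isOpen_pts.measurableSet).2
      (integrableOn_const (T.cell k).volume_pts_lt_top.ne)

theorem hasCompactSupport_pwConst (c : Fin T.numCells → ℝ) : HasCompactSupport (pwConst T c) := by
  refine HasCompactSupport.intro (K := ⋃ k, (T.cell k).closedPts)
    (isCompact_iUnion fun k => (T.cell k).isCompact_closedPts) fun x hx => ?_
  refine Finset.sum_eq_zero fun k _ => Set.indicator_of_notMem (fun h => hx ?_) _
  exact Set.mem_iUnion.2 ⟨k, (T.cell k).pts_subset_closedPts h⟩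

theorem sum_vol_mul_rpow_le_lintegral {c : Fin T.numCells → ℝ} (hc : ∀ k, 0 ≤ c k) {q : ℝ}
    (hq : 0 ≤ q) :
    ENNReal.ofReal (∑ k, (T.cell k).vol * c k ^ q) ≤ ∫⁻ x, ‖pwConst T c x‖ₑ ^ q := by
  calc ENNReal.ofReal (∑ k, (T.cell k).vol * c k ^ q)
      = ∑ k, ∫⁻ x in T.pts k, ‖pwConst T c x‖ₑ ^ q := by
        rw [ENNReal.ofReal_sum_of_nonneg fun k _ =>
          mul_nonneg (T.cell k).vol_pos.le (Real.rpow_nonneg (hc k) _)]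
        refine Finset.sum_congr rfl fun k _ => ?_
        rw [setLIntegral_congr_fun (g := fun _ => ENNReal.ofReal (c k ^ q))
          (T.cell k).isOpen_pts.measurableSet, setLIntegral_const, mul_comm,
          ENNReal.ofReal_mul (Real.rpow_nonneg (hc k) _), Cell.vol,
          ofReal_measureReal (T.cell k).volume_pts_lt_top.ne]
        intro x hx
        change ‖pwConst T c x‖ₑ ^ q = ENNReal.ofReal (c k ^ q)
        rw [pwConst_of_mem c hx, Real.enorm_eq_ofReal (hc k),
          ENNReal.ofReal_rpow_of_nonneg (hc k) hq]
    _ = ∫⁻ x in ⋃ k, T.pts k, ‖pwConst T c x‖ₑ ^ q := by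
        rw [lintegral_iUnion (fun k => (T.cell k).isOpen_pts.measurableSet)
          (fun k l hkl => T.disjoint k l hkl), tsum_fintype]
    _ ≤ _ := setLIntegral_le_lintegral _ _

/-- Sobolev inequality for piecewise constant functions. -/
theorem exists_wNorm_le_sum_jump (hd : 2 ≤ d) : ∃ C : ℝ, 0 < C ∧ ∀ (Ω : Set (Vec d))
    (T : Mesh d Ω) (c : Fin T.numCells → ℝ), (∀ k, 0 ≤ c k) →
      wNorm T (d / (d - 1)) c ≤ C * ∑ p : T.FacetIdx, jump c p * (2 * p.diam) ^ (d - 1) := by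
  have hd' : (2 : ℝ) ≤ d := by exact_mod_cast hd
  set p : ℝ≥0 := ⟨(d : ℝ) / (d - 1), div_nonneg (by linarith) (by linarith)⟩ with hp
  have hpd : NNReal.HolderConjugate d p := by
    rw [← NNReal.holderConjugate_coe_iff]
    have := Real.HolderConjugate.conjExponent (p := (d : ℝ)) (by linarith)
    exact this
  have hp0 : (0 : ℝ) < p := by
    change 0 < (d : ℝ) / (d - 1)
    exact div_pos (by linarith) (by linarith)
  set C₀ := eLpNormLESNormFDerivOneConst (volume : Measure (Vec d)) p with hC₀
  -- The summand `1` makes the constant positive without knowing that `C₀` is.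
  refine ⟨C₀ * d + 1, by positivity, fun Ω T c hc => ?_⟩
  have hJ : 0 ≤ ∑ p : T.FacetIdx, jump c p * (2 * p.diam) ^ (d - 1) :=
    Finset.sum_nonneg fun p _ => mul_nonneg (jump_nonneg c p)
      (pow_nonneg (mul_nonneg zero_le_two p.diam_nonneg) _)
  have h1 := eLpNorm_le_of_translation_bound hpd (measurable_pwConst c) (integrable_pwConst c)
    (hasCompactSupport_pwConst c) fun j t ht => lintegral_pwConst_add_sub_le c j ht
  have h2 := sum_vol_mul_rpow_le_lintegral hc hp0.le
  rw [← eLpNorm_nnreal_pow_eq_lintegral (NNReal.coe_pos.1 hp0).ne'] at h2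
  have h3 : ENNReal.ofReal (wNorm T (d / (d - 1)) c) ≤ eLpNorm (pwConst T c) p volume := by
    have h4 := ENNReal.rpow_le_rpow h2 (z := 1 / (p : ℝ)) (by positivity)
    rw [← ENNReal.rpow_mul, mul_one_div_cancel hp0.ne', ENNReal.rpow_one,
      ENNReal.ofReal_rpow_of_nonneg (Finset.sum_nonneg fun k _ =>
        mul_nonneg (T.cell k).vol_pos.le (Real.rpow_nonneg (hc k) _)) (by positivity)] at h4
    exact h4
  have h5 := h3.trans h1
  rw [← ENNReal.ofReal_natCast, ← ENNReal.ofReal_mul (by positivity), ← ENNReal.ofReal_coe_nnreal,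
    ← ENNReal.ofReal_mul (by positivity), ENNReal.ofReal_le_ofReal_iff (by positivity)] at h5
  refine h5.trans ?_
  rw [← mul_assoc]
  exact mul_le_mul_of_nonneg_right (by linarith) hJ

/-- Facet sums of products are bounded by the product of weighted `ℓ²` norms. -/
theorem sum_facet_mul_le (hd : 2 ≤ d) {κ : ℝ} (hκ : 0 < κ)
    (hT : ∀ k, κ * (T.cell k).diam ^ d ≤ (T.cell k).vol) {A G : Fin T.numCells → ℝ}
    (hA : ∀ k, 0 ≤ A k) (hG : ∀ k, 0 ≤ G k) :
    ∑ p : T.FacetIdx, p.diam ^ (d - 1) * ((A p.1 + A p.opp.1) *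
      ((T.cell p.1).diam * G p.1 + (T.cell p.opp.1).diam * G p.opp.1)) ≤
    8 * d / κ * (√(∑ k, (T.cell k).vol * A k ^ 2) * √(∑ k, (T.cell k).vol * G k ^ 2)) := by
  set h : Fin T.numCells → ℝ := fun k => (T.cell k).diam with hh
  have hh0 : ∀ k, 0 ≤ h k := fun k => (T.cell k).diam_nonneg
  set w : Fin T.numCells → ℝ := fun k => √(h k ^ d) with hw
  have hw0 : ∀ k, 0 ≤ w k := fun k => Real.sqrt_nonneg _
  -- Adjacent cells are not assumed to be of comparable size. It suffices that the facet diameter is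
  -- at most each of the two cell diameters: the `d - 1` powers of it are shared out to make the
  -- exponents `d/2` and `d/2`.
  have key : ∀ (p : T.FacetIdx) (k l : Fin T.numCells), p.diam ≤ h k → p.diam ≤ h l →
      p.diam ^ (d - 1) * h l ≤ w k * w l := by
    intro p k l hk hl
    have hp := p.diam_nonneg
    rw [hw, ← Real.sqrt_mul (pow_nonneg (hh0 k) d)]
    apply Real.le_sqrt_of_sq_le
    obtain ⟨n, rfl⟩ : ∃ n, d = n + 2 := ⟨d - 2, by omega⟩
    calc (p.diam ^ (n + 2 - 1) * h l) ^ 2 = p.diam ^ (n + 2) * (p.diam ^ n * h l ^ 2) := by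
          rw [show n + 2 - 1 = n + 1 by omega]; ring
      _ ≤ h k ^ (n + 2) * (h l ^ n * h l ^ 2) := by
          have := hh0 l
          have := hh0 k
          gcongr
      _ = _ := by ring
  have hterm : ∀ p : T.FacetIdx, p.diam ^ (d - 1) * ((A p.1 + A p.opp.1) *
      (h p.1 * G p.1 + h p.opp.1 * G p.opp.1)) ≤
      (w p.1 * A p.1 + w p.opp.1 * A p.opp.1) * (w p.1 * G p.1 + w p.opp.1 * G p.opp.1) := by
    intro p
    have h1 := p.diam_le
    have h2 := p.diam_le_opp
    have e1 := mul_le_mul_of_nonneg_right (key p _ _ h1 h1) (mul_nonneg (hA p.1) (hG p.1))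
    have e2 := mul_le_mul_of_nonneg_right (key p _ _ h1 h2) (mul_nonneg (hA p.1) (hG p.opp.1))
    have e3 := mul_le_mul_of_nonneg_right (key p _ _ h2 h1) (mul_nonneg (hA p.opp.1) (hG p.1))
    have e4 := mul_le_mul_of_nonneg_right (key p _ _ h2 h2) (mul_nonneg (hA p.opp.1) (hG p.opp.1))
    linear_combination e1 + e2 + e3 + e4
  -- The constant is 2 from squaring a sum, 2 from the two sides of a facet, `2 * d` from the facets
  -- of a cell and `1 / κ` from the volume bound.
  have hsq : ∀ B : Fin T.numCells → ℝ,
      ∑ p : T.FacetIdx, (w p.1 * B p.1 + w p.opp.1 * B p.opp.1) ^ 2 ≤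
        8 * d / κ * ∑ k, (T.cell k).vol * B k ^ 2 := by
    intro B
    calc ∑ p : T.FacetIdx, (w p.1 * B p.1 + w p.opp.1 * B p.opp.1) ^ 2
        ≤ ∑ p : T.FacetIdx, (2 * (w p.1 * B p.1) ^ 2 + 2 * (w p.opp.1 * B p.opp.1) ^ 2) :=
          Finset.sum_le_sum fun p _ => by
            nlinarith [sq_nonneg (w p.1 * B p.1 - w p.opp.1 * B p.opp.1)]
      _ = 4 * ∑ p : T.FacetIdx, (w p.1 * B p.1) ^ 2 := by
          rw [Finset.sum_add_distrib, ← Finset.mul_sum, ← Finset.mul_sum,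
            sum_opp fun p : T.FacetIdx => (w p.1 * B p.1) ^ 2]
          ring
      _ ≤ 4 * (2 * d * ∑ k, (w k * B k) ^ 2) :=
          mul_le_mul_of_nonneg_left (sum_fst_le fun k => sq_nonneg (w k * B k)) (by norm_num)
      _ = 8 * d / κ * ∑ k, κ * (w k * B k) ^ 2 := by
          rw [← Finset.mul_sum]
          field_simp
          ring
      _ ≤ _ := by
          refine mul_le_mul_of_nonneg_left (Finset.sum_le_sum fun k _ => ?_) (by positivity)
          rw [mul_pow, hw, Real.sq_sqrt (pow_nonneg (hh0 k) d), ← mul_assoc]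
          exact mul_le_mul_of_nonneg_right (hT k) (sq_nonneg _)
  have hκ' : 0 ≤ 8 * d / κ := by positivity
  calc _ ≤ ∑ p : T.FacetIdx, (w p.1 * A p.1 + w p.opp.1 * A p.opp.1) *
        (w p.1 * G p.1 + w p.opp.1 * G p.opp.1) := Finset.sum_le_sum fun p _ => hterm p
    _ ≤ √(∑ p : T.FacetIdx, (w p.1 * A p.1 + w p.opp.1 * A p.opp.1) ^ 2) *
        √(∑ p : T.FacetIdx, (w p.1 * G p.1 + w p.opp.1 * G p.opp.1) ^ 2) :=
        Real.sum_mul_le_sqrt_mul_sqrt _ _ _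
    _ ≤ √(8 * d / κ * ∑ k, (T.cell k).vol * A k ^ 2) *
        √(8 * d / κ * ∑ k, (T.cell k).vol * G k ^ 2) := by
        gcongr
        · exact hsq A
        · exact hsq G
    _ = _ := by
        rw [Real.sqrt_mul hκ', Real.sqrt_mul hκ', mul_mul_mul_comm, Real.mul_self_sqrt hκ']

theorem wNorm_nonneg {q : ℝ} {c : Fin T.numCells → ℝ} (hc : ∀ k, 0 ≤ c k) : 0 ≤ wNorm T q c :=
  Real.rpow_nonneg (Finset.sum_nonneg fun k _ =>
    mul_nonneg (T.cell k).vol_pos.le (Real.rpow_nonneg (hc k) _)) _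

theorem sum_vol_le (hΩ : Bornology.IsBounded Ω) : ∑ k, (T.cell k).vol ≤ volume.real Ω := by
  have h : volume.real (⋃ k, T.pts k) = ∑ k, (T.cell k).vol :=
    measureReal_iUnion_fintype (fun k l hkl => T.disjoint k l hkl)
      (fun k => (T.cell k).isOpen_pts.measurableSet) (fun k => (T.cell k).volume_pts_lt_top.ne)
  rw [← h]
  exact measureReal_mono (Set.iUnion_subset T.cell_subset) hΩ.measure_lt_top.ne

/-- Hölder's inequality between weighted power sums. -/
theorem sum_vol_rpow_le {W : ℝ} (hW : ∑ k, (T.cell k).vol ≤ W) {a q : ℝ} (ha : 0 < a)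
    (haq : a ≤ q) {c : Fin T.numCells → ℝ} (hc : ∀ k, 0 ≤ c k) :
    ∑ k, (T.cell k).vol * c k ^ a ≤
      W ^ (1 - a / q) * (∑ k, (T.cell k).vol * c k ^ q) ^ (a / q) := by
  have hq : 0 < q := ha.trans_le haq
  have h := Real.inner_le_weight_mul_Lp_of_nonneg Finset.univ (p := q / a)
    ((one_le_div ha).2 haq) (fun k => (T.cell k).vol) (fun k => c k ^ a)
    (fun k => (T.cell k).vol_pos.le) (fun k => Real.rpow_nonneg (hc k) _)
  have e : ∀ k, (c k ^ a) ^ (q / a) = c k ^ q := fun k => by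
    rw [← Real.rpow_mul (hc k), mul_div_cancel₀ _ ha.ne']
  simp only [e, inv_div] at h
  refine h.trans (mul_le_mul_of_nonneg_right ?_ (Real.rpow_nonneg (Finset.sum_nonneg fun k _ =>
    mul_nonneg (T.cell k).vol_pos.le (Real.rpow_nonneg (hc k) _)) _))
  exact Real.rpow_le_rpow (Finset.sum_nonneg fun k _ => (T.cell k).vol_pos.le) hW
    (sub_nonneg.2 ((div_le_one hq).2 haq))

theorem wNorm_le_wNorm {W : ℝ} (hW : ∑ k, (T.cell k).vol ≤ W) {a q : ℝ} (ha : 0 < a)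
    (haq : a ≤ q) {c : Fin T.numCells → ℝ} (hc : ∀ k, 0 ≤ c k) :
    wNorm T a c ≤ W ^ (1 / a - 1 / q) * wNorm T q c := by
  have hq : 0 < q := ha.trans_le haq
  have hs : ∀ b : ℝ, 0 ≤ ∑ k, (T.cell k).vol * c k ^ b := fun b => Finset.sum_nonneg fun k _ =>
    mul_nonneg (T.cell k).vol_pos.le (Real.rpow_nonneg (hc k) _)
  have hW0 : 0 ≤ W := (Finset.sum_nonneg fun k _ => (T.cell k).vol_pos.le).trans hW
  have h := Real.rpow_le_rpow (hs a) (sum_vol_rpow_le hW ha haq hc) (z := 1 / a) (by positivity)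
  rw [Real.mul_rpow (Real.rpow_nonneg hW0 _) (Real.rpow_nonneg (hs q) _), ← Real.rpow_mul hW0,
    ← Real.rpow_mul (hs q)] at h
  rw [show (1 - a / q) * (1 / a) = 1 / a - 1 / q by field_simp,
    show a / q * (1 / a) = 1 / q by field_simp] at h
  exact h

/-- The tangent line inequality for the convex function `t ↦ t ^ s` at `a`, obtained from
Bernoulli's inequality for `b / a`. -/
theorem rpow_sub_rpow_le {a b s : ℝ} (ha : 0 ≤ a) (hb : 0 ≤ b) (hs : 1 ≤ s) :
    a ^ s - b ^ s ≤ s * a ^ (s - 1) * (a - b) := by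
  rcases ha.eq_or_lt with rfl | ha
  · rw [Real.zero_rpow (by linarith)]
    have h1 := Real.rpow_nonneg hb s
    rcases hs.eq_or_lt with rfl | hs
    · simp
    · rw [Real.zero_rpow (by linarith)]; linarith
  have h := one_add_mul_self_le_rpow_one_add (s := b / a - 1) (by
    have : 0 ≤ b / a := by positivity
    linarith) hs
  rw [add_sub_cancel, Real.div_rpow hb ha.le, le_div_iff₀ (Real.rpow_pos_of_pos ha s)] at h
  have e : a ^ s = a ^ (s - 1) * a := by
    rw [← Real.rpow_add_one ha.ne']; congr 1; ring
  have e2 : s * (b / a - 1) * a ^ s = s * a ^ (s - 1) * (b - a) := by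
    rw [e]; field_simp
  linarith

theorem abs_rpow_sub_rpow_le {a b s : ℝ} (ha : 0 ≤ a) (hb : 0 ≤ b) (hs : 1 ≤ s) :
    |a ^ s - b ^ s| ≤ s * (a ^ (s - 1) + b ^ (s - 1)) * |a - b| := by
  wlog hab : b ≤ a generalizing a b
  · rw [abs_sub_comm, abs_sub_comm a, add_comm (a ^ (s - 1))]
    exact this hb ha (le_of_not_ge hab)
  rw [abs_of_nonneg (sub_nonneg.2 (Real.rpow_le_rpow hb hab (by linarith))),
    abs_of_nonneg (sub_nonneg.2 hab)]
  refine (rpow_sub_rpow_le ha hb hs).trans ?_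
  refine mul_le_mul_of_nonneg_right ?_ (sub_nonneg.2 hab)
  have h1 : 0 ≤ s * b ^ (s - 1) := mul_nonneg (by linarith) (Real.rpow_nonneg hb (s - 1))
  linarith

end Mesh

end NCFlow

end

/-! ### Crouzeix–Raviart functions and their discrete Sobolev inequality -/

noncomputable section

namespace NCFlow

open Module Filter Topology

namespace Mesh

variable {d m : ℕ} {Ω : Set (Vec d)} {T : Mesh d Ω}

theorem gradInner_self (f : Vec d →ᵃ[ℝ] Vec m) : gradInner f f = ∑ j, ‖pderiv f j‖ ^ 2 := by
  simp [gradInner]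

theorem gradInner_self_nonneg (f : Vec d →ᵃ[ℝ] Vec m) : 0 ≤ gradInner f f := by
  rw [gradInner_self]; positivity

theorem gradNorm_nonneg (f : Vec d →ᵃ[ℝ] Vec m) : 0 ≤ gradNorm f := Real.sqrt_nonneg _

theorem gradNorm_sq (f : Vec d →ᵃ[ℝ] Vec m) : gradNorm f ^ 2 = gradInner f f :=
  Real.sq_sqrt (gradInner_self_nonneg f)

theorem gradNorm_eq (f : Vec d →ᵃ[ℝ] Vec m) : gradNorm f = √(∑ j, ‖pderiv f j‖ ^ 2) := by
  rw [gradNorm, gradInner_self]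

theorem abs_gradInner_le (f g : Vec d →ᵃ[ℝ] Vec m) :
    |gradInner f g| ≤ gradNorm f * gradNorm g := by
  rw [gradNorm_eq, gradNorm_eq]
  refine (Finset.abs_sum_le_sum_abs _ _).trans ((Finset.sum_le_sum fun j _ =>
    abs_real_inner_le_norm _ _).trans (Real.sum_mul_le_sqrt_mul_sqrt _ _ _))

theorem norm_linear_le (f : Vec d →ᵃ[ℝ] Vec m) (x : Vec d) :
    ‖f.linear x‖ ≤ gradNorm f * ‖x‖ := by
  have h2 : x = ∑ j, x j • EuclideanSpace.single j (1 : ℝ) := by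
    have := (EuclideanSpace.basisFun (Fin d) ℝ).sum_repr x
    simpa using this.symm
  have h3 : f.linear x = ∑ j, x j • pderiv f j := by
    conv_lhs => rw [h2, map_sum]
    simp [pderiv]
  rw [h3, gradNorm_eq, EuclideanSpace.norm_eq x, mul_comm]
  refine (norm_sum_le _ _).trans ?_
  simp_rw [norm_smul]
  exact Real.sum_mul_le_sqrt_mul_sqrt _ _ _

theorem norm_sub_le_gradNorm (f : Vec d →ᵃ[ℝ] Vec m) (x y : Vec d) :
    ‖f x - f y‖ ≤ gradNorm f * dist x y := by
  rw [dist_eq_norm, ← vsub_eq_sub, ← f.linearMap_vsub, vsub_eq_sub]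
  exact norm_linear_le f _

theorem continuous_affine (f : Vec d →ᵃ[ℝ] Vec m) : Continuous f :=
  f.continuous_of_finiteDimensional

theorem pderiv_sub (f g : Vec d →ᵃ[ℝ] Vec m) (j : Fin d) :
    pderiv (f - g) j = pderiv f j - pderiv g j := by
  simp [pderiv]

theorem gradInner_sub_left (f g h : Vec d →ᵃ[ℝ] Vec m) :
    gradInner (f - g) h = gradInner f h - gradInner g h := by
  simp [gradInner, pderiv_sub, inner_sub_left]

/-- A point of each cell. -/
def base (T : Mesh d Ω) (k : Fin T.numCells) : Vec d := (T.cell k).pts_nonempty.some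

theorem base_mem (k : Fin T.numCells) : T.base k ∈ (T.cell k).closedPts :=
  (T.cell k).pts_subset_closedPts (T.cell k).pts_nonempty.some_mem

/-- A bound for a piecewise affine function on a cell. -/
def cellBound (v : T.PW m) (k : Fin T.numCells) : ℝ :=
  ‖v k (T.base k)‖ + (T.cell k).diam * gradNorm (v k)

theorem cellBound_nonneg (v : T.PW m) (k : Fin T.numCells) : 0 ≤ cellBound v k :=
  add_nonneg (norm_nonneg _) (mul_nonneg (T.cell k).diam_nonneg (gradNorm_nonneg _))

theorem norm_sub_le_diam (v : T.PW m) (k : Fin T.numCells) {x y : Vec d}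
    (hx : x ∈ (T.cell k).closedPts) (hy : y ∈ (T.cell k).closedPts) :
    ‖v k x - v k y‖ ≤ (T.cell k).diam * gradNorm (v k) := by
  rw [mul_comm]
  exact (norm_sub_le_gradNorm _ _ _).trans
    (mul_le_mul_of_nonneg_left ((T.cell k).dist_le_diam hx hy) (gradNorm_nonneg _))

theorem norm_le_cellBound (v : T.PW m) (k : Fin T.numCells) {x : Vec d}
    (hx : x ∈ (T.cell k).closedPts) : ‖v k x‖ ≤ cellBound v k := by
  have := norm_sub_le_diam v k hx (base_mem k)
  have h2 := norm_sub_norm_le (v k x) (v k (T.base k))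
  unfold cellBound
  linarith

/-- The `L²` norm of the broken gradient. -/
def gradL2 (v : T.PW m) : ℝ := √(∑ k, (T.cell k).vol * gradNorm (v k) ^ 2)

theorem gradL2_nonneg (v : T.PW m) : 0 ≤ gradL2 v := Real.sqrt_nonneg _

theorem gradL2_sq (v : T.PW m) : gradL2 v ^ 2 = ∑ k, (T.cell k).vol * gradNorm (v k) ^ 2 :=
  Real.sq_sqrt (Finset.sum_nonneg fun k _ => mul_nonneg (T.cell k).vol_pos.le (sq_nonneg _))

/-- The midpoint of a facet. -/
abbrev FacetIdx.mid (p : T.FacetIdx) : Vec d := (T.cell p.1).mid p.2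

theorem FacetIdx.mid_mem (p : T.FacetIdx) : p.mid ∈ (T.cell p.1).closedPts :=
  Cell.facet_subset_closedPts _ _ ((T.cell p.1).mid_mem_facet p.2)

theorem FacetIdx.mem_opp_closedPts (p : T.FacetIdx) {x : Vec d} (hx : x ∈ p.set) :
    x ∈ (T.cell p.opp.1).closedPts := by
  have : (T.cell p.opp.1).facet p.opp.2 = (T.cell p.1).facet p.2 := p.opp_set
  exact Cell.facet_subset_closedPts _ p.opp.2 (this ▸ hx)

theorem FacetIdx.mid_mem_opp (p : T.FacetIdx) : p.mid ∈ (T.cell p.opp.1).closedPts :=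
  p.mem_opp_closedPts ((T.cell p.1).mid_mem_facet p.2)

theorem IsCR.eq_mid {v : T.PW m} (hv : IsCR v) {p : T.FacetIdx} (hp : p.Interior) :
    v p.1 p.mid = v p.opp.1 p.mid :=
  hv p.1 p.2 p.opp.1 (isNeighbor_iff.2 ⟨hp, rfl⟩)

/-- The jump of a Crouzeix–Raviart function over an interior facet. -/
theorem IsCR.norm_jump_le {v : T.PW m} (hv : IsCR v) {p : T.FacetIdx} (hp : p.Interior) {x : Vec d}
    (hx : x ∈ p.set) : ‖v p.opp.1 x - v p.1 x‖ ≤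
      (T.cell p.1).diam * gradNorm (v p.1) + (T.cell p.opp.1).diam * gradNorm (v p.opp.1) := by
  have h1 := norm_sub_le_diam v p.1 (Cell.facet_subset_closedPts _ _ hx) p.mid_mem
  have h2 := norm_sub_le_diam v p.opp.1 (p.mem_opp_closedPts hx) p.mid_mem_opp
  rw [hv.eq_mid hp] at h1
  have h3 := norm_sub_le_norm_sub_add_norm_sub (v p.opp.1 x) (v p.opp.1 p.mid) (v p.1 x)
  rw [norm_sub_rev (v p.opp.1 p.mid)] at h3
  linarith

/-- Both base values are compared with the common value at the facet midpoint. The factor 2 accounts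
for this variation and for the gradient term inside `cellBound`. -/
theorem IsCR.abs_cellBound_sub_le {v : T.PW m} (hv : IsCR v) {p : T.FacetIdx} (hp : p.Interior) :
    |cellBound v p.1 - cellBound v p.opp.1| ≤
      2 * ((T.cell p.1).diam * gradNorm (v p.1) +
        (T.cell p.opp.1).diam * gradNorm (v p.opp.1)) := by
  have h1 := norm_sub_le_diam v p.1 (base_mem p.1) p.mid_mem
  have h2 := norm_sub_le_diam v p.opp.1 (base_mem p.opp.1) p.mid_mem_opp
  rw [hv.eq_mid hp] at h1
  have h3 := abs_le.1 ((abs_norm_sub_norm_le _ _).trans h1)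
  have h4 := abs_le.1 ((abs_norm_sub_norm_le _ _).trans h2)
  have h5 := mul_nonneg (T.cell p.1).diam_nonneg (gradNorm_nonneg (v p.1))
  have h6 := mul_nonneg (T.cell p.opp.1).diam_nonneg (gradNorm_nonneg (v p.opp.1))
  unfold cellBound
  rw [abs_le]
  constructor <;> linarith [h3.1, h3.2, h4.1, h4.2]

theorem IsCR0.cellBound_le {v : T.PW m} (hv : IsCR0 v) {p : T.FacetIdx} (hp : ¬ p.Interior) :
    cellBound v p.1 ≤ 2 * ((T.cell p.1).diam * gradNorm (v p.1)) := by
  have h1 := norm_sub_le_diam v p.1 (base_mem p.1) p.mid_mem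
  rw [show v p.1 p.mid = 0 from hv.2 p.1 p.2 (not_not.1 hp), sub_zero] at h1
  unfold cellBound
  linarith

/-- A power of the majorant jumps by a derivative factor times the jump of the majorant. On boundary
facets the outside value is zero, and vanishing at the midpoint plays the role of midpoint
continuity. -/
theorem IsCR0.jump_le {v : T.PW m} (hv : IsCR0 v) {s : ℝ} (hs : 1 ≤ s) (p : T.FacetIdx) :
    jump (fun k => cellBound v k ^ s) p ≤
      2 * s * ((cellBound v p.1 ^ (s - 1) + cellBound v p.opp.1 ^ (s - 1)) *
      ((T.cell p.1).diam * gradNorm (v p.1) +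
        (T.cell p.opp.1).diam * gradNorm (v p.opp.1))) := by
  have hA := cellBound_nonneg v p.1
  have hB := cellBound_nonneg v p.opp.1
  have h5 := mul_nonneg (T.cell p.1).diam_nonneg (gradNorm_nonneg (v p.1))
  have hA' := Real.rpow_nonneg hA (s - 1)
  have hB' := Real.rpow_nonneg hB (s - 1)
  unfold jump
  split_ifs with hp
  · refine (abs_rpow_sub_rpow_le hA hB hs).trans ?_
    calc _ ≤ s * (cellBound v p.1 ^ (s - 1) + cellBound v p.opp.1 ^ (s - 1)) *
          (2 * ((T.cell p.1).diam * gradNorm (v p.1) +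
            (T.cell p.opp.1).diam * gradNorm (v p.opp.1))) :=
          mul_le_mul_of_nonneg_left (hv.1.abs_cellBound_sub_le hp) (by positivity)
      _ = _ := by ring
  · rw [FacetIdx.opp_of_not_interior hp, abs_of_nonneg (Real.rpow_nonneg hA _)]
    have h1 := (rpow_sub_rpow_le hA le_rfl hs (b := 0))
    rw [Real.zero_rpow (by linarith), sub_zero, sub_zero] at h1
    refine h1.trans ?_
    have h2 := mul_le_mul_of_nonneg_left (hv.cellBound_le hp)
      (show 0 ≤ s * cellBound v p.1 ^ (s - 1) by positivity)
    refine h2.trans ?_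
    have h3 : 0 ≤ s * cellBound v p.1 ^ (s - 1) * ((T.cell p.1).diam * gradNorm (v p.1)) := by
      positivity
    linarith

/-- Discrete Sobolev inequality for Crouzeix–Raviart functions. -/
theorem exists_wNorm_cellBound_le (hd : 2 ≤ d) {κ W q : ℝ} (hκ : 0 < κ) (hW : 0 ≤ W)
    (hq1 : d / (d - 1) < q) (hq2 : 2 * (q * (d - 1) / d - 1) ≤ q) :
    ∃ C : ℝ, 0 < C ∧ ∀ (Ω : Set (Vec d)) (T : Mesh d Ω),
      (∀ k, κ * (T.cell k).diam ^ d ≤ (T.cell k).vol) → ∑ k, (T.cell k).vol ≤ W →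
      ∀ (m : ℕ) (v : T.PW m), IsCR0 v → wNorm T q (cellBound v) ≤ C * gradL2 v := by
  obtain ⟨C₁, hC₁, h₁⟩ := exists_wNorm_le_sum_jump hd
  have hd' : (2 : ℝ) ≤ d := by exact_mod_cast hd
  have hd1 : (0 : ℝ) < d - 1 := by linarith
  -- Chosen so that the `L^{d/(d-1)}` norm of the `s`-th power is the `s`-th power of the `L^q`
  -- norm.
  set s : ℝ := q * (d - 1) / d with hs
  have hs1 : 1 < s := by
    rw [hs, lt_div_iff₀ (by linarith), one_mul]
    rwa [div_lt_iff₀ hd1] at hq1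
  have hq : 0 < q := lt_of_le_of_lt (by positivity) hq1
  set C₂ : ℝ := C₁ * (2 ^ (d - 1) * (2 * s) * (8 * d / κ)) with hC₂
  have hC₂pos : 0 < C₂ := by positivity
  set θ : ℝ := 2 * (s - 1) / q with hθ
  refine ⟨C₂ * (W ^ (1 - θ)) ^ (1 / 2 : ℝ) + 1, by positivity, fun Ω T hT hTW m v hv => ?_⟩
  have hM := cellBound_nonneg v
  set Q : ℝ := ∑ k, (T.cell k).vol * cellBound v k ^ q with hQ
  have hQ0 : 0 ≤ Q := Finset.sum_nonneg fun k _ =>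
    mul_nonneg (T.cell k).vol_pos.le (Real.rpow_nonneg (hM k) _)
  have hG := gradL2_nonneg v
  have e1 : wNorm T (d / (d - 1)) (fun k => cellBound v k ^ s) = Q ^ (s / q) := by
    unfold wNorm
    have : s / q = 1 / ((d : ℝ) / (d - 1)) := by rw [hs]; field_simp
    rw [this]
    congr 1
    refine Finset.sum_congr rfl fun k _ => ?_
    rw [← Real.rpow_mul (hM k)]
    congr 2
    rw [hs]
    field_simp
  have e2 : Q ^ (s / q) ≤ C₂ * (√(∑ k, (T.cell k).vol * (cellBound v k ^ (s - 1)) ^ 2) *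
      gradL2 v) := by
    rw [← e1]
    refine (h₁ Ω T _ fun k => Real.rpow_nonneg (hM k) _).trans ?_
    rw [hC₂, mul_assoc]
    refine mul_le_mul_of_nonneg_left ?_ hC₁.le
    calc _ ≤ ∑ p : T.FacetIdx, 2 ^ (d - 1) * (2 * s) * (p.diam ^ (d - 1) *
          ((cellBound v p.1 ^ (s - 1) + cellBound v p.opp.1 ^ (s - 1)) *
            ((T.cell p.1).diam * gradNorm (v p.1) +
              (T.cell p.opp.1).diam * gradNorm (v p.opp.1)))) := by
          refine Finset.sum_le_sum fun p _ => ?_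
          refine (mul_le_mul_of_nonneg_right (hv.jump_le hs1.le p)
            (pow_nonneg (mul_nonneg zero_le_two p.diam_nonneg) _)).trans (le_of_eq ?_)
          rw [mul_pow]; ring
      _ ≤ _ := by
          rw [← Finset.mul_sum, mul_assoc (2 ^ (d - 1) * (2 * s)) (8 * (d : ℝ) / κ)]
          refine mul_le_mul_of_nonneg_left ?_ (by positivity)
          exact sum_facet_mul_le hd hκ hT (A := fun k => cellBound v k ^ (s - 1))
            (G := fun k => gradNorm (v k)) (fun k => Real.rpow_nonneg (hM k) _)
            fun k => gradNorm_nonneg _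
  -- Hölder on a set of volume at most `W` applies because `2 * (s - 1) ≤ q`; equality is the
  -- critical Sobolev exponent.
  have e3 : √(∑ k, (T.cell k).vol * (cellBound v k ^ (s - 1)) ^ 2) ≤
      (W ^ (1 - θ)) ^ (1 / 2 : ℝ) * Q ^ ((s - 1) / q) := by
    have h := sum_vol_rpow_le hTW (a := 2 * (s - 1)) (q := q) (by linarith) hq2 hM
    have e : ∀ k, (cellBound v k ^ (s - 1)) ^ 2 = cellBound v k ^ (2 * (s - 1)) := fun k => by
      rw [← Real.rpow_natCast, ← Real.rpow_mul (hM k)]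
      congr 1
      push_cast
      ring
    simp_rw [e]
    refine (Real.sqrt_le_sqrt h).trans (le_of_eq ?_)
    rw [Real.sqrt_eq_rpow, Real.mul_rpow (Real.rpow_nonneg hW _) (Real.rpow_nonneg hQ0 _),
      ← Real.rpow_mul hQ0]
    congr 2
    field_simp
  change Q ^ (1 / q) ≤ _
  -- The factor `Q ^ ((s - 1) / q)` occurs on both sides and is cancelled, which requires `Q ≠ 0`.
  rcases hQ0.eq_or_lt with h0 | hpos
  · rw [← h0, Real.zero_rpow (one_div_pos.2 hq).ne']
    positivity
  · have h4 : Q ^ (s / q) = Q ^ (1 / q) * Q ^ ((s - 1) / q) := by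
      rw [← Real.rpow_add hpos]
      congr 1
      field_simp
      ring
    have h5 : 0 < Q ^ ((s - 1) / q) := Real.rpow_pos_of_pos hpos _
    have h6 : Q ^ (1 / q) * Q ^ ((s - 1) / q) ≤
        C₂ * (W ^ (1 - θ)) ^ (1 / 2 : ℝ) * gradL2 v * Q ^ ((s - 1) / q) := by
      rw [← h4]
      refine e2.trans ?_
      have := mul_le_mul_of_nonneg_right e3 hG
      have := mul_le_mul_of_nonneg_left this hC₂pos.le
      refine this.trans (le_of_eq ?_)
      ring
    have h7 := le_of_mul_le_mul_right h6 h5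
    linarith

end Mesh

end NCFlow

end

/-! ### The upwind convective form -/

noncomputable section

namespace NCFlow

open Module Filter Topology

theorem Cell.integrableOn_pts {d : ℕ} (c : Cell d) {E : Type*} [NormedAddCommGroup E]
    {f : Vec d → E} (hf : Continuous f) : IntegrableOn f c.pts volume :=
  (hf.continuousOn.integrableOn_compact c.isCompact_closedPts).mono_set c.pts_subset_closedPts

theorem Cell.abs_setIntegral_pts_le {d : ℕ} (c : Cell d) {f : Vec d → ℝ} {C : ℝ}
    (h : ∀ x ∈ c.pts, |f x| ≤ C) : |∫ x in c.pts, f x| ≤ c.vol * C := by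
  rw [mul_comm]
  exact norm_setIntegral_le_of_norm_le_const (f := f) c.volume_pts_lt_top h

namespace Mesh

variable {d m : ℕ} {Ω : Set (Vec d)} {T : Mesh d Ω}

/-- The upwind flux through a facet, with integrand written out. -/
def fluxIntegrand (w : T.PW d) (u v : T.PW m) (p : T.FacetIdx) (x : Vec d) : ℝ :=
  (1 / 2) * (inner ℝ (w p.1 x) p.normal - |inner ℝ (w p.1 x) p.normal|) *
    inner ℝ (u p.opp.1 x - u p.1 x) (v p.1 x)

theorem continuous_fluxIntegrand (w : T.PW d) (u v : T.PW m) (p : T.FacetIdx) :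
    Continuous (fluxIntegrand w u v p) := by
  have := continuous_affine (w p.1)
  have := continuous_affine (u p.1)
  have := continuous_affine (u p.opp.1)
  have := continuous_affine (v p.1)
  unfold fluxIntegrand
  fun_prop

open Classical in
theorem convForm_eq (w : T.PW d) (u v : T.PW m) : convForm w u v =
    (∑ k, ∫ x in T.pts k, inner ℝ ((u k).linear (w k x)) (v k x)) +
    ∑ p : T.FacetIdx, if p.Interior then ∫ x in p.set, fluxIntegrand w u v p x ∂μHE[d - 1]
      else 0 := by
  unfold convForm
  congr 1
  rw [Fintype.sum_sigma]
  refine Finset.sum_congr rfl fun k _ => Finset.sum_congr rfl fun i _ => ?_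
  have hn : ∀ k', T.IsNeighbor k i k' ↔
      FacetIdx.Interior (⟨k, i⟩ : T.FacetIdx) ∧
        k' = (FacetIdx.opp (⟨k, i⟩ : T.FacetIdx)).1 :=
    fun k' => isNeighbor_iff (p := ⟨k, i⟩)
  by_cases hp : FacetIdx.Interior (⟨k, i⟩ : T.FacetIdx)
  · rw [if_pos hp, Finset.sum_eq_single (FacetIdx.opp (⟨k, i⟩ : T.FacetIdx)).1,
      if_pos ((hn _).2 ⟨hp, rfl⟩)]
    · rfl
    · exact fun k' _ hk' => if_neg fun h => hk' ((hn k').1 h).2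
    · simp
  · rw [if_neg hp]
    exact Finset.sum_eq_zero fun k' _ => if_neg fun h => hp ((hn k').1 h).1

theorem integrableOn_conv (w : T.PW d) (u v : T.PW m) (k : Fin T.numCells) :
    IntegrableOn (fun x => inner ℝ ((u k).linear (w k x)) (v k x)) (T.pts k) := by
  have := continuous_affine (w k)
  have := continuous_affine (v k)
  have h3 : Continuous (u k).linear := (u k).linear.continuous_of_finiteDimensional
  exact (T.cell k).integrableOn_pts ((h3.comp (by fun_prop)).inner (by fun_prop))

/-- The form is linear here, unlike in the first argument, which enters through `|w · n|` and admits
only a Lipschitz estimate. -/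
theorem convForm_sub_middle (w : T.PW d) (u u' v : T.PW m) :
    convForm w (u - u') v = convForm w u v - convForm w u' v := by
  classical
  rw [convForm_eq, convForm_eq, convForm_eq, add_sub_add_comm, ← Finset.sum_sub_distrib,
    ← Finset.sum_sub_distrib]
  congr 1
  · refine Finset.sum_congr rfl fun k _ => ?_
    rw [← integral_sub (integrableOn_conv w u v k) (integrableOn_conv w u' v k)]
    simp [inner_sub_left]
  · refine Finset.sum_congr rfl fun p _ => ?_
    split_ifs
    · rw [← integral_sub (Cell.integrableOn_facet _ _ (continuous_fluxIntegrand w u v p))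
        (Cell.integrableOn_facet _ _ (continuous_fluxIntegrand w u' v p))]
      congr 1
      ext x
      simp only [fluxIntegrand, Pi.sub_apply, AffineMap.coe_sub, inner_sub_left]
      ring
    · simp

/-- Lets the Lipschitz estimate in the first argument yield the continuity estimate. -/
theorem convForm_zero_left (u v : T.PW m) : convForm 0 u v = 0 := by
  classical
  rw [convForm_eq]
  simp [fluxIntegrand]

theorem abs_sub_abs_half_le (a b : ℝ) :
    |1 / 2 * (a - |a|) - 1 / 2 * (b - |b|)| ≤ |a - b| := by
  have h1 := abs_abs_sub_abs_le_abs_sub a b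
  rw [show 1 / 2 * (a - |a|) - 1 / 2 * (b - |b|) = 1 / 2 * ((a - b) - (|a| - |b|)) by ring, abs_mul,
    abs_of_pos (by norm_num : (0 : ℝ) < 1 / 2)]
  have := abs_sub (a - b) (|a| - |b|)
  linarith

/-- The map `t ↦ (t - |t|) / 2` is 1-Lipschitz, and the jump of `u` is a gradient times a diameter
by midpoint continuity. The result has the shape required by `sum_facet_mul_le`. -/
theorem abs_fluxIntegrand_sub_le (w w' : T.PW d) {u : T.PW m} (hu : IsCR u) (v : T.PW m)
    {p : T.FacetIdx} (hp : p.Interior) {x : Vec d} (hx : x ∈ p.set) :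
    |fluxIntegrand w u v p x - fluxIntegrand w' u v p x| ≤
      cellBound (w - w') p.1 * cellBound v p.1 * ((T.cell p.1).diam * gradNorm (u p.1) +
        (T.cell p.opp.1).diam * gradNorm (u p.opp.1)) := by
  have hx' := Cell.facet_subset_closedPts _ _ hx
  unfold fluxIntegrand
  rw [← sub_mul, abs_mul, mul_right_comm, mul_assoc (cellBound (w - w') p.1)]
  have h1 : |inner ℝ (w p.1 x) p.normal - inner ℝ (w' p.1 x) p.normal| ≤
      cellBound (w - w') p.1 := by
    rw [← inner_sub_left]
    refine (abs_real_inner_le_norm _ _).trans ?_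
    rw [FacetIdx.normal, (T.cell p.1).norm_normal, mul_one]
    exact norm_le_cellBound (w - w') p.1 hx'
  refine mul_le_mul ((abs_sub_abs_half_le _ _).trans h1) ?_ (abs_nonneg _) (cellBound_nonneg _ _)
  refine (abs_real_inner_le_norm _ _).trans ?_
  exact mul_le_mul (hu.norm_jump_le hp hx) (norm_le_cellBound v p.1 hx') (norm_nonneg _)
    (add_nonneg (mul_nonneg (T.cell p.1).diam_nonneg (gradNorm_nonneg _))
      (mul_nonneg (T.cell p.opp.1).diam_nonneg (gradNorm_nonneg _)))

theorem sum_vol_mul_le (A B : Fin T.numCells → ℝ) : ∑ k, (T.cell k).vol * (A k * B k) ≤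
    √(∑ k, (T.cell k).vol * A k ^ 2) * √(∑ k, (T.cell k).vol * B k ^ 2) := by
  have h := Real.sum_mul_le_sqrt_mul_sqrt Finset.univ (fun k => √(T.cell k).vol * A k)
    (fun k => √(T.cell k).vol * B k)
  have e : ∀ C : Fin T.numCells → ℝ, ∀ k, (√(T.cell k).vol * C k) ^ 2 =
      (T.cell k).vol * C k ^ 2 := fun C k => by
    rw [mul_pow, Real.sq_sqrt (T.cell k).vol_pos.le]
  simp only [e] at h
  refine (le_of_eq ?_).trans h
  refine Finset.sum_congr rfl fun k _ => ?_
  rw [mul_mul_mul_comm, Real.mul_self_sqrt (T.cell k).vol_pos.le]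

theorem sqrt_sum_vol_mul_sq_le (A B : Fin T.numCells → ℝ) :
    √(∑ k, (T.cell k).vol * (A k * B k) ^ 2) ≤ wNorm T 4 A * wNorm T 4 B := by
  have e : ∀ C : Fin T.numCells → ℝ, wNorm T 4 C = √√(∑ k, (T.cell k).vol * (C k ^ 2) ^ 2) := by
    intro C
    unfold wNorm
    rw [Real.sqrt_eq_rpow, Real.sqrt_eq_rpow, ← Real.rpow_mul (Finset.sum_nonneg fun k _ =>
      mul_nonneg (T.cell k).vol_pos.le (sq_nonneg _))]
    norm_num
    congr 1
    refine Finset.sum_congr rfl fun k _ => ?_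
    rw [← pow_mul, ← Real.rpow_natCast]
  rw [e, e, ← Real.sqrt_mul (Real.sqrt_nonneg _)]
  refine Real.sqrt_le_sqrt ?_
  simp_rw [mul_pow]
  exact sum_vol_mul_le _ _

/-- The convective form is Lipschitz in its first argument. -/
theorem abs_convForm_sub_le (hd : 2 ≤ d) {κ : ℝ} (hκ : 0 < κ)
    (hT : ∀ k, κ * (T.cell k).diam ^ d ≤ (T.cell k).vol) (w w' : T.PW d) {u : T.PW m}
    (hu : IsCR u) (v : T.PW m) :
    |convForm w u v - convForm w' u v| ≤ (1 + (ballVol (d - 1)).toReal * (8 * d / κ)) *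
      (wNorm T 4 (cellBound (w - w')) * wNorm T 4 (cellBound v) * gradL2 u) := by
  classical
  have hMw := cellBound_nonneg (w - w')
  have hMv := cellBound_nonneg v
  set A : Fin T.numCells → ℝ := fun k => cellBound (w - w') k * cellBound v k with hA
  have hA0 : ∀ k, 0 ≤ A k := fun k => mul_nonneg (hMw k) (hMv k)
  have hfin : √(∑ k, (T.cell k).vol * A k ^ 2) * gradL2 u ≤
      wNorm T 4 (cellBound (w - w')) * wNorm T 4 (cellBound v) * gradL2 u :=
    mul_le_mul_of_nonneg_right (sqrt_sum_vol_mul_sq_le _ _) (gradL2_nonneg u)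
  refine le_trans ?_ (mul_le_mul_of_nonneg_left hfin (by positivity))
  rw [convForm_eq, convForm_eq, add_sub_add_comm, ← Finset.sum_sub_distrib,
    ← Finset.sum_sub_distrib, add_mul, one_mul]
  refine (abs_add_le _ _).trans (add_le_add ?_ ?_)
  · refine (Finset.abs_sum_le_sum_abs _ _).trans (le_trans (Finset.sum_le_sum fun k _ => ?_)
      (sum_vol_mul_le A fun k => gradNorm (u k)))
    rw [← integral_sub (integrableOn_conv w u v k) (integrableOn_conv w' u v k)]
    refine (T.cell k).abs_setIntegral_pts_le fun x hx => ?_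
    have hx' := (T.cell k).pts_subset_closedPts hx
    rw [← inner_sub_left, ← map_sub]
    refine (abs_real_inner_le_norm _ _).trans ?_
    have h1 : ‖w k x - w' k x‖ ≤ cellBound (w - w') k := norm_le_cellBound (w - w') k hx'
    calc _ ≤ (gradNorm (u k) * cellBound (w - w') k) * cellBound v k :=
          mul_le_mul ((norm_linear_le _ _).trans
            (mul_le_mul_of_nonneg_left h1 (gradNorm_nonneg _))) (norm_le_cellBound v k hx')
            (norm_nonneg _) (mul_nonneg (gradNorm_nonneg _) (hMw k))
      _ = _ := by rw [hA]; ring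
  · refine (Finset.abs_sum_le_sum_abs _ _).trans ?_
    rw [mul_assoc]
    refine le_trans ?_ (mul_le_mul_of_nonneg_left (sum_facet_mul_le hd hκ hT hA0
      (G := fun k => gradNorm (u k)) fun k => gradNorm_nonneg _) ENNReal.toReal_nonneg)
    rw [Finset.mul_sum]
    refine Finset.sum_le_sum fun p _ => ?_
    have hJ : 0 ≤ (T.cell p.1).diam * gradNorm (u p.1) +
        (T.cell p.opp.1).diam * gradNorm (u p.opp.1) :=
      add_nonneg (mul_nonneg (T.cell p.1).diam_nonneg (gradNorm_nonneg _))
        (mul_nonneg (T.cell p.opp.1).diam_nonneg (gradNorm_nonneg _))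
    have hdm := pow_nonneg p.diam_nonneg (d - 1)
    have hb : 0 ≤ (ballVol (d - 1)).toReal := ENNReal.toReal_nonneg
    split_ifs with hp
    · rw [← integral_sub (Cell.integrableOn_facet _ _ (continuous_fluxIntegrand w u v p))
        (Cell.integrableOn_facet _ _ (continuous_fluxIntegrand w' u v p))]
      have hfm := (T.cell p.1).facet_measure_lt_top p.2
      have h1 := norm_setIntegral_le_of_norm_le_const hfm
        (f := fun x => fluxIntegrand w u v p x - fluxIntegrand w' u v p x)
        fun x hx => abs_fluxIntegrand_sub_le w w' hu v hp hx
      have h2 : (μHE[d - 1] : Measure (Vec d)).real p.set ≤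
          p.diam ^ (d - 1) * (ballVol (d - 1)).toReal := by
        have h3 := (T.cell p.1).facet_measure_le p.2 fun x hx y hy => p.dist_le_diam hx hy
        have h4 := ENNReal.toReal_mono
          (ENNReal.mul_lt_top ENNReal.ofReal_lt_top (ballVol_lt_top _)).ne h3
        rwa [ENNReal.toReal_mul, ENNReal.toReal_ofReal hdm] at h4
      refine h1.trans ((mul_le_mul_of_nonneg_left h2
        (mul_nonneg (hA0 p.1) hJ)).trans ?_)
      -- The facet sum to compare with also contains the value of `A` on the other side; this
      -- nonnegative term is added.
      have h5 : 0 ≤ (ballVol (d - 1)).toReal * (p.diam ^ (d - 1) * (A p.opp.1 *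
          ((T.cell p.1).diam * gradNorm (u p.1) +
            (T.cell p.opp.1).diam * gradNorm (u p.opp.1)))) :=
        mul_nonneg hb (mul_nonneg hdm (mul_nonneg (hA0 _) hJ))
      linear_combination h5
    · rw [sub_zero, abs_zero]
      exact mul_nonneg hb (mul_nonneg hdm (mul_nonneg (add_nonneg (hA0 _) (hA0 _)) hJ))

end Mesh

end NCFlow

end

/-! ### Norms, integrability and coercivity -/

noncomputable section

namespace NCFlow

open Module Filter Topology

namespace FlowData

variable {d : ℕ} {Ω : Set (Vec d)} (P : FlowData d Ω)

/-- Positive definiteness gives `κ‖v‖ ≤ ‖K v‖`, so `K` is injective, hence invertible, with inverse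
of norm at most `κ⁻¹`. -/
theorem exists_norm_inv_le : ∃ C : ℝ, 0 < C ∧ ∀ x ∈ Ω, ‖matOp (P.K x)⁻¹‖ ≤ C := by
  obtain ⟨κ, hκ, h⟩ := P.K_posDef
  refine ⟨κ⁻¹, inv_pos.2 hκ, fun x hx => ?_⟩
  have hlow : ∀ v : Vec d, κ * ‖v‖ ≤ ‖matOp (P.K x) v‖ := by
    intro v
    rcases eq_or_ne v 0 with rfl | hv
    · simp
    · have h1 := (h x hx v).trans (real_inner_le_norm v _)
      have h2 : 0 < ‖v‖ := norm_pos_iff.2 hv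
      nlinarith
  have hinj : Function.Injective (P.K x).mulVec := by
    intro a b hab
    have h1 : matOp (P.K x) (WithLp.toLp 2 (a - b)) = 0 := by
      ext i
      rw [Matrix.ofLp_toEuclideanCLM]
      simp [Matrix.mulVec_sub, hab]
    have h2 := hlow (WithLp.toLp 2 (a - b))
    rw [h1, norm_zero] at h2
    have h3 : ‖(WithLp.toLp 2 (a - b) : Vec d)‖ = 0 :=
      le_antisymm (by nlinarith [norm_nonneg (WithLp.toLp 2 (a - b) : Vec d)]) (norm_nonneg _)
    have h4 := norm_eq_zero.1 h3
    have h5 : a - b = 0 := by simpa using congrArg WithLp.ofLp h4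
    exact sub_eq_zero.1 h5
  have hu : IsUnit (P.K x) := Matrix.mulVec_injective_iff_isUnit.1 hinj
  have hmul : matOp (P.K x) * matOp (P.K x)⁻¹ = 1 := by
    rw [← map_mul, Matrix.mul_nonsing_inv _ ((Matrix.isUnit_iff_isUnit_det _).1 hu), map_one]
  refine ContinuousLinearMap.opNorm_le_bound _ (inv_nonneg.2 hκ.le) fun v => ?_
  have h1 := hlow (matOp (P.K x)⁻¹ v)
  have h2 : matOp (P.K x) (matOp (P.K x)⁻¹ v) = v := by
    change (matOp (P.K x) * matOp (P.K x)⁻¹) v = v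
    rw [hmul]; rfl
  rw [h2] at h1
  rw [inv_mul_eq_div, le_div_iff₀ hκ]
  linarith

theorem sigma_nonneg : 0 ≤ P.sigma := ENNReal.toReal_nonneg

/-- The essential supremum must first be shown finite, since `toReal` sends `∞` to `0` and `sigma`
would then bound nothing. -/
theorem ae_norm_inv_le (hΩ : IsOpen Ω) :
    ∀ᵐ x ∂(volume.restrict Ω), ‖matOp (P.K x)⁻¹‖ ≤ P.sigma := by
  obtain ⟨C, _, hb⟩ := P.exists_norm_inv_le
  have hfin : eLpNorm (fun x => matOp (P.K x)⁻¹) ∞ (volume.restrict Ω) < ∞ := by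
    rw [eLpNorm_exponent_top]
    refine (eLpNormEssSup_le_of_ae_bound (C := C) ?_).trans_lt ENNReal.ofReal_lt_top
    exact (ae_restrict_iff' hΩ.measurableSet).2 (Eventually.of_forall hb)
  have h := enorm_ae_le_eLpNormEssSup (fun x => matOp (P.K x)⁻¹) (volume.restrict Ω)
  rw [← eLpNorm_exponent_top] at h
  filter_upwards [h] with x hx
  have h2 := ENNReal.toReal_mono hfin.ne hx
  rwa [toReal_enorm] at h2

/-- By Cramer's rule the entry is the inverse determinant times a polynomial in the entries of `K`.
-/
theorem aemeasurable_inv_entry (i j : Fin d) :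
    AEMeasurable (fun x => (P.K x)⁻¹ i j) (volume.restrict Ω) := by
  have hK : AEMeasurable (fun x => (fun i j => P.K x i j : Fin d → Fin d → ℝ))
      (volume.restrict Ω) :=
    aemeasurable_pi_lambda _ fun i => aemeasurable_pi_lambda _ fun j => P.K_meas i j
  have hof : Continuous fun A : Fin d → Fin d → ℝ => (Matrix.of A : Matrix (Fin d) (Fin d) ℝ) :=
    continuous_id
  have h1 : Measurable fun A : Fin d → Fin d → ℝ => (Matrix.of A).det :=
    hof.matrix_det.measurable
  have h2 : Measurable fun A : Fin d → Fin d → ℝ => (Matrix.of A).adjugate i j :=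
    (hof.matrix_adjugate.matrix_elem i j).measurable
  have h3 : ∀ x, (P.K x)⁻¹ i j = ((P.K x).det)⁻¹ * (P.K x).adjugate i j := fun x => by
    rw [Matrix.inv_def, Ring.inverse_eq_inv']
    simp
  simp_rw [h3]
  exact ((h1.inv.mul h2).comp_aemeasurable hK)

theorem aestronglyMeasurable_inner_inv {f g : Vec d → Vec d} (hf : Continuous f)
    (hg : Continuous g) :
    AEStronglyMeasurable (fun x => inner ℝ (matOp (P.K x)⁻¹ (f x)) (g x)) (volume.restrict Ω) := by
  have h : ∀ x, inner ℝ (matOp (P.K x)⁻¹ (f x)) (g x) =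
      ∑ i, (∑ j, (P.K x)⁻¹ i j * f x j) * g x i := fun x => by
    rw [PiLp.inner_apply]
    refine Finset.sum_congr rfl fun i _ => ?_
    rw [Matrix.ofLp_toEuclideanCLM]
    simp [Matrix.mulVec, dotProduct, mul_comm]
  simp_rw [h]
  refine AEMeasurable.aestronglyMeasurable ?_
  refine Finset.aemeasurable_fun_sum _ fun i _ => AEMeasurable.mul ?_ ?_
  · refine Finset.aemeasurable_fun_sum _ fun j _ => (P.aemeasurable_inv_entry i j).mul ?_
    exact (show Continuous fun x => f x j by fun_prop).measurable.aemeasurable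
  · exact (show Continuous fun x => g x i by fun_prop).measurable.aemeasurable

theorem continuous_ν : Continuous P.ν :=
  (LipschitzWith.of_dist_le_mul (K := ⟨P.γν, P.γν_pos.le⟩) fun s t => by
    rw [Real.dist_eq, Real.dist_eq]; exact P.ν_lipschitz s t).continuous

theorem continuous_F : Continuous P.F :=
  (LipschitzWith.of_dist_le_mul (K := ⟨P.γF, P.γF_pos.le⟩) fun s t => by
    rw [dist_eq_norm, dist_eq_norm]; exact P.F_lipschitz s t).continuous

/-- Test with a unit vector. Positivity of `sigmaBar` is what lets `normY` control the broken
gradient. -/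
theorem alpha₂_le_sigmaBar : P.α₂ ≤ P.sigmaBar := by
  have h := P.D_posDef (EuclideanSpace.single 0 1)
  have h2 := h.trans (real_inner_le_norm _ _)
  have h3 := (matOp P.D).le_opNorm (EuclideanSpace.single 0 1)
  have h4 : ‖(EuclideanSpace.single 0 1 : Vec 2)‖ = 1 := by simp
  rw [h4] at h2 h3
  simp only [one_pow, mul_one, one_mul] at h2 h3
  exact h2.trans h3

theorem sigmaBar_pos : 0 < P.sigmaBar := P.α₂_pos.trans_le P.alpha₂_le_sigmaBar

end FlowData

namespace Mesh

variable {d m : ℕ} {Ω : Set (Vec d)} {T : Mesh d Ω} (P : FlowData d Ω)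

theorem setIntegral_pts_const (k : Fin T.numCells) (c : ℝ) :
    ∫ _x in T.pts k, c = (T.cell k).vol * c := by
  rw [setIntegral_const]; rfl

/-- The square of the `L²` norm. -/
def l2Sq (v : T.PW m) : ℝ := ∑ k, ∫ x in T.pts k, ‖v k x‖ ^ 2

theorem l2Sq_nonneg (v : T.PW m) : 0 ≤ l2Sq v :=
  Finset.sum_nonneg fun _ _ => integral_nonneg fun _ => sq_nonneg _

theorem normU_sq (v : T.PW d) : normU P v ^ 2 = P.sigma * l2Sq v + P.ν₂ * gradL2 v ^ 2 := by
  have e : ∑ k, (P.sigma * (∫ x in T.pts k, ‖v k x‖ ^ 2) +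
      P.ν₂ * ∫ _x in T.pts k, gradNorm (v k) ^ 2) = P.sigma * l2Sq v + P.ν₂ * gradL2 v ^ 2 := by
    rw [Finset.sum_add_distrib, ← Finset.mul_sum, ← Finset.mul_sum, gradL2_sq]
    simp_rw [setIntegral_pts_const]
    rfl
  rw [normU, e, Real.sq_sqrt]
  exact add_nonneg (mul_nonneg P.sigma_nonneg (l2Sq_nonneg v))
    (mul_nonneg P.ν₂_pos.le (sq_nonneg _))

theorem normU_nonneg (v : T.PW d) : 0 ≤ normU P v := Real.sqrt_nonneg _

theorem normY_nonneg (s : T.PW 2) : 0 ≤ normY P s := Real.sqrt_nonneg _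

theorem normY_sq (s : T.PW 2) : normY P s ^ 2 = P.sigmaBar * gradL2 s ^ 2 := by
  have e : ∑ k, P.sigmaBar * ∫ _x in T.pts k, gradNorm (s k) ^ 2 =
      P.sigmaBar * gradL2 s ^ 2 := by
    rw [← Finset.mul_sum, gradL2_sq]
    simp_rw [setIntegral_pts_const]
  rw [normY, e, Real.sq_sqrt (mul_nonneg P.sigmaBar_pos.le (sq_nonneg _))]

theorem gradL2_le_normU (v : T.PW d) : gradL2 v ≤ (√P.ν₂)⁻¹ * normU P v := by
  have h : P.ν₂ * gradL2 v ^ 2 ≤ normU P v ^ 2 := by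
    rw [normU_sq]
    exact le_add_of_nonneg_left (mul_nonneg P.sigma_nonneg (l2Sq_nonneg v))
  have h2 := Real.sqrt_le_sqrt h
  rw [Real.sqrt_mul P.ν₂_pos.le, Real.sqrt_sq (gradL2_nonneg v), Real.sqrt_sq (normU_nonneg P v)]
    at h2
  rw [inv_mul_eq_div, le_div_iff₀ (Real.sqrt_pos.2 P.ν₂_pos)]
  linarith

theorem gradL2_le_normY (s : T.PW 2) : gradL2 s ≤ (√P.sigmaBar)⁻¹ * normY P s := by
  have h2 := Real.sqrt_le_sqrt (normY_sq P s).ge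
  rw [Real.sqrt_mul P.sigmaBar_pos.le, Real.sqrt_sq (gradL2_nonneg s),
    Real.sqrt_sq (normY_nonneg P s)] at h2
  rw [inv_mul_eq_div, le_div_iff₀ (Real.sqrt_pos.2 P.sigmaBar_pos)]
  linarith

theorem integrableOn_inner_inv (u v : T.PW d) (k : Fin T.numCells) :
    IntegrableOn (fun x => inner ℝ (matOp (P.K x)⁻¹ (u k x)) (v k x)) (T.pts k) := by
  obtain ⟨C, hC, hb⟩ := P.exists_norm_inv_le
  have hfin : IsFiniteMeasure (volume.restrict (T.pts k)) :=
    ⟨by simpa using (T.cell k).volume_pts_lt_top⟩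
  refine Integrable.mono' (integrable_const (C * cellBound u k * cellBound v k))
    ((P.aestronglyMeasurable_inner_inv (continuous_affine (u k))
      (continuous_affine (v k))).mono_measure (Measure.restrict_mono (T.cell_subset k) le_rfl)) ?_
  refine (ae_restrict_iff' (T.cell k).isOpen_pts.measurableSet).2 (Eventually.of_forall
    fun x hx => ?_)
  have hx' := (T.cell k).pts_subset_closedPts hx
  refine (norm_inner_le_norm _ _).trans (mul_le_mul ?_ (norm_le_cellBound v k hx')
    (norm_nonneg _) (mul_nonneg hC.le (cellBound_nonneg _ _)))
  exact ((matOp (P.K x)⁻¹).le_opNorm _).trans (mul_le_mul (hb x (T.cell_subset k hx))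
    (norm_le_cellBound u k hx') (norm_nonneg _) hC.le)

theorem continuous_viscosity (s : T.PW 2) (k : Fin T.numCells) :
    Continuous fun x => P.ν (s k x 0) := by
  have h1 := continuous_affine (s k)
  have h2 : Continuous fun x => s k x 0 := by fun_prop
  exact P.continuous_ν.comp h2

theorem integrableOn_viscosity (s : T.PW 2) (c : ℝ) (k : Fin T.numCells) :
    IntegrableOn (fun x => P.ν (s k x 0) * c) (T.pts k) :=
  (T.cell k).integrableOn_pts ((continuous_viscosity P s k).mul continuous_const)

theorem integrableOn_norm_sq (v : T.PW m) (k : Fin T.numCells) :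
    IntegrableOn (fun x => ‖v k x‖ ^ 2) (T.pts k) := by
  have := continuous_affine (v k)
  exact (T.cell k).integrableOn_pts (by fun_prop)

theorem aForm_self_ge (s : T.PW 2) (v : T.PW d) :
    P.α₁ * l2Sq v + P.ν₁ * gradL2 v ^ 2 ≤ aForm P s v v := by
  have e : P.α₁ * l2Sq v + P.ν₁ * gradL2 v ^ 2 =
      ∑ k, ∫ x in T.pts k, (P.α₁ * ‖v k x‖ ^ 2 + P.ν₁ * gradNorm (v k) ^ 2) := by
    rw [l2Sq, gradL2_sq, Finset.mul_sum, Finset.mul_sum, ← Finset.sum_add_distrib]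
    refine Finset.sum_congr rfl fun k _ => ?_
    rw [integral_add ((integrableOn_norm_sq v k).const_mul _)
      (integrableOn_const (T.cell k).volume_pts_lt_top.ne), integral_const_mul,
      setIntegral_pts_const]
    ring
  rw [e]
  refine Finset.sum_le_sum fun k _ => setIntegral_mono_on
    (((integrableOn_norm_sq v k).const_mul _).add
      (integrableOn_const (T.cell k).volume_pts_lt_top.ne))
    ((integrableOn_inner_inv P v v k).add (integrableOn_viscosity P s _ k))
    (T.cell k).isOpen_pts.measurableSet fun x hx => ?_
  refine add_le_add ?_ ?_
  · rw [real_inner_comm]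
    exact P.K_inv x (T.cell_subset k hx) _
  · rw [gradNorm_sq]
    exact mul_le_mul_of_nonneg_right (P.ν_bounds _).1 (gradInner_self_nonneg _)

/-- The weights `sigma` and `ν₂` in the norm are upper bounds for the coefficients of the form. This
is why coercivity constants cannot exceed one. -/
theorem aForm_self_le (hΩ : IsOpen Ω) (s : T.PW 2) (v : T.PW d) :
    aForm P s v v ≤ normU P v ^ 2 := by
  have e : normU P v ^ 2 =
      ∑ k, ∫ x in T.pts k, (P.sigma * ‖v k x‖ ^ 2 + P.ν₂ * gradNorm (v k) ^ 2) := by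
    rw [normU_sq, l2Sq, gradL2_sq, Finset.mul_sum, Finset.mul_sum, ← Finset.sum_add_distrib]
    refine Finset.sum_congr rfl fun k _ => ?_
    rw [integral_add ((integrableOn_norm_sq v k).const_mul _)
      (integrableOn_const (T.cell k).volume_pts_lt_top.ne), integral_const_mul,
      setIntegral_pts_const]
    ring
  rw [e]
  refine Finset.sum_le_sum fun k _ => setIntegral_mono_ae_restrict
    ((integrableOn_inner_inv P v v k).add (integrableOn_viscosity P s _ k))
    (((integrableOn_norm_sq v k).const_mul _).add
      (integrableOn_const (T.cell k).volume_pts_lt_top.ne)) ?_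
  filter_upwards [ae_restrict_of_ae_restrict_of_subset (T.cell_subset k) (P.ae_norm_inv_le hΩ)]
    with x hx
  refine add_le_add ?_ ?_
  · refine (real_inner_le_norm _ _).trans ?_
    rw [sq, ← mul_assoc]
    refine mul_le_mul_of_nonneg_right (((matOp (P.K x)⁻¹).le_opNorm _).trans ?_) (norm_nonneg _)
    exact mul_le_mul_of_nonneg_right hx (norm_nonneg _)
  · rw [gradNorm_sq]
    exact mul_le_mul_of_nonneg_right (P.ν_bounds _).2 (gradInner_self_nonneg _)

theorem aYForm_eq (y s : T.PW 2) : aYForm P y s =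
    ∑ k, (T.cell k).vol * ∑ j, inner ℝ (matOp P.D (pderiv (y k) j)) (pderiv (s k) j) := by
  simp_rw [aYForm, setIntegral_pts_const]

theorem aYForm_self_ge (s : T.PW 2) : P.α₂ * gradL2 s ^ 2 ≤ aYForm P s s := by
  rw [aYForm_eq, gradL2_sq, Finset.mul_sum]
  refine Finset.sum_le_sum fun k _ => ?_
  rw [mul_left_comm, gradNorm_sq, gradInner_self, Finset.mul_sum]
  refine mul_le_mul_of_nonneg_left (Finset.sum_le_sum fun j _ => ?_) (T.cell k).vol_pos.le
  rw [real_inner_comm]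
  exact P.D_posDef _

theorem aYForm_self_le (s : T.PW 2) : aYForm P s s ≤ normY P s ^ 2 := by
  rw [normY_sq, aYForm_eq, gradL2_sq, Finset.mul_sum]
  refine Finset.sum_le_sum fun k _ => ?_
  rw [mul_left_comm, gradNorm_sq, gradInner_self]
  refine mul_le_mul_of_nonneg_left ?_ (T.cell k).vol_pos.le
  rw [Finset.mul_sum]
  refine Finset.sum_le_sum fun j _ => ?_
  refine (real_inner_le_norm _ _).trans ?_
  rw [sq, ← mul_assoc]
  exact mul_le_mul_of_nonneg_right ((matOp P.D).le_opNorm _) (norm_nonneg _)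

theorem aYForm_sub (y y' s : T.PW 2) :
    aYForm P (y - y') s = aYForm P y s - aYForm P y' s := by
  rw [aYForm_eq, aYForm_eq, aYForm_eq, ← Finset.sum_sub_distrib]
  refine Finset.sum_congr rfl fun k _ => ?_
  rw [← mul_sub, ← Finset.sum_sub_distrib]
  congr 1
  refine Finset.sum_congr rfl fun j _ => ?_
  rw [Pi.sub_apply, pderiv_sub, map_sub, inner_sub_left]

/-- Coercivity constants that do not depend on the mesh. -/
theorem exists_coercive : ∃ αa αy : ℝ, 0 < αa ∧ 0 < αy ∧
    ∀ T : Mesh d Ω, Coercive T P αa αy := by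
  have hσ := P.sigma_nonneg
  have hα := P.α₁_pos
  have hν := P.ν₁_pos
  have hν₂ := P.ν₂_pos
  -- Only `0 ≤ sigma` is at hand, hence the denominator `sigma + 1`.
  refine ⟨min (P.α₁ / (P.sigma + 1)) (P.ν₁ / P.ν₂), P.α₂ / P.sigmaBar, by positivity,
    div_pos P.α₂_pos P.sigmaBar_pos, fun T => ⟨fun s v _ _ => ?_, fun s _ => ?_⟩⟩
  · refine le_trans ?_ (aForm_self_ge P s v)
    rw [normU_sq]
    set α := min (P.α₁ / (P.sigma + 1)) (P.ν₁ / P.ν₂) with hαd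
    have h1 : α * (P.sigma + 1) ≤ P.α₁ := by
      rw [← le_div_iff₀ (by positivity)]; exact min_le_left _ _
    have h2 : α * P.ν₂ ≤ P.ν₁ := by
      rw [← le_div_iff₀ hν₂]; exact min_le_right _ _
    have h0 : 0 < α := by positivity
    have h3 := mul_le_mul_of_nonneg_right h1 (l2Sq_nonneg v)
    have h4 := mul_le_mul_of_nonneg_right h2 (sq_nonneg (gradL2 v))
    have h5 := mul_nonneg h0.le (l2Sq_nonneg v)
    linarith
  · refine le_trans (le_of_eq ?_) (aYForm_self_ge P s)
    rw [normY_sq, ← mul_assoc, div_mul_cancel₀ _ P.sigmaBar_pos.ne']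

end Mesh

end NCFlow

end

/-! ### Hölder estimates for viscosity, buoyancy and load -/

noncomputable section

namespace NCFlow

open Module Filter Topology

namespace Mesh

variable {d m : ℕ} {Ω : Set (Vec d)} {T : Mesh d Ω}

theorem sum_vol_mul_le_wNorm {p q : ℝ} (hpq : p.HolderConjugate q) {A B : Fin T.numCells → ℝ}
    (hA : ∀ k, 0 ≤ A k) (hB : ∀ k, 0 ≤ B k) :
    ∑ k, (T.cell k).vol * (A k * B k) ≤ wNorm T p A * wNorm T q B := by
  have hv : ∀ k, 0 ≤ (T.cell k).vol := fun k => (T.cell k).vol_pos.le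
  have h := Real.inner_le_Lp_mul_Lq_of_nonneg Finset.univ hpq
    (f := fun k => (T.cell k).vol ^ (1 / p) * A k) (g := fun k => (T.cell k).vol ^ (1 / q) * B k)
    (fun k _ => mul_nonneg (Real.rpow_nonneg (hv k) _) (hA k))
    (fun k _ => mul_nonneg (Real.rpow_nonneg (hv k) _) (hB k))
  have e1 : ∀ k, ((T.cell k).vol ^ (1 / p) * A k) ^ p = (T.cell k).vol * A k ^ p := fun k => by
    rw [Real.mul_rpow (Real.rpow_nonneg (hv k) _) (hA k), ← Real.rpow_mul (hv k),
      one_div_mul_cancel hpq.ne_zero, Real.rpow_one]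
  have e2 : ∀ k, ((T.cell k).vol ^ (1 / q) * B k) ^ q = (T.cell k).vol * B k ^ q := fun k => by
    rw [Real.mul_rpow (Real.rpow_nonneg (hv k) _) (hB k), ← Real.rpow_mul (hv k),
      one_div_mul_cancel hpq.symm.ne_zero, Real.rpow_one]
  simp only [e1, e2] at h
  refine (le_of_eq ?_).trans h
  refine Finset.sum_congr rfl fun k _ => ?_
  have e3 : (T.cell k).vol ^ (1 / p) * (T.cell k).vol ^ (1 / q) = (T.cell k).vol := by
    rw [← Real.rpow_add (T.cell k).vol_pos, one_div, one_div, hpq.inv_add_inv_eq_one, Real.rpow_one]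
  rw [mul_mul_mul_comm, e3]

theorem gradLqNorm_eq (q : ℝ) (u : T.PW m) : gradLqNorm q u = wNorm T q fun k => gradNorm (u k) := by
  simp_rw [gradLqNorm, setIntegral_pts_const]
  rfl

theorem lqNorm_le_wNorm {q : ℝ} (hq : 0 ≤ q) (v : T.PW m) : lqNorm q v ≤ wNorm T q (cellBound v) := by
  refine Real.rpow_le_rpow (Finset.sum_nonneg fun k _ => integral_nonneg fun x =>
    Real.rpow_nonneg (norm_nonneg _) _) (Finset.sum_le_sum fun k _ => ?_) (by positivity)
  refine (le_abs_self _).trans ((T.cell k).abs_setIntegral_pts_le fun x hx => ?_)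
  rw [abs_of_nonneg (Real.rpow_nonneg (norm_nonneg _) _)]
  exact Real.rpow_le_rpow (norm_nonneg _)
    (norm_le_cellBound v k ((T.cell k).pts_subset_closedPts hx)) hq

theorem sqrt_sum_vol_mul_sq_le_six_three {A B : Fin T.numCells → ℝ} (hA : ∀ k, 0 ≤ A k)
    (hB : ∀ k, 0 ≤ B k) :
    √(∑ k, (T.cell k).vol * (A k * B k) ^ 2) ≤ wNorm T 6 A * wNorm T 3 B := by
  apply Real.sqrt_le_iff.2 ⟨mul_nonneg (wNorm_nonneg hA) (wNorm_nonneg hB), ?_⟩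
  have h := sum_vol_mul_le_wNorm (T := T) (p := 3) (q := 3 / 2) (by
    rw [Real.holderConjugate_iff]; norm_num) (A := fun k => A k ^ 2) (B := fun k => B k ^ 2)
    (fun k => sq_nonneg _) (fun k => sq_nonneg _)
  have e : ∀ {C : Fin T.numCells → ℝ}, (∀ k, 0 ≤ C k) → ∀ {p : ℝ}, 0 < p →
      wNorm T p (fun k => C k ^ 2) = wNorm T (2 * p) C ^ 2 := by
    intro C hC p hp
    unfold wNorm
    have hs : 0 ≤ ∑ k, (T.cell k).vol * C k ^ (2 * p) := Finset.sum_nonneg fun k _ =>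
      mul_nonneg (T.cell k).vol_pos.le (Real.rpow_nonneg (hC k) _)
    rw [← Real.rpow_natCast (_ ^ _), ← Real.rpow_mul hs]
    congr 1
    · refine Finset.sum_congr rfl fun k _ => ?_
      change _ * (C k ^ 2) ^ p = _
      rw [← Real.rpow_natCast, ← Real.rpow_mul (hC k)]
      norm_num
    · field_simp
      norm_num
  rw [e hA (by norm_num), e hB (by norm_num)] at h
  norm_num at h
  simp_rw [mul_pow]
  exact h

variable (P : FlowData d Ω)

/-- The effect of a change of viscosity. -/
def viscosityDiff (y y' : T.PW 2) (u v : T.PW d) : ℝ :=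
  ∑ k, ∫ x in T.pts k, (P.ν (y k x 0) - P.ν (y' k x 0)) * gradInner (u k) (v k)

/-- The splitting lets the viscosity difference multiply the gradient of `u`, the state for which an
`L³` bound is available, and leaves the coercive part with the viscosity at `y'`. -/
theorem aForm_sub (y y' : T.PW 2) (u u' v : T.PW d) :
    aForm P y u v - aForm P y' u' v = aForm P y' (u - u') v + viscosityDiff P y y' u v := by
  unfold aForm viscosityDiff
  rw [← Finset.sum_sub_distrib, ← Finset.sum_add_distrib]
  refine Finset.sum_congr rfl fun k _ => ?_
  have hi : ∀ (y : T.PW 2) (u : T.PW d), IntegrableOn (fun x =>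
      inner ℝ (matOp (P.K x)⁻¹ (u k x)) (v k x) + P.ν (y k x 0) * gradInner (u k) (v k))
      (T.pts k) := fun y u =>
    (integrableOn_inner_inv P u v k).add (integrableOn_viscosity P y _ k)
  rw [← integral_sub (hi y u) (hi y' u'), ← integral_add (hi y' (u - u'))]
  · refine integral_congr_ae (Eventually.of_forall fun x => ?_)
    simp only [Pi.sub_apply, AffineMap.coe_sub, map_sub, inner_sub_left, gradInner_sub_left]
    ring
  · simp_rw [sub_mul]
    exact (integrableOn_viscosity P y _ k).sub (integrableOn_viscosity P y' _ k)

/-- Lipschitz continuity of `ν`, then Hölder with exponents 6, 3 and 2. -/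
theorem abs_viscosityDiff_le (y y' : T.PW 2) (u v : T.PW d) :
    |viscosityDiff P y y' u v| ≤
      P.γν * (wNorm T 6 (cellBound (y - y')) * gradLqNorm 3 u * gradL2 v) := by
  set A : Fin T.numCells → ℝ := fun k => cellBound (y - y') k * gradNorm (u k) with hA
  calc |viscosityDiff P y y' u v|
      ≤ ∑ k, (T.cell k).vol * (P.γν * (A k * gradNorm (v k))) := by
        refine (Finset.abs_sum_le_sum_abs _ _).trans (Finset.sum_le_sum fun k _ =>
          (T.cell k).abs_setIntegral_pts_le fun x hx => ?_)
        rw [abs_mul, hA, mul_assoc (cellBound _ _), ← mul_assoc P.γν]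
        refine mul_le_mul ((P.ν_lipschitz _ _).trans (mul_le_mul_of_nonneg_left ?_ P.γν_pos.le))
          (abs_gradInner_le _ _) (abs_nonneg _)
          (mul_nonneg P.γν_pos.le (cellBound_nonneg _ _))
        refine le_trans ?_ (norm_le_cellBound (y - y') k ((T.cell k).pts_subset_closedPts hx))
        exact PiLp.norm_apply_le (y k x - y' k x) 0
    _ = P.γν * ∑ k, (T.cell k).vol * (A k * gradNorm (v k)) := by
        rw [Finset.mul_sum]
        exact Finset.sum_congr rfl fun k _ => by ring
    _ ≤ P.γν * (√(∑ k, (T.cell k).vol * A k ^ 2) * gradL2 v) :=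
        mul_le_mul_of_nonneg_left (sum_vol_mul_le A fun k => gradNorm (v k)) P.γν_pos.le
    _ ≤ _ := by
        refine mul_le_mul_of_nonneg_left (mul_le_mul_of_nonneg_right ?_ (gradL2_nonneg v))
          P.γν_pos.le
        rw [gradLqNorm_eq]
        exact sqrt_sum_vol_mul_sq_le_six_three (cellBound_nonneg _) fun k => gradNorm_nonneg _

theorem abs_dForm_sub_le (y y' : T.PW 2) (v : T.PW d) :
    |dForm P y v - dForm P y' v| ≤
      P.γF * (wNorm T 2 (cellBound (y - y')) * wNorm T 2 (cellBound v)) := by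
  have hi : ∀ (y : T.PW 2) k, IntegrableOn (fun x => inner ℝ (P.F (y k x)) (v k x)) (T.pts k) := by
    intro y k
    have h1 := P.continuous_F.comp (continuous_affine (y k))
    exact (T.cell k).integrableOn_pts (h1.inner (continuous_affine (v k)))
  unfold dForm
  rw [← Finset.sum_sub_distrib]
  calc _ ≤ ∑ k, (T.cell k).vol * (P.γF * (cellBound (y - y') k * cellBound v k)) := by
        refine (Finset.abs_sum_le_sum_abs _ _).trans (Finset.sum_le_sum fun k _ => ?_)
        rw [← integral_sub (hi y k) (hi y' k)]
        refine (T.cell k).abs_setIntegral_pts_le fun x hx => ?_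
        have hx' := (T.cell k).pts_subset_closedPts hx
        rw [← inner_sub_left, ← mul_assoc]
        refine (abs_real_inner_le_norm _ _).trans (mul_le_mul ((P.F_lipschitz _ _).trans
          (mul_le_mul_of_nonneg_left ?_ P.γF_pos.le)) (norm_le_cellBound v k hx')
          (norm_nonneg _) (mul_nonneg P.γF_pos.le (cellBound_nonneg _ _)))
        exact norm_le_cellBound (y - y') k hx'
    _ = P.γF * ∑ k, (T.cell k).vol * (cellBound (y - y') k * cellBound v k) := by
        rw [Finset.mul_sum]
        exact Finset.sum_congr rfl fun k _ => by ring
    _ ≤ _ := mul_le_mul_of_nonneg_left (sum_vol_mul_le_wNorm Real.HolderConjugate.two_two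
        (cellBound_nonneg _) (cellBound_nonneg _)) P.γF_pos.le

/-- Controls are not piecewise constant, so Hölder is applied to integrals over `Ω`, with the
piecewise constant function of values `cellBound v` as majorant of `|v|`. -/
theorem abs_load_sub_le (hΩb : Bornology.IsBounded Ω) {r : ℝ} (hr : 1 < r)
    {U U' : Vec d → Vec d} (hU : MemLp U (ENNReal.ofReal r) (volume.restrict Ω))
    (hU' : MemLp U' (ENNReal.ofReal r) (volume.restrict Ω)) (v : T.PW d) :
    |load U v - load U' v| ≤ (eLpNorm (U - U') (ENNReal.ofReal r) (volume.restrict Ω)).toReal *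
      wNorm T (r / (r - 1)) (cellBound v) := by
  have hfin : IsFiniteMeasure (volume.restrict Ω) := ⟨by simpa using hΩb.measure_lt_top⟩
  have hr1 : (1 : ℝ≥0∞) ≤ ENNReal.ofReal r := by
    rw [ENNReal.one_le_ofReal]; exact hr.le
  have hconj : r.HolderConjugate (r / (r - 1)) := Real.HolderConjugate.conjExponent hr
  have hW := hU.sub hU'
  set M : Fin T.numCells → ℝ := cellBound v with hM
  have hM0 := cellBound_nonneg v
  have hpw0 : ∀ (c : Fin T.numCells → ℝ), (∀ k, 0 ≤ c k) → ∀ x, 0 ≤ pwConst T c x :=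
    fun c hc x => Finset.sum_nonneg fun k _ => Set.indicator_nonneg (fun _ _ => hc k) x
  have hpwb : ∀ x, pwConst T M x ≤ ∑ k, M k := fun x => Finset.sum_le_sum fun k _ =>
    Set.indicator_le_self' (fun _ _ => hM0 k) x
  have hpwm : ∀ p : ℝ≥0∞, MemLp (pwConst T M) p (volume.restrict Ω) := fun p =>
    MemLp.of_bound (measurable_pwConst M).aestronglyMeasurable (∑ k, M k)
      (Eventually.of_forall fun x => by
        rw [Real.norm_of_nonneg (hpw0 M hM0 x)]; exact hpwb x)
  have hint : Integrable (fun x => ‖(U - U') x‖ * pwConst T M x) (volume.restrict Ω) :=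
    (hW.integrable hr1).norm.mul_bdd (c := ∑ k, M k)
      (measurable_pwConst M).aestronglyMeasurable (Eventually.of_forall fun x => by
        rw [Real.norm_of_nonneg (hpw0 M hM0 x)]; exact hpwb x)
  have hi : ∀ {V : Vec d → Vec d}, MemLp V (ENNReal.ofReal r) (volume.restrict Ω) → ∀ k,
      IntegrableOn (fun x => inner ℝ (V x) (v k x)) (T.pts k) := by
    intro V hV k
    have h1 : IntegrableOn V (T.pts k) := IntegrableOn.mono_set (hV.integrable hr1) (T.cell_subset k)
    refine Integrable.mono' (h1.norm.mul_const (M k))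
      (h1.aestronglyMeasurable.inner (continuous_affine (v k)).aestronglyMeasurable)
      ((ae_restrict_iff' (T.cell k).isOpen_pts.measurableSet).2 (Eventually.of_forall
        fun x hx => ?_))
    exact (norm_inner_le_norm _ _).trans (mul_le_mul_of_nonneg_left
      (norm_le_cellBound v k ((T.cell k).pts_subset_closedPts hx)) (norm_nonneg _))
  have h1 : |load U v - load U' v| ≤ ∑ k, ∫ x in T.pts k, ‖(U - U') x‖ * pwConst T M x := by
    unfold load
    rw [← Finset.sum_sub_distrib]
    refine (Finset.abs_sum_le_sum_abs _ _).trans (Finset.sum_le_sum fun k _ => ?_)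
    rw [← integral_sub (hi hU k) (hi hU' k)]
    refine abs_integral_le_integral_abs.trans ?_
    refine setIntegral_mono_on ((hi hU k).sub (hi hU' k)).abs
      (IntegrableOn.mono_set hint (T.cell_subset k))
      (T.cell k).isOpen_pts.measurableSet
      fun x hx => ?_
    rw [pwConst_of_mem M hx, ← inner_sub_left]
    exact (abs_real_inner_le_norm _ _).trans (mul_le_mul_of_nonneg_left
      (norm_le_cellBound v k ((T.cell k).pts_subset_closedPts hx)) (norm_nonneg _))
  have h2 : ∑ k, ∫ x in T.pts k, ‖(U - U') x‖ * pwConst T M x ≤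
      ∫ x in Ω, ‖(U - U') x‖ * pwConst T M x := by
    rw [← integral_iUnion_fintype (fun k => (T.cell k).isOpen_pts.measurableSet)
      (fun k l hkl => T.disjoint k l hkl)
      (fun k => IntegrableOn.mono_set hint (T.cell_subset k))]
    exact setIntegral_mono_set hint (Eventually.of_forall fun x =>
      mul_nonneg (norm_nonneg _) (hpw0 M hM0 x))
      (Set.iUnion_subset T.cell_subset).eventuallyLE
  have h3 := integral_mul_le_Lp_mul_Lq_of_nonneg (μ := volume.restrict Ω) hconj
    (f := fun x => ‖(U - U') x‖) (g := pwConst T M) (Eventually.of_forall fun x => norm_nonneg _)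
    (Eventually.of_forall fun x => hpw0 M hM0 x) hW.norm (hpwm _)
  refine (h1.trans (h2.trans h3)).trans (le_of_eq ?_)
  congr 1
  · rw [hW.eLpNorm_eq_integral_rpow_norm (by simpa using hconj.pos) ENNReal.ofReal_ne_top,
      ENNReal.toReal_ofReal (by positivity), ENNReal.toReal_ofReal hconj.nonneg, one_div]
  · unfold wNorm
    congr 1
    have e : ∀ x, pwConst T M x ^ (r / (r - 1)) = pwConst T (fun k => M k ^ (r / (r - 1))) x := by
      intro x
      by_cases hx : ∃ k, x ∈ T.pts k
      · obtain ⟨k, hk⟩ := hx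
        rw [pwConst_of_mem _ hk, pwConst_of_mem _ hk]
      · push Not at hx
        unfold pwConst
        rw [Finset.sum_eq_zero fun k _ => Set.indicator_of_notMem (hx k) _,
          Finset.sum_eq_zero fun k _ => Set.indicator_of_notMem (hx k) _,
          Real.zero_rpow hconj.symm.ne_zero]
    simp_rw [e]
    unfold pwConst
    rw [integral_finsetSum]
    · refine Finset.sum_congr rfl fun k _ => ?_
      rw [integral_indicator (T.cell k).isOpen_pts.measurableSet,
        Measure.restrict_restrict (T.cell k).isOpen_pts.measurableSet,
        Set.inter_eq_left.2 (T.cell_subset k), setIntegral_pts_const]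
    · intro k _
      exact ((integrable_indicator_iff (T.cell k).isOpen_pts.measurableSet).2
        (integrableOn_const (T.cell k).volume_pts_lt_top.ne)).mono_measure Measure.restrict_le_self

theorem IsCR.sub {v w : T.PW m} (hv : IsCR v) (hw : IsCR w) : IsCR (v - w) := fun k i k' h => by
  simp only [Pi.sub_apply, AffineMap.coe_sub, hv k i k' h, hw k i k' h]

theorem IsCR0.sub {v w : T.PW m} (hv : IsCR0 v) (hw : IsCR0 w) : IsCR0 (v - w) :=
  ⟨hv.1.sub hw.1, fun k i h => by
    simp only [Pi.sub_apply, AffineMap.coe_sub, hv.2 k i h, hw.2 k i h, sub_zero]⟩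

theorem IsX.sub {v w : T.PW d} (hv : IsX v) (hw : IsX w) : IsX (v - w) := by
  refine ⟨hv.1.sub hw.1, fun q hq => ?_⟩
  have h1 := hv.2 q hq
  have h2 := hw.2 q hq
  unfold bForm at h1 h2 ⊢
  simp_rw [setIntegral_pts_const] at h1 h2 ⊢
  rw [neg_eq_zero] at h1 h2 ⊢
  simp only [Pi.sub_apply, AffineMap.sub_linear, map_sub, mul_sub, Finset.sum_sub_distrib, h1, h2,
    sub_zero]

/-- A Crouzeix–Raviart function with vanishing cell bounds is zero. -/
theorem eq_zero_of_cellBound_eq_zero (hd : 0 < d) {v : T.PW m} (h : ∀ k, cellBound v k = 0) :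
    v = 0 := by
  funext k
  have h1 := h k
  have h2 := mul_nonneg (T.cell k).diam_nonneg (gradNorm_nonneg (v k))
  have h3 := norm_nonneg (v k (T.base k))
  unfold cellBound at h1
  have h4 : ‖v k (T.base k)‖ = 0 := by linarith
  have h5 : (T.cell k).diam * gradNorm (v k) = 0 := by linarith
  have h6 := (mul_eq_zero.1 h5).resolve_left ((T.cell k).diam_pos hd).ne'
  ext x : 1
  have h7 := norm_sub_le_gradNorm (v k) x (T.base k)
  rw [h6, zero_mul, norm_eq_zero.1 h4, sub_zero] at h7
  simpa using h7

end Mesh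

end NCFlow

end

/-! ### Uniform constants and the stability argument -/

noncomputable section

namespace NCFlow

open Module Filter Topology

namespace Mesh

variable {d m : ℕ} {Ω : Set (Vec d)} {T : Mesh d Ω} {P : FlowData d Ω}

/-- Embedding and continuity constant of a mesh, with cell bounds in place of function values. -/
structure Bounds (T : Mesh d Ω) (P : FlowData d Ω) (qmax E : ℝ) : Prop where
  lqU : ∀ q : ℝ, 1 ≤ q → q ≤ qmax → ∀ v : T.PW d, IsCR0 v →
    wNorm T q (cellBound v) ≤ E * normU P v
  lqY : ∀ q : ℝ, 1 ≤ q → q ≤ qmax → ∀ s : T.PW 2, IsCR0 s →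
    wNorm T q (cellBound s) ≤ E * normY P s
  convU : ∀ w w' u v : T.PW d, IsCR0 (w - w') → IsCR u → IsCR0 v →
    |convForm w u v - convForm w' u v| ≤ E * normU P (w - w') * normU P u * normU P v
  convY : ∀ (w w' : T.PW d) (y s : T.PW 2), IsCR0 (w - w') → IsCR y → IsCR0 s →
    |convForm w y s - convForm w' y s| ≤ E * normU P (w - w') * normY P y * normY P s
  gradU : ∀ v : T.PW d, gradL2 v ≤ E * normU P v

/-- The Sobolev inequality is used at `qmax` alone; lower exponents follow from Hölder on the
bounded domain. For `d = 3` the exponent 6 is critical, `2(6·2/3 - 1) = 6`, while for `d = 2` the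
condition `q - 2 ≤ q` always holds. -/
theorem exists_bounds (hd : d = 2 ∨ d = 3) (hΩb : Bornology.IsBounded Ω) (P : FlowData d Ω)
    {ρ : ℝ} (hρ : 0 < ρ) {qmax : ℝ} (hq6 : 6 ≤ qmax) (hqd : d = 3 → qmax = 6) :
    ∃ E : ℝ, 1 ≤ E ∧ ∀ T : Mesh d Ω, T.ShapeRegular ρ → Bounds T P qmax E := by
  have hd2 : 2 ≤ d := by omega
  have hd0 : 0 < d := by omega
  set κ : ℝ := (ballVol d).toReal / (4 * ρ) ^ d with hκd
  have hκ : 0 < κ := div_pos (Cell.ballVol_toReal_pos d) (by positivity)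
  -- The summand ensures `1 ≤ W`, so every power of `W` with exponent at most one is at most `W`.
  set W : ℝ := volume.real Ω + 1 with hWd
  have hW1 : 1 ≤ W := le_add_of_nonneg_left measureReal_nonneg
  have hq : (d : ℝ) / (d - 1) < qmax ∧ 2 * (qmax * (d - 1) / d - 1) ≤ qmax := by
    rcases hd with rfl | h3
    · norm_num
      constructor <;> linarith
    · have := hqd h3
      subst h3
      rw [this]
      norm_num
  obtain ⟨C, hC, hS⟩ := exists_wNorm_cellBound_le hd2 hκ (zero_le_one.trans hW1) hq.1 hq.2
  set Cc : ℝ := 1 + (ballVol (d - 1)).toReal * (8 * d / κ) with hCc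
  have hCc0 : 0 ≤ Cc := by positivity
  have hν := Real.sqrt_pos.2 P.ν₂_pos
  have hσ := Real.sqrt_pos.2 P.sigmaBar_pos
  set β : ℝ := (√P.ν₂)⁻¹ + (√P.sigmaBar)⁻¹ with hβd
  have hβ : 0 < β := by positivity
  set S : ℝ := W * C * β with hSd
  have hS0 : 0 < S := by positivity
  set E : ℝ := 1 + β + S + Cc * S * S * β with hE
  have hCS : 0 ≤ Cc * S * S * β := by positivity
  refine ⟨E, by linarith, fun T hT => ?_⟩
  have hvol : ∀ k, κ * (T.cell k).diam ^ d ≤ (T.cell k).vol := fun k =>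
    (T.cell k).pow_diam_le_vol hd0 hρ (hT k)
  have hsum : ∑ k, (T.cell k).vol ≤ W := (sum_vol_le hΩb).trans (by linarith)
  have gU : ∀ v : T.PW d, gradL2 v ≤ β * normU P v := fun v =>
    (gradL2_le_normU P v).trans (mul_le_mul_of_nonneg_right
      (le_add_of_nonneg_right (by positivity)) (normU_nonneg P v))
  have gY : ∀ v : T.PW 2, gradL2 v ≤ β * normY P v := fun v =>
    (gradL2_le_normY P v).trans (mul_le_mul_of_nonneg_right
      (le_add_of_nonneg_left (by positivity)) (normY_nonneg P v))
  have hemb : ∀ {n : ℕ} (v : T.PW n) (N : ℝ), IsCR0 v → gradL2 v ≤ β * N → ∀ q : ℝ, 1 ≤ q →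
      q ≤ qmax → wNorm T q (cellBound v) ≤ S * N := by
    intro n v N hv hN q hq1 hq2
    have h1 := wNorm_le_wNorm hsum (by linarith) hq2 (cellBound_nonneg v)
    have h2 : W ^ (1 / q - 1 / qmax) ≤ W := by
      conv_rhs => rw [← Real.rpow_one W]
      refine Real.rpow_le_rpow_of_exponent_le hW1 ?_
      have h3 : 1 / q ≤ 1 := by rw [div_le_one (by linarith)]; exact hq1
      have h4 : 0 ≤ 1 / qmax := by positivity
      linarith
    calc _ ≤ _ := h1
      _ ≤ W * (C * (β * N)) := by
        refine mul_le_mul h2 ((hS Ω T hvol hsum n v hv).trans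
          (mul_le_mul_of_nonneg_left hN hC.le)) (wNorm_nonneg (cellBound_nonneg v)) (by linarith)
      _ = S * N := by rw [hSd]; ring
  have hconv : ∀ {n : ℕ} (w w' : T.PW d) (u v : T.PW n) (Nu Nv : ℝ), IsCR0 (w - w') → IsCR u →
      IsCR0 v → gradL2 u ≤ β * Nu → gradL2 v ≤ β * Nv → 0 ≤ Nu → 0 ≤ Nv →
      |convForm w u v - convForm w' u v| ≤ E * normU P (w - w') * Nu * Nv := by
    intro n w w' u v Nu Nv hw hu hv hNu hNv hNu0 hNv0
    have h1 := hemb (w - w') _ hw (gU _) 4 (by norm_num) (by linarith)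
    have h2 := hemb v _ hv hNv 4 (by norm_num) (by linarith)
    have hX := normU_nonneg P (w - w')
    have h3 : |convForm w u v - convForm w' u v| ≤
        Cc * ((S * normU P (w - w')) * (S * Nv) * (β * Nu)) := by
      refine (abs_convForm_sub_le hd2 hκ hvol w w' hu v).trans
        (mul_le_mul_of_nonneg_left ?_ hCc0)
      have h4 := wNorm_nonneg (T := T) (q := 4) (cellBound_nonneg (w - w'))
      have h5 := wNorm_nonneg (T := T) (q := 4) (cellBound_nonneg v)
      exact mul_le_mul (mul_le_mul h1 h2 h5 (by positivity)) hNu (gradL2_nonneg u) (by positivity)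
    refine h3.trans ?_
    have h6 : 0 ≤ (1 + β + S) * (normU P (w - w') * Nu * Nv) := by positivity
    rw [hE]
    linear_combination h6
  refine ⟨fun q h1 h2 v hv => ?_, fun q h1 h2 v hv => ?_, fun w w' u v hw hu hv => ?_,
    fun w w' u v hw hu hv => ?_, fun v => ?_⟩
  · exact (hemb v _ hv (gU v) q h1 h2).trans
      (mul_le_mul_of_nonneg_right (by linarith) (normU_nonneg P v))
  · exact (hemb v _ hv (gY v) q h1 h2).trans
      (mul_le_mul_of_nonneg_right (by linarith) (normY_nonneg P v))
  · exact hconv w w' u v _ _ hw hu hv (gU u) (gU v) (normU_nonneg P u) (normU_nonneg P v)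
  · exact hconv w w' u v _ _ hw hu hv (gY u) (gY v) (normY_nonneg P u) (normY_nonneg P v)
  · exact (gU v).trans (mul_le_mul_of_nonneg_right (by linarith) (normU_nonneg P v))

theorem eq_zero_of_wNorm_cellBound_le_zero (hd : 0 < d) {v : T.PW m}
    (h : wNorm T 1 (cellBound v) ≤ 0) : v = 0 := by
  refine eq_zero_of_cellBound_eq_zero hd fun k => ?_
  have hnn : ∀ k, 0 ≤ (T.cell k).vol * cellBound v k := fun k =>
    mul_nonneg (T.cell k).vol_pos.le (cellBound_nonneg v k)
  unfold wNorm at h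
  simp only [Real.rpow_one, div_one] at h
  have h1 := (Finset.sum_eq_zero_iff_of_nonneg fun k _ => hnn k).1
    (le_antisymm h (Finset.sum_nonneg fun k _ => hnn k)) k (Finset.mem_univ k)
  exact (mul_eq_zero.1 h1).resolve_left (T.cell k).vol_pos.ne'

theorem Bounds.abs_convU_le {qmax E : ℝ} (h : Bounds T P qmax E) {w u v : T.PW d} (hw : IsCR0 w)
    (hu : IsCR u) (hv : IsCR0 v) :
    |convForm w u v| ≤ E * normU P w * normU P u * normU P v := by
  have := h.convU w 0 u v (by rwa [sub_zero]) hu hv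
  rwa [convForm_zero_left, sub_zero, sub_zero] at this

theorem Bounds.abs_convY_le {qmax E : ℝ} (h : Bounds T P qmax E) {w : T.PW d} {y s : T.PW 2}
    (hw : IsCR0 w) (hy : IsCR y) (hs : IsCR0 s) :
    |convForm w y s| ≤ E * normU P w * normY P y * normY P s := by
  have := h.convY w 0 y s (by rwa [sub_zero]) hy hs
  rwa [convForm_zero_left, sub_zero, sub_zero] at this

theorem Bounds.embeddingConst {qmax E Ce : ℝ} (h : Bounds T P qmax E) (hE : E ≤ Ce) :
    EmbeddingConst T P qmax Ce := by
  refine ⟨fun q h1 h2 => ⟨fun v hv => ?_, fun s hs => ?_⟩, fun w u v hw hu hv => ?_,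
    fun w y s hw hy hs => ?_⟩
  · exact (lqNorm_le_wNorm (by linarith) v).trans ((h.lqU q h1 h2 v hv).trans
      (mul_le_mul_of_nonneg_right hE (normU_nonneg P v)))
  · exact (lqNorm_le_wNorm (by linarith) s).trans ((h.lqY q h1 h2 s hs).trans
      (mul_le_mul_of_nonneg_right hE (normY_nonneg P s)))
  · refine (h.abs_convU_le hw hu.1 hv).trans ?_
    have := normU_nonneg P w
    have := normU_nonneg P u
    have := normU_nonneg P v
    gcongr
  · refine (h.abs_convY_le hw hy hs).trans ?_
    have := normU_nonneg P w
    have := normY_nonneg P y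
    have := normY_nonneg P s
    gcongr

/-- Coercivity constants of `aʰ` are at most one if the velocity space is not trivial. -/
theorem Coercive.le_one_left (hΩ : IsOpen Ω) {αa αy : ℝ} (h : Coercive T P αa αy) {s : T.PW 2}
    (hs : IsCR s) {v : T.PW d} (hv : IsCR0 v) (hpos : 0 < normU P v) : αa ≤ 1 := by
  have h1 := (h.1 s v hs hv).trans (aForm_self_le P hΩ s v)
  have h2 : 0 < normU P v ^ 2 := by positivity
  exact le_of_mul_le_mul_right (by linarith) h2

theorem Coercive.le_one_right {αa αy : ℝ} (h : Coercive T P αa αy) {s : T.PW 2}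
    (hs : IsCR0 s) (hpos : 0 < normY P s) : αy ≤ 1 := by
  have h1 := (h.2 s hs).trans (aYForm_self_le P s)
  have h2 : 0 < normY P s ^ 2 := by positivity
  exact le_of_mul_le_mul_right (by linarith) h2

section Stability

variable {yD : Vec d → Vec 2} {U₁ U₂ : Vec d → Vec d} {u₁ u₂ : T.PW d} {y₁ y₂ : T.PW 2}

theorem IsSolution.sub_isCR0 (h₁ : IsSolution P yD U₁ u₁ y₁) (h₂ : IsSolution P yD U₂ u₂ y₂) :
    IsCR0 (y₁ - y₂) :=
  ⟨h₁.y_mem.sub h₂.y_mem, fun k i hb => by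
    simp only [Pi.sub_apply, AffineMap.coe_sub, h₁.bdry k i hb, h₂.bdry k i hb, sub_self]⟩

/-- The difference of the temperature–concentration pairs is controlled by that of the velocities. -/
theorem Bounds.transport_estimate {qmax E a y : ℝ} (hB : Bounds T P qmax E)
    (hc : Coercive T P a y) (h₁ : IsSolution P yD U₁ u₁ y₁) (h₂ : IsSolution P yD U₂ u₂ y₂) :
    y * normY P (y₁ - y₂) ^ 2 ≤
      E * normU P (u₁ - u₂) * normY P y₁ * normY P (y₁ - y₂) +
      E * normU P u₂ * normY P (y₁ - y₂) * normY P (y₁ - y₂) := by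
  have hδ := h₁.sub_isCR0 h₂
  -- The convective difference splits into a change of velocity at fixed `y₁` and the form at `u₂`
  -- applied to the difference. The latter is not dropped by sign but bounded, to be absorbed for
  -- small `u₂`.
  have e1 := h₁.transport _ hδ
  have e2 := h₂.transport _ hδ
  have e3 := aYForm_sub P y₁ y₂ (y₁ - y₂)
  have e4 := convForm_sub_middle u₂ y₁ y₂ (y₁ - y₂)
  have b1 := abs_le.1 (hB.convY u₁ u₂ y₁ (y₁ - y₂) (h₁.u_mem.1.sub h₂.u_mem.1) h₁.y_mem hδ)
  have b2 := abs_le.1 (hB.abs_convY_le h₂.u_mem.1 hδ.1 hδ)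
  have e5 := hc.2 _ hδ
  linarith [b1.1, b2.1]

/-- Subtract the two momentum equations and test with `u₁ - u₂`, which lies in the discrete kernel.
Coercivity is used at `y₂`, and the changes of viscosity and of convecting velocity are taken at the
first state `u₁`. -/
theorem Bounds.momentum_estimate {qmax E a y r : ℝ} (hB : Bounds T P qmax E) (hE : 0 ≤ E)
    (hq6 : 6 ≤ qmax) (hr : 1 < r) (hrq : r / (r - 1) ≤ qmax) (hΩb : Bornology.IsBounded Ω)
    (hc : Coercive T P a y) (h₁ : IsSolution P yD U₁ u₁ y₁) (h₂ : IsSolution P yD U₂ u₂ y₂)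
    (hU₁ : MemLp U₁ (ENNReal.ofReal r) (volume.restrict Ω))
    (hU₂ : MemLp U₂ (ENNReal.ofReal r) (volume.restrict Ω)) {Mt : ℝ} (hMt : gradLqNorm 3 u₁ ≤ Mt) :
    a * normU P (u₁ - u₂) ^ 2 ≤
      P.γν * ((E * normY P (y₁ - y₂)) * Mt * (E * normU P (u₁ - u₂))) +
      E * normU P (u₁ - u₂) * normU P u₁ * normU P (u₁ - u₂) +
      E * normU P u₂ * normU P (u₁ - u₂) * normU P (u₁ - u₂) +
      P.γF * ((E * normY P (y₁ - y₂)) * (E * normU P (u₁ - u₂))) +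
      (eLpNorm (U₁ - U₂) (ENNReal.ofReal r) (volume.restrict Ω)).toReal *
        (E * normU P (u₁ - u₂)) := by
  have hδy := h₁.sub_isCR0 h₂
  have hδX := h₁.u_mem.sub h₂.u_mem
  have hδ := hδX.1
  have e1 := h₁.momentum _ hδX
  have e2 := h₂.momentum _ hδX
  have e3 := aForm_sub P y₁ y₂ u₁ u₂ (u₁ - u₂)
  have e4 := convForm_sub_middle u₂ u₁ u₂ (u₁ - u₂)
  have b1 := abs_le.1 (hB.convU u₁ u₂ u₁ (u₁ - u₂) hδ h₁.u_mem.1.1 hδ)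
  have b2 := abs_le.1 (hB.abs_convU_le h₂.u_mem.1 hδ.1 hδ)
  have b3 := abs_le.1 (abs_viscosityDiff_le P y₁ y₂ u₁ (u₁ - u₂))
  have b4 := abs_le.1 (abs_dForm_sub_le P y₁ y₂ (u₁ - u₂))
  have b5 := abs_le.1 (abs_load_sub_le hΩb hr hU₁ hU₂ (u₁ - u₂))
  have e5 := hc.1 y₂ _ h₂.y_mem hδ
  have hX := normU_nonneg P (u₁ - u₂)
  have hY := normY_nonneg P (y₁ - y₂)
  have hMt0 : 0 ≤ gradLqNorm 3 u₁ := by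
    rw [gradLqNorm_eq]; exact wNorm_nonneg fun k => gradNorm_nonneg _
  have c3 : P.γν * (wNorm T 6 (cellBound (y₁ - y₂)) * gradLqNorm 3 u₁ * gradL2 (u₁ - u₂)) ≤
      P.γν * ((E * normY P (y₁ - y₂)) * Mt * (E * normU P (u₁ - u₂))) := by
    refine mul_le_mul_of_nonneg_left ?_ P.γν_pos.le
    exact mul_le_mul (mul_le_mul (hB.lqY 6 (by norm_num) hq6 _ hδy) hMt hMt0 (by positivity))
      (hB.gradU _) (gradL2_nonneg _) (mul_nonneg (by positivity) (hMt0.trans hMt))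
  have c4 : P.γF * (wNorm T 2 (cellBound (y₁ - y₂)) * wNorm T 2 (cellBound (u₁ - u₂))) ≤
      P.γF * ((E * normY P (y₁ - y₂)) * (E * normU P (u₁ - u₂))) := by
    refine mul_le_mul_of_nonneg_left ?_ P.γF_pos.le
    exact mul_le_mul (hB.lqY 2 (by norm_num) (by linarith) _ hδy)
      (hB.lqU 2 (by norm_num) (by linarith) _ hδ) (wNorm_nonneg (cellBound_nonneg _))
      (by positivity)
  have hr1 : 1 ≤ r / (r - 1) := by
    rw [one_le_div (by linarith)]; linarith
  have c5 : (eLpNorm (U₁ - U₂) (ENNReal.ofReal r) (volume.restrict Ω)).toReal *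
      wNorm T (r / (r - 1)) (cellBound (u₁ - u₂)) ≤
      (eLpNorm (U₁ - U₂) (ENNReal.ofReal r) (volume.restrict Ω)).toReal *
        (E * normU P (u₁ - u₂)) :=
    mul_le_mul_of_nonneg_left (hB.lqU _ hr1 hrq _ hδ) ENNReal.toReal_nonneg
  linarith [b1.1, b2.1, b3.1, b4.2, b5.2]

/-- Lipschitz dependence of discrete states on the control. -/
theorem Bounds.stability {qmax E a y r Ce αa αy Mt Mu My : ℝ} (hΩ : IsOpen Ω)
    (hB : Bounds T P qmax E) (hE : 0 < E) (hq6 : 6 ≤ qmax) (hr : 1 < r) (hrq : r / (r - 1) ≤ qmax)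
    (hΩb : Bornology.IsBounded Ω) (ha : 0 < a) (hy : 0 < y) (hc : Coercive T P a y)
    (hCe : 0 < Ce) (hCe1 : 2 * E / y ≤ Ce) (hCe2 : 4 * E / a ≤ Ce)
    (hCe3 : 8 * E ^ 3 * (1 + P.γF / P.CF) / (y * a) ≤ Ce)
    (hαy : 0 < αy) (hMt : 0 < Mt) (hMu : 0 ≤ Mu) (hMy : 0 ≤ My)
    (hcond : Ce * My / αy * (P.γν * Mt + P.CF) + Ce * Mu < αa) (hc' : Coercive T P αa αy)
    (h₁ : IsSolution P yD U₁ u₁ y₁) (h₂ : IsSolution P yD U₂ u₂ y₂)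
    (hU₁ : MemLp U₁ (ENNReal.ofReal r) (volume.restrict Ω))
    (hU₂ : MemLp U₂ (ENNReal.ofReal r) (volume.restrict Ω))
    (hMtu : gradLqNorm 3 u₁ ≤ Mt) (hMu₁ : normU P u₁ ≤ Mu) (hMy₁ : normY P y₁ ≤ My)
    (hMu₂ : normU P u₂ ≤ Mu) :
    normU P (u₁ - u₂) + normY P (y₁ - y₂) ≤ (1 + 2 * E * My / y) * (4 * E / a) *
      (eLpNorm (U₁ - U₂) (ENNReal.ofReal r) (volume.restrict Ω)).toReal := by
  have hyest := hB.transport_estimate hc h₁ h₂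
  have huest := hB.momentum_estimate hE.le hq6 hr hrq hΩb hc h₁ h₂ hU₁ hU₂ hMtu
  set Z := (eLpNorm (U₁ - U₂) (ENNReal.ofReal r) (volume.restrict Ω)).toReal with hZ
  have hZ0 : 0 ≤ Z := ENNReal.toReal_nonneg
  have hX := normU_nonneg P (u₁ - u₂)
  have hY := normY_nonneg P (y₁ - y₂)
  set X := normU P (u₁ - u₂) with hXd
  set Y := normY P (y₁ - y₂) with hYd
  have hγν := P.γν_pos
  have hγF := P.γF_pos
  have hCF := P.CF_pos
  set G := P.γν * Mt + P.CF with hG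
  have hG0 : 0 < G := by positivity
  have hfirst : 0 ≤ Ce * My / αy * G := by positivity
  have hsecond : 0 ≤ Ce * Mu := by positivity
  -- Unless `v` has norm zero, its presence forces `αa ≤ 1`, and the hypothesis then gives `Ce * Mu
  -- < 1`.
  have hsmall : ∀ v : T.PW d, IsCR0 v → normU P v ≤ Mu → Ce * normU P v ≤ 1 := by
    intro v hv hvM
    rcases (normU_nonneg P v).eq_or_lt with h0 | hpos
    · rw [← h0, mul_zero]; exact zero_le_one
    · have h1 := hc'.le_one_left hΩ h₁.y_mem hv hpos
      have h2 := mul_le_mul_of_nonneg_left hvM hCe.le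
      linarith
  have hμ : ∀ v : T.PW d, IsCR0 v → normU P v ≤ Mu → E * normU P v ≤ y / 2 ∧
      E * normU P v ≤ a / 4 := by
    intro v hv hvM
    have h1 := hsmall v hv hvM
    have h2 := normU_nonneg P v
    constructor
    · have h3 := (mul_le_mul_of_nonneg_right hCe1 h2).trans h1
      rw [div_mul_eq_mul_div, div_le_one hy] at h3
      linarith
    · have h3 := (mul_le_mul_of_nonneg_right hCe2 h2).trans h1
      rw [div_mul_eq_mul_div, div_le_one ha] at h3
      linarith
  have hμ₁ := hμ u₁ h₁.u_mem.1 hMu₁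
  have hμ₂ := hμ u₂ h₂.u_mem.1 hMu₂
  -- The term with `u₂` takes at most half of the coercivity `y`.
  have hYX : Y ≤ 2 * E * My / y * X := by
    rcases hY.eq_or_lt with h0 | hpos
    · rw [← h0]; positivity
    · have h1 : E * X * normY P y₁ * Y ≤ E * X * My * Y := by gcongr
      have h2 := mul_le_mul_of_nonneg_right hμ₂.1 (mul_nonneg hY hY)
      have h3 : (y * Y) * Y ≤ (2 * E * My * X) * Y := by linarith
      have h4 := le_of_mul_le_mul_right h3 hpos
      rw [div_mul_eq_mul_div, le_div_iff₀ hy]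
      linarith
  have hXZ : X ≤ 4 * E / a * Z := by
    rcases hX.eq_or_lt with h0 | hpos
    · rw [← h0]; positivity
    · have hαa1 := hc'.le_one_left hΩ h₁.y_mem (h₁.u_mem.1.sub h₂.u_mem.1) hpos
      -- The coupling through viscosity and buoyancy takes a quarter of the coercivity `a`, after
      -- `Y` is bounded by `X`. If `Y > 0` then `αy ≤ 1`, so `My / αy` dominates `My` in the
      -- hypothesis.
      have hcoup : E ^ 2 * (P.γν * Mt + P.γF) * Y ≤ a / 4 * X := by
        rcases hY.eq_or_lt with h0 | hYpos
        · rw [← h0, mul_zero]; positivity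
        · have hαy1 := hc'.le_one_right (h₁.sub_isCR0 h₂) hYpos
          have h1 : Ce * (My * G) ≤ 1 := by
            have h2 : Ce * My ≤ Ce * My / αy := by
              rw [le_div_iff₀ hαy]
              exact mul_le_of_le_one_right (by positivity) hαy1
            have h3 := mul_le_mul_of_nonneg_right h2 hG0.le
            linarith
          have h4 := (mul_le_mul_of_nonneg_right hCe3 (mul_nonneg hMy hG0.le)).trans h1
          rw [div_mul_eq_mul_div, div_le_one (by positivity)] at h4
          -- The hypothesis carries the growth constant `CF`, whereas differences of `F` cost `γF`;
          -- the ratio is built into the lower bound for `Ce`.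
          have h5 : P.γν * Mt + P.γF ≤ (1 + P.γF / P.CF) * G := by
            have h6 : P.γF / P.CF * P.CF = P.γF := div_mul_cancel₀ _ hCF.ne'
            have h7 : 0 ≤ P.γF / P.CF * (P.γν * Mt) := by positivity
            rw [hG]
            linarith
          calc E ^ 2 * (P.γν * Mt + P.γF) * Y
              ≤ E ^ 2 * ((1 + P.γF / P.CF) * G) * (2 * E * My / y * X) := by gcongr
            _ = (8 * E ^ 3 * (1 + P.γF / P.CF) * (My * G)) / (4 * y) * X := by
                field_simp; ring
            _ ≤ (y * a) / (4 * y) * X := by gcongr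
            _ = a / 4 * X := by field_simp
      -- Coupling and the two convective terms use up three quarters of `a`; the remaining quarter
      -- gives the factor `4 * E / a`.
      have h8 : (a * X) * X ≤ (E ^ 2 * (P.γν * Mt + P.γF) * Y + (a / 4 + a / 4) * X + Z * E) * X := by
        have h9 := mul_le_mul_of_nonneg_right hμ₁.2 (mul_nonneg hX hX)
        have h10 := mul_le_mul_of_nonneg_right hμ₂.2 (mul_nonneg hX hX)
        linear_combination huest + h9 + h10
      have h11 := le_of_mul_le_mul_right h8 hpos
      rw [div_mul_eq_mul_div, le_div_iff₀ ha]
      linarith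
  have hK : 0 ≤ 1 + 2 * E * My / y := by positivity
  calc X + Y ≤ (1 + 2 * E * My / y) * X := by linarith
    _ ≤ (1 + 2 * E * My / y) * (4 * E / a * Z) := mul_le_mul_of_nonneg_left hXZ hK
    _ = _ := by ring

end Stability

end Mesh

end NCFlow

end

/-! ### The main theorem -/

open NCFlow NCFlow.Mesh in
theorem theorem4p6 (d : ℕ) (hd : d = 2 ∨ d = 3)
    (Ω : Set (Vec d)) (hΩ : IsOpen Ω) (hΩb : Bornology.IsBounded Ω)
    (P : FlowData d Ω) (ρ : ℝ) (hρ : 0 < ρ)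
    (r : ℝ) (hr : (d = 2 ∧ 1 < r) ∨ (d = 3 ∧ 6 / 5 ≤ r ∧ r ≤ 6)) :
    -- coercivity holds with constants that do not depend on the mesh
    (∃ αa αy : ℝ, 0 < αa ∧ 0 < αy ∧ ∀ T : Mesh d Ω, Coercive T P αa αy) ∧
    -- the constant `Ce` depends only on `d`, `Ω`, `ρ`, `r` and the data of the problem
    ∃ Ce : ℝ, 0 < Ce ∧
      (∀ T : Mesh d Ω, T.ShapeRegular ρ → EmbeddingConst T P (max 6 (r / (r - 1))) Ce) ∧
      ∀ αa αy Mt Mu My : ℝ, 0 < αa → 0 < αy → 0 < Mt → 0 ≤ Mu → 0 ≤ My →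
        αa > Ce * My / αy * (P.γν * Mt + P.CF) + Ce * Mu →
        ∃ C : ℝ, 0 < C ∧
          ∀ T : Mesh d Ω, T.ShapeRegular ρ → Coercive T P αa αy →
          ∀ yD : Vec d → Vec 2, MemLp yD 2 (μHE[d - 1].restrict (frontier Ω)) →
            -- uniqueness
            (∀ U : Vec d → Vec d, MemLp U (ENNReal.ofReal r) (volume.restrict Ω) →
              ∀ (u u' : T.PW d) (y y' : T.PW 2),
                IsSolution P yD U u y → IsSolution P yD U u' y' →
                gradLqNorm 3 u ≤ Mt →
                normU P u ≤ Mu → normY P y ≤ My → normU P u' ≤ Mu →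
                u = u' ∧ y = y') ∧
            -- Lipschitz dependence on the control
            (∀ U₁ U₂ : Vec d → Vec d,
              MemLp U₁ (ENNReal.ofReal r) (volume.restrict Ω) →
              MemLp U₂ (ENNReal.ofReal r) (volume.restrict Ω) →
              ∀ (u₁ u₂ : T.PW d) (y₁ y₂ : T.PW 2),
                IsSolution P yD U₁ u₁ y₁ → IsSolution P yD U₂ u₂ y₂ →
                gradLqNorm 3 u₁ ≤ Mt →
                normU P u₁ ≤ Mu → normY P y₁ ≤ My → normU P u₂ ≤ Mu →
                normU P (u₁ - u₂) + normY P (y₁ - y₂) ≤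
                  C * (eLpNorm (U₁ - U₂) (ENNReal.ofReal r) (volume.restrict Ω)).toReal) := by
  
  have hd0 : 0 < d := by omega
  have hr1 : 1 < r := by
    rcases hr with h | h
    · exact h.2
    · linarith [h.2.1]
  -- The bound `6 / 5 ≤ r` says exactly that the conjugate exponent does not exceed the critical
  -- exponent 6.
  have hq3 : d = 3 → max 6 (r / (r - 1)) = 6 := by
    intro h3
    refine max_eq_left ?_
    rcases hr with h | h
    · omega
    · rw [div_le_iff₀ (by linarith)]
      linarith [h.2.1]
  obtain ⟨a, y, ha, hy, hc⟩ := exists_coercive P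
  obtain ⟨E, hE1, hB⟩ := exists_bounds hd hΩb P hρ (le_max_left 6 (r / (r - 1))) hq3
  have hE : 0 < E := by linarith
  refine ⟨⟨a, y, ha, hy, hc⟩, ?_⟩
  have hγ : 0 < P.γF / P.CF := div_pos P.γF_pos P.CF_pos
  have p1 : 0 < 2 * E / y := by positivity
  have p2 : 0 < 4 * E / a := by positivity
  have p3 : 0 < 8 * E ^ 3 * (1 + P.γF / P.CF) / (y * a) := by positivity
  -- The sum dominates the embedding constant and the three lower bounds required by the absorption
  -- argument; none of its terms involves the mesh, `yD` or the controls.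
  refine ⟨E + 2 * E / y + 4 * E / a + 8 * E ^ 3 * (1 + P.γF / P.CF) / (y * a), by positivity,
    fun T hT => (hB T hT).embeddingConst (by linarith), ?_⟩
  intro αa αy Mt Mu My _ hαy hMt hMu hMy hcond
  refine ⟨(1 + 2 * E * My / y) * (4 * E / a), by positivity, fun T hT hT' yD _ => ?_⟩
  have key : ∀ U₁ U₂ : Vec d → Vec d,
      MemLp U₁ (ENNReal.ofReal r) (volume.restrict Ω) →
      MemLp U₂ (ENNReal.ofReal r) (volume.restrict Ω) →
      ∀ (u₁ u₂ : T.PW d) (y₁ y₂ : T.PW 2),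
        IsSolution P yD U₁ u₁ y₁ → IsSolution P yD U₂ u₂ y₂ →
        gradLqNorm 3 u₁ ≤ Mt → normU P u₁ ≤ Mu → normY P y₁ ≤ My → normU P u₂ ≤ Mu →
        normU P (u₁ - u₂) + normY P (y₁ - y₂) ≤ (1 + 2 * E * My / y) * (4 * E / a) *
          (eLpNorm (U₁ - U₂) (ENNReal.ofReal r) (volume.restrict Ω)).toReal :=
    fun U₁ U₂ hU₁ hU₂ u₁ u₂ y₁ y₂ h₁ h₂ g1 g2 g3 g4 =>
      (hB T hT).stability hΩ hE (le_max_left _ _) hr1 (le_max_right _ _) hΩb ha hy (hc T)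
        (by positivity) (by linarith) (by linarith) (by linarith) hαy hMt hMu hMy hcond hT'
        h₁ h₂ hU₁ hU₂ g1 g2 g3 g4
  refine ⟨fun U hU u u' z z' h₁ h₂ g1 g2 g3 g4 => ?_, key⟩
  have h := key U U hU hU u u' z z' h₁ h₂ g1 g2 g3 g4
  rw [sub_self U, eLpNorm_zero, ENNReal.toReal_zero, mul_zero] at h
  have hX := normU_nonneg P (u - u')
  have hY := normY_nonneg P (z - z')
  have hX0 : normU P (u - u') = 0 := by linarith
  have hY0 : normY P (z - z') = 0 := by linarith
  have hu := h₁.u_mem.1.sub h₂.u_mem.1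
  have hz := h₁.sub_isCR0 h₂
  -- Vanishing norms do not yet give equality, `normY` being a seminorm on the full space. The
  -- differences vanish at boundary midpoints, so the `L¹` embedding makes their cell bounds zero.
  have b1 := (hB T hT).lqU 1 le_rfl (by linarith [le_max_left 6 (r / (r - 1))]) _ hu
  have b2 := (hB T hT).lqY 1 le_rfl (by linarith [le_max_left 6 (r / (r - 1))]) _ hz
  rw [hX0, mul_zero] at b1
  rw [hY0, mul_zero] at b2
  exact ⟨sub_eq_zero.1 (eq_zero_of_wNorm_cellBound_le_zero hd0 b1),
    sub_eq_zero.1 (eq_zero_of_wNorm_cellBound_le_zero hd0 b2)⟩
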